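/- Notation. Let $d\ge 1$, $1\le p\le\infty$ (with $1/\infty=0$), $\hat f(\eta)=\int f(t)e^{-2\pi i t\cdot\eta}\,dt$, $\langle\eta\rangle=(1+|\eta|^2)^{1/2}$, and $\langle D\rangle^m f=\mathcal F^{-1}(\langle\cdot\rangle^m\hat f)$. A *Fourier integral operator (FIO) of order $m$* with phase $\Phi$ and symbol $\sigma$ is $$Tf(x)=\int_{\mathbb R^d} e^{2\pi i\Phi(x,\eta)}\sigma(x,\eta)\hat f(\eta)\,d\eta,\qquad f\in\mathcal S(\mathbb R^d),$$ where $\sigma\in C^\infty(\mathbb R^{2d})$ satisfies $|\partial_x^\alpha\partial_\eta^\beta\sigma(x,\eta)|\le C_{\alpha,\beta}\langle\eta\rangle^{m-|\beta|}$ on $\mathbb R^{2d}$ and vanishes for $x$ outside a compact set, and $\Phi$ is real-valued, positively homogeneous of degree $1$ in $\eta$, smooth on $\mathbb R^d\times(\mathbb R^d\setminus\{0\})$, with $\det(\partial^2\Phi/\partial x_i\partial\eta_l)\ne0$ there. $\mathcal FL^p_{\rm comp}$ is the space of compactly supported tempered distributions $u$ with $\|u\|_{\mathcal FL^p}=\|\hat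 u\|_{L^p}<\infty$, with the inductive limit structure over compact sets. For a window $0\ne g\in\mathcal S(\mathbb R^d)$, $M^p$ is the space of $u\in\mathcal S'(\mathbb R^d)$ with $\|u\|_{M^p}=\|V_gu\|_{L^p(\mathbb R^{2d})}<\infty$, where $V_gu(x,\eta)=\langle u, e^{2\pi i\eta\cdot}g(\cdot-x)\rangle$ (the norms for different $g$ are equivalent), and $\mathcal M^\infty$ is the closure of $\mathcal S(\mathbb R^d)$ in $M^\infty$. An operator defined on $\mathcal S(\mathbb R^d)$ is called *$p$-unbounded* here if (i) its restriction to $C_0^\infty(\mathbb R^d)$ does not extend to a bounded linear operator on $\mathcal FL^p_{\rm comp}$ (for $p=\infty$: on the closure of $C_0^\infty(\mathbb R^d)$ in $\mathcal FL^\infty_{\rm comp}$), and (ii) it does not extend to a bounded linear operator on $M^p$ (for $p=\infty$: on $\mathcal M^\infty$). Theorem. Let $m>-d\left|\frac12-\frac1p\right|$. Then there is an FIO of order $m$, with phase linear in $\eta$, which is $p$-unbounded. Explicitly, let $\varphi:\mathbb R\to\mathbb R$ be any $C^\infty$ diffeomorphism that maps $(0,1)$ onto $(0,1)$, with $|\varphi''|\ge\rho>0$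 on some nonempty open interval $I\subset(0,1)$ and $0<c\le|\varphi'|\le C$ on $\mathbb R$. Put $\tilde\varphi(x)=(\varphi(x_1),\dots,\varphi(x_d))$ and let $0\le G\in C_0^\infty(\mathbb R^d)$ with $G=1$ on $[0,1]^d$. (a) If $1\le p\le2$, the operator $Ff=G\cdot\big((\langle D\rangle^mf)\circ\tilde\varphi\big)$ is the FIO of order $m$ with phase $\tilde\varphi(x)\cdot\eta$ and symbol $G(x)\langle\eta\rangle^m$, and it is $p$-unbounded. (b) If $2<p\le\infty$ and $0\le H\in C_0^\infty(\mathbb R^d)$ with $H=1$ on $\operatorname{supp}(G\circ\tilde\varphi^{-1})$, the operator $\tilde Ff=H\cdot\langle D\rangle^m\big(T^*(Gf)\big)$, where $T^*h=|J_{\tilde\varphi}\circ\tilde\varphi^{-1}|^{-1}\,(h\circ\tilde\varphi^{-1})$ is the adjoint of $h\mapsto h\circ\tilde\varphi$ and $J_{\tilde\varphi}$ is the Jacobian determinant of $\tilde\varphi$, is an FIO of order $m$ with phase $\tilde\varphi^{-1}(x)\cdot\eta$ and some symbol, and it is $p$-unbounded. -/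

import Mathlib

open MeasureTheory Set FourierTransform Distribution
open scoped SchwartzMap ENNReal NNReal ContDiff

noncomputable section

namespace FourierInt

/-- Euclidean space of dimension `d`. -/
abbrev E (d : ℕ) : Type := EuclideanSpace ℝ (Fin d)

/-- The weight `⟨η⟩ ^ m = (1 + |η|²) ^ (m / 2)`. -/
def bracket {d : ℕ} (m : ℝ) (η : E d) : ℝ := (1 + ‖η‖ ^ 2) ^ (m / 2)

/-! ### Fourier integral operators -/

/-- The Hörmander class of order `m` and type `(1, 0)`: `σ` is smooth in `(x, η)`, and every
derivative of order `k` in `x` and `l` in `η` is bounded by a multiple of `⟨η⟩ ^ (m - l)`,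
uniformly on the whole space. -/
structure IsSymbol {d : ℕ} (m : ℝ) (σ : E d → E d → ℂ) : Prop where
  smooth : ContDiff ℝ ∞ (fun z : E d × E d => σ z.1 z.2)
  bound : ∀ k l : ℕ, ∃ C : ℝ, ∀ x η : E d,
    ‖iteratedFDeriv ℝ k (fun x' => iteratedFDeriv ℝ l (σ x') η) x‖ ≤ C * bracket (m - l) η

/-- `σ` has compact support with respect to `x`. -/
def CompactInX {d : ℕ} (σ : E d → E d → ℂ) : Prop :=
  ∃ K : Set (E d), IsCompact K ∧ ∀ x, x ∉ K → ∀ η, σ x η = 0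

/-- The matrix of the mixed second derivatives `∂² Φ / ∂ x_i ∂ η_l`. -/
def mixedHessian {d : ℕ} (Φ : E d → E d → ℝ) (x η : E d) : Matrix (Fin d) (Fin d) ℝ :=
  Matrix.of fun i l =>
    fderiv ℝ (fun x' => fderiv ℝ (Φ x') η (EuclideanSpace.single l 1)) x
      (EuclideanSpace.single i 1)

/-- A real non-degenerate phase: positively homogeneous of degree one in `η`, smooth for `η ≠ 0`,
with invertible mixed Hessian at every `(x, η)` with `η ≠ 0`. -/
structure IsPhase {d : ℕ} (Φ : E d → E d → ℝ) : Prop where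
  homogeneous : ∀ (x η : E d) (t : ℝ), η ≠ 0 → 0 < t → Φ x (t • η) = t * Φ x η
  smooth : ContDiffOn ℝ ∞ (fun z : E d × E d => Φ z.1 z.2) {z | z.2 ≠ 0}
  nondegenerate : ∀ x η : E d, η ≠ 0 → (mixedHessian Φ x η).det ≠ 0

/-- The operator `f ↦ ∫ exp (2 π i Φ(x, η)) σ(x, η) f̂(η) dη` on Schwartz functions. -/
def fio {d : ℕ} (Φ : E d → E d → ℝ) (σ : E d → E d → ℂ) (f : 𝓢(E d, ℂ)) (x : E d) : ℂ :=
  ∫ η : E d, Complex.exp (2 * Real.pi * Complex.I * (Φ x η : ℂ)) * σ x η * (𝓕 f) η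

/-- `T` is the Fourier integral operator of order `m` with phase `Φ` and symbol `σ`, the symbol
being compactly supported in `x`. -/
structure IsFourierIntegral {d : ℕ} (m : ℝ) (Φ : E d → E d → ℝ) (σ : E d → E d → ℂ)
    (T : 𝓢(E d, ℂ) → E d → ℂ) : Prop where
  phase : IsPhase Φ
  symbol : IsSymbol m σ
  compact : CompactInX σ
  eq : ∀ f x, T f x = fio Φ σ f x

/-- The tempered distribution `u` is given by the function `h`. -/
def IsGivenBy {d : ℕ} (u : 𝓢'(E d, ℂ)) (h : E d → ℂ) : Prop :=
  ∀ θ : 𝓢(E d, ℂ), u θ = ∫ x, θ x * h x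

/-! ### Fourier–Lebesgue spaces -/

/-- The space `𝓕L^p` of tempered distributions whose Fourier transform is in `L^p`. -/
def FL (d : ℕ) (p : ℝ≥0∞) [Fact (1 ≤ p)] : Submodule ℂ 𝓢'(E d, ℂ) where
  carrier := {u | ∃ h : Lp ℂ p (volume : Measure (E d)), (h : 𝓢'(E d, ℂ)) = 𝓕 u}
  add_mem' := by
    rintro u v ⟨h, hh⟩ ⟨k, hk⟩
    refine ⟨h + k, ?_⟩
    have := (Lp.toTemperedDistributionCLM ℂ (volume : Measure (E d)) p).map_add h k
    simp only [Lp.toTemperedDistributionCLM_apply] at this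
    rw [this, hh, hk, FourierTransform.fourier_add]
  zero_mem' := by
    refine ⟨0, ?_⟩
    have := (Lp.toTemperedDistributionCLM ℂ (volume : Measure (E d)) p).map_zero
    simp only [Lp.toTemperedDistributionCLM_apply] at this
    rw [this]
    exact (map_zero (fourierCLM ℂ 𝓢'(E d, ℂ))).symm
  smul_mem' := by
    rintro c u ⟨h, hh⟩
    refine ⟨c • h, ?_⟩
    have := (Lp.toTemperedDistributionCLM ℂ (volume : Measure (E d)) p).map_smul c h
    simp only [Lp.toTemperedDistributionCLM_apply] at this
    rw [this, hh, FourierTransform.fourier_smul]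

/-- The norm `‖û‖_{L^p}` of `u` in `𝓕L^p` (infinite outside `𝓕L^p`; the function representing
`û` is unique). -/
def flNorm {d : ℕ} (p : ℝ≥0∞) [Fact (1 ≤ p)] (u : 𝓢'(E d, ℂ)) : ℝ≥0∞ :=
  ⨅ (h : Lp ℂ p (volume : Measure (E d))) (_ : (h : 𝓢'(E d, ℂ)) = 𝓕 u), ‖h‖ₑ

theorem flNorm_add_le {d : ℕ} (p : ℝ≥0∞) [Fact (1 ≤ p)] (u v : 𝓢'(E d, ℂ)) :
    flNorm p (u + v) ≤ flNorm p u + flNorm p v := by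
  unfold flNorm
  simp only [ENNReal.iInf_add, ENNReal.add_iInf]
  refine le_iInf fun k => le_iInf fun hk => le_iInf fun h => le_iInf fun hh => ?_
  refine (iInf₂_le (h + k) ?_).trans (enorm_add_le h k)
  have := (Lp.toTemperedDistributionCLM ℂ (volume : Measure (E d)) p).map_add h k
  simp only [Lp.toTemperedDistributionCLM_apply] at this
  rw [this, hh, hk, FourierTransform.fourier_add]

theorem flNorm_smul_le {d : ℕ} (p : ℝ≥0∞) [Fact (1 ≤ p)] (c : ℂ) (u : 𝓢'(E d, ℂ)) (ε : ℝ≥0∞)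
    (hu : flNorm p u < ε) : flNorm p (c • u) ≤ ‖c‖ₑ * ε := by
  unfold flNorm at hu
  obtain ⟨h, hu⟩ := iInf_lt_iff.1 hu
  obtain ⟨hh, hu⟩ := iInf_lt_iff.1 hu
  refine (iInf₂_le (c • h) ?_).trans ?_
  · have := (Lp.toTemperedDistributionCLM ℂ (volume : Measure (E d)) p).map_smul c h
    simp only [Lp.toTemperedDistributionCLM_apply] at this
    rw [this, hh, FourierTransform.fourier_smul]
  · rw [enorm_smul]
    gcongr

theorem dsupport_add_subset {d : ℕ} (u v : 𝓢'(E d, ℂ)) :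
    dsupport (u + v : 𝓢'(E d, ℂ)) ⊆ dsupport u ∪ dsupport v := by
  intro x hx
  by_contra hcon
  simp only [mem_union, not_or, notMem_dsupport_iff] at hcon
  obtain ⟨⟨s, hs, hso, hxs⟩, ⟨t, ht, hto, hxt⟩⟩ := hcon
  refine (notMem_dsupport_iff (f := (u + v : 𝓢'(E d, ℂ))) x).2
    ⟨s ∩ t, fun θ hθ => ?_, hso.inter hto, hxs, hxt⟩ hx
  have h1 := hs θ (hθ.trans inter_subset_left)
  have h2 := ht θ (hθ.trans inter_subset_right)
  change u θ + v θ = 0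
  rw [h1, h2, add_zero]

theorem dsupport_smul_subset {d : ℕ} (c : ℂ) (u : 𝓢'(E d, ℂ)) :
    dsupport (c • u : 𝓢'(E d, ℂ)) ⊆ dsupport u := by
  refine dsupport_subset_dsupport fun s _ hs θ hθ => ?_
  change c • u θ = 0
  rw [hs θ hθ, smul_zero]

theorem dsupport_zero_eq {d : ℕ} : dsupport (0 : 𝓢'(E d, ℂ)) = ∅ := by
  refine eq_empty_iff_forall_notMem.2 fun x => ?_
  rw [notMem_dsupport_iff]
  exact ⟨univ, fun θ _ => rfl, isOpen_univ, mem_univ x⟩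

/-- The space `𝓕L^p_comp` of compactly supported distributions in `𝓕L^p`. -/
def FLComp (d : ℕ) (p : ℝ≥0∞) [Fact (1 ≤ p)] : Submodule ℂ 𝓢'(E d, ℂ) where
  carrier := {u | u ∈ FL d p ∧ IsCompact (dsupport u)}
  add_mem' := by
    rintro u v ⟨hu, hu'⟩ ⟨hv, hv'⟩
    exact ⟨add_mem hu hv,
      (hu'.union hv').of_isClosed_subset isClosed_dsupport (dsupport_add_subset u v)⟩
  zero_mem' := ⟨zero_mem _, by rw [dsupport_zero_eq]; exact isCompact_empty⟩
  smul_mem' := by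
    rintro c u ⟨hu, hu'⟩
    exact ⟨Submodule.smul_mem _ c hu,
      hu'.of_isClosed_subset isClosed_dsupport (dsupport_smul_subset c u)⟩

/-- The closure of the test functions in `𝓕L^p_comp`: the elements that are limits in the
`𝓕L^p` norm of test functions supported in a common compact set. -/
def FLCompClosure (d : ℕ) (p : ℝ≥0∞) [Fact (1 ≤ p)] : Submodule ℂ 𝓢'(E d, ℂ) where
  carrier := {u | u ∈ FLComp d p ∧ ∃ K : Set (E d), IsCompact K ∧ ∀ ε : ℝ≥0, 0 < ε →
    ∃ v : 𝓢(E d, ℂ), tsupport v ⊆ K ∧ flNorm p (u - (v : 𝓢'(E d, ℂ))) < ε}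
  add_mem' := by
    rintro u v ⟨hu, K, hK, hu'⟩ ⟨hv, L, hL, hv'⟩
    refine ⟨add_mem hu hv, K ∪ L, hK.union hL, fun ε hε => ?_⟩
    obtain ⟨a, ha, ha'⟩ := hu' (ε / 2) (half_pos hε)
    obtain ⟨b, hb, hb'⟩ := hv' (ε / 2) (half_pos hε)
    refine ⟨a + b, (tsupport_add a b).trans (union_subset_union ha hb), ?_⟩
    rw [map_add, add_sub_add_comm]
    refine (flNorm_add_le p _ _).trans_lt ((ENNReal.add_lt_add ha' hb').trans_le ?_)
    rw [← ENNReal.coe_add, add_halves]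
  zero_mem' := by
    refine ⟨zero_mem _, ∅, isCompact_empty, fun ε hε => ⟨0, ?_, ?_⟩⟩
    · simp [tsupport]
    · rw [map_zero, sub_zero]
      refine lt_of_le_of_lt (iInf₂_le 0 ?_) (?_ : ‖(0 : Lp ℂ p (volume : Measure (E d)))‖ₑ < ε)
      · have := (Lp.toTemperedDistributionCLM ℂ (volume : Measure (E d)) p).map_zero
        simp only [Lp.toTemperedDistributionCLM_apply] at this
        rw [this]
        exact (map_zero (fourierCLM ℂ 𝓢'(E d, ℂ))).symm
      · rw [enorm_zero]
        exact_mod_cast hε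
  smul_mem' := by
    rintro c u ⟨hu, K, hK, hu'⟩
    refine ⟨Submodule.smul_mem _ c hu, K, hK, fun ε hε => ?_⟩
    have hδ : 0 < ε / (2 * (‖c‖₊ + 1)) := by positivity
    obtain ⟨a, ha, ha'⟩ := hu' _ hδ
    refine ⟨c • a, (closure_mono (Function.support_const_smul_subset c a)).trans ha, ?_⟩
    rw [map_smul, ← smul_sub]
    refine (flNorm_smul_le p c _ _ ha').trans_lt ?_
    rw [enorm_eq_nnnorm, ← ENNReal.coe_mul, ENNReal.coe_lt_coe, mul_div_assoc',
      div_lt_iff₀ (by positivity)]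
    calc ‖c‖₊ * ε < (2 * (‖c‖₊ + 1)) * ε := by
          refine mul_lt_mul_of_pos_right ?_ hε
          have : (0 : ℝ≥0) < ‖c‖₊ + 2 := by positivity
          calc ‖c‖₊ < ‖c‖₊ + (‖c‖₊ + 2) := lt_add_of_pos_right _ this
            _ = 2 * (‖c‖₊ + 1) := by ring
      _ = ε * (2 * (‖c‖₊ + 1)) := mul_comm _ _

open Classical in
/-- `𝓕L^p_comp` for `p < ∞`, and the closure of the test functions in it for `p = ∞`. -/
def FLDomain (d : ℕ) (p : ℝ≥0∞) [Fact (1 ≤ p)] : Submodule ℂ 𝓢'(E d, ℂ) :=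
  if p = (⊤ : ℝ≥0∞) then FLCompClosure d p else FLComp d p

/-- `T`, initially defined on test functions, extends to a bounded operator on `𝓕L^p_comp`
(for `p = ∞`, on the closure of the test functions in it). A set is bounded in this inductive limit
if its elements are supported in a common compact set and it is bounded in norm. -/
def ExtendsToFLComp {d : ℕ} (p : ℝ≥0∞) [Fact (1 ≤ p)] (T : 𝓢(E d, ℂ) → E d → ℂ) : Prop :=
  ∃ S : FLDomain d p →ₗ[ℂ] FLDomain d p,
    (∀ f : 𝓢(E d, ℂ), HasCompactSupport f → ∀ h : (f : 𝓢'(E d, ℂ)) ∈ FLDomain d p,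
      IsGivenBy (S ⟨f, h⟩ : 𝓢'(E d, ℂ)) (T f)) ∧
    ∀ K : Set (E d), IsCompact K → ∃ K' : Set (E d), IsCompact K' ∧ ∃ C : ℝ≥0,
      ∀ u : FLDomain d p, dsupport (u : 𝓢'(E d, ℂ)) ⊆ K →
        dsupport (S u : 𝓢'(E d, ℂ)) ⊆ K' ∧
        flNorm p (S u : 𝓢'(E d, ℂ)) ≤ C * flNorm p (u : 𝓢'(E d, ℂ))

/-! ### Modulation spaces -/

theorem iteratedDeriv_cexp_mul (c : ℂ) (n : ℕ) :
    iteratedDeriv n (fun t : ℝ => Complex.exp (c * t)) = fun t : ℝ => c ^ n * Complex.exp (c * t) := by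
  induction n with
  | zero => simp
  | succ n ih =>
    rw [iteratedDeriv_succ, ih]
    funext t
    have h1 : HasDerivAt (fun t : ℝ => c * (t : ℂ)) (c * 1) t :=
      (Complex.ofRealCLM.hasDerivAt (x := t)).const_mul c
    have h2 := (h1.cexp).const_mul (c ^ n)
    rw [h2.deriv]
    ring

theorem hasTemperateGrowth_character {d : ℕ} (η : E d) :
    (fun y : E d => Complex.exp (-(2 * Real.pi * Complex.I) * (inner ℝ y η : ℝ))).HasTemperateGrowth := by
  have h : (fun t : ℝ => Complex.exp (-(2 * Real.pi * Complex.I) * t)).HasTemperateGrowth := by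
    refine ⟨(contDiff_const.mul Complex.ofRealCLM.contDiff).cexp, fun n => ⟨0, ‖(-(2 * Real.pi * Complex.I)) ^ n‖, fun t => ?_⟩⟩
    rw [norm_iteratedFDeriv_eq_norm_iteratedDeriv, iteratedDeriv_cexp_mul, norm_mul,
      Complex.norm_exp]
    simp
  exact h.comp (Function.hasTemperateGrowth_inner_left η)

/-- The Schwartz function `y ↦ conj (M_η T_x g (y)) = exp (-2 π i y·η) conj (g (y - x))`. -/
def conjShift {d : ℕ} (g : 𝓢(E d, ℂ)) (x η : E d) : 𝓢(E d, ℂ) :=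
  SchwartzMap.smulLeftCLM ℂ
    (fun y : E d => Complex.exp (-(2 * Real.pi * Complex.I) * (inner ℝ y η : ℝ)))
    ((g.compSubConstCLM ℂ x).postcompCLM (𝕜 := ℝ) (Complex.conjCLE : ℂ →L[ℝ] ℂ))

theorem conjShift_apply {d : ℕ} (g : 𝓢(E d, ℂ)) (x η y : E d) :
    conjShift g x η y = Complex.exp (-(2 * Real.pi * Complex.I) * (inner ℝ y η : ℝ)) *
      (starRingEnd ℂ) (g (y - x)) := by
  rw [conjShift, SchwartzMap.smulLeftCLM_apply_apply (hasTemperateGrowth_character η)]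
  rfl

/-- The short-time Fourier transform `V_g f (x, η) = ⟨f, M_η T_x g⟩`, as a function of the pair
`z = (x, η)`. -/
def stft {d : ℕ} (g : 𝓢(E d, ℂ)) (f : 𝓢'(E d, ℂ)) (z : E d × E d) : ℂ :=
  f (conjShift g z.1 z.2)

theorem stft_add {d : ℕ} (g : 𝓢(E d, ℂ)) (u v : 𝓢'(E d, ℂ)) :
    stft g (u + v) = stft g u + stft g v := rfl

theorem stft_smul {d : ℕ} (g : 𝓢(E d, ℂ)) (c : ℂ) (u : 𝓢'(E d, ℂ)) :
    stft g (c • u) = c • stft g u := rfl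

theorem stft_zero {d : ℕ} (g : 𝓢(E d, ℂ)) : stft g (0 : 𝓢'(E d, ℂ)) = 0 := rfl

/-- The norm of the modulation space `M^p` with window `g`. -/
def modNorm {d : ℕ} (g : 𝓢(E d, ℂ)) (p : ℝ≥0∞) (u : 𝓢'(E d, ℂ)) : ℝ≥0∞ :=
  eLpNorm (stft g u) p volume

/-- The modulation space `M^p`, defined with the window `g`. -/
def Mod {d : ℕ} (g : 𝓢(E d, ℂ)) (p : ℝ≥0∞) : Submodule ℂ 𝓢'(E d, ℂ) where
  carrier := {u | MemLp (stft g u) p volume}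
  add_mem' := fun hu hv => by
    change MemLp _ _ _
    rw [stft_add]
    exact MemLp.add hu hv
  zero_mem' := by
    change MemLp _ _ _
    rw [stft_zero]
    exact MemLp.zero
  smul_mem' := fun c u hu => by
    change MemLp _ _ _
    rw [stft_smul]
    exact MemLp.const_smul hu c

/-- The closure of the Schwartz class in `M^p`. -/
def ModClosure {d : ℕ} (g : 𝓢(E d, ℂ)) (p : ℝ≥0∞) [Fact (1 ≤ p)] : Submodule ℂ 𝓢'(E d, ℂ) where
  carrier := {u | u ∈ Mod g p ∧ ∀ ε : ℝ≥0, 0 < ε → ∃ v : 𝓢(E d, ℂ),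
    (v : 𝓢'(E d, ℂ)) ∈ Mod g p ∧ modNorm g p (u - (v : 𝓢'(E d, ℂ))) < ε}
  add_mem' := by
    rintro u v ⟨hu, hu'⟩ ⟨hv, hv'⟩
    refine ⟨add_mem hu hv, fun ε hε => ?_⟩
    obtain ⟨a, ha, ha'⟩ := hu' (ε / 2) (half_pos hε)
    obtain ⟨b, hb, hb'⟩ := hv' (ε / 2) (half_pos hε)
    refine ⟨a + b, by rw [map_add]; exact add_mem ha hb, ?_⟩
    rw [map_add, add_sub_add_comm]
    unfold modNorm at *
    rw [stft_add]
    refine (eLpNorm_add_le (sub_mem hu ha : _ ∈ Mod g p).1 (sub_mem hv hb : _ ∈ Mod g p).1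
      Fact.out).trans_lt ((ENNReal.add_lt_add ha' hb').trans_le ?_)
    rw [← ENNReal.coe_add, add_halves]
  zero_mem' := by
    refine ⟨zero_mem _, fun ε hε => ⟨0, by rw [map_zero]; exact zero_mem _, ?_⟩⟩
    rw [map_zero, sub_zero, modNorm, stft_zero, eLpNorm_zero]
    exact_mod_cast hε
  smul_mem' := by
    rintro c u ⟨hu, hu'⟩
    refine ⟨Submodule.smul_mem _ c hu, fun ε hε => ?_⟩
    have hδ : 0 < ε / (2 * (‖c‖₊ + 1)) := by positivity
    obtain ⟨a, ha, ha'⟩ := hu' _ hδ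
    refine ⟨c • a, by rw [map_smul]; exact Submodule.smul_mem _ c ha, ?_⟩
    rw [map_smul, ← smul_sub]
    unfold modNorm at *
    rw [stft_smul, eLpNorm_const_smul]
    refine (mul_le_mul_right ha'.le _).trans_lt ?_
    rw [enorm_eq_nnnorm, ← ENNReal.coe_mul, ENNReal.coe_lt_coe, mul_div_assoc',
      div_lt_iff₀ (by positivity)]
    calc ‖c‖₊ * ε < (2 * (‖c‖₊ + 1)) * ε := by
          refine mul_lt_mul_of_pos_right ?_ hε
          have : (0 : ℝ≥0) < ‖c‖₊ + 2 := by positivity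
          calc ‖c‖₊ < ‖c‖₊ + (‖c‖₊ + 2) := lt_add_of_pos_right _ this
            _ = 2 * (‖c‖₊ + 1) := by ring
      _ = ε * (2 * (‖c‖₊ + 1)) := mul_comm _ _

open Classical in
/-- `M^p` for `p < ∞`, and the closure of the Schwartz class in `M^∞` for `p = ∞`. -/
def ModDomain {d : ℕ} (g : 𝓢(E d, ℂ)) (p : ℝ≥0∞) [Fact (1 ≤ p)] : Submodule ℂ 𝓢'(E d, ℂ) :=
  if p = (⊤ : ℝ≥0∞) then ModClosure g p else Mod g p

/-- `T`, initially defined on the Schwartz class, extends to a bounded operator on `M^p`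
(for `p = ∞`, on the closure of the Schwartz class in `M^∞`). -/
def ExtendsToMod {d : ℕ} (g : 𝓢(E d, ℂ)) (p : ℝ≥0∞) [Fact (1 ≤ p)]
    (T : 𝓢(E d, ℂ) → E d → ℂ) : Prop :=
  ∃ S : ModDomain g p →ₗ[ℂ] ModDomain g p,
    (∀ (f : 𝓢(E d, ℂ)) (h : (f : 𝓢'(E d, ℂ)) ∈ ModDomain g p),
      IsGivenBy (S ⟨f, h⟩ : 𝓢'(E d, ℂ)) (T f)) ∧
    ∃ C : ℝ≥0, ∀ u : ModDomain g p,
      modNorm g p (S u : 𝓢'(E d, ℂ)) ≤ C * modNorm g p (u : 𝓢'(E d, ℂ))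

/-! ### The explicit operators -/

/-- A smooth diffeomorphism of the line that maps `(0, 1)` onto itself, is not linear there, and
whose derivative is bounded above and away from zero in absolute value. -/
structure IsNonlinearDiffeo (φ : ℝ ≃ ℝ) : Prop where
  smooth : ContDiff ℝ ∞ φ
  smooth_symm : ContDiff ℝ ∞ φ.symm
  image : φ '' Ioo 0 1 = Ioo 0 1
  nonlinear : ∃ a b ρ : ℝ, 0 ≤ a ∧ a < b ∧ b ≤ 1 ∧ 0 < ρ ∧
    ∀ t ∈ Ioo a b, ρ ≤ |iteratedDeriv 2 φ t|
  deriv_bounds : ∃ c C : ℝ, 0 < c ∧ ∀ t, c ≤ |deriv φ t| ∧ |deriv φ t| ≤ C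

/-- The product map `(x_1, …, x_d) ↦ (φ (x_1), …, φ (x_d))`. -/
def prodMap {d : ℕ} (φ : ℝ → ℝ) (x : E d) : E d := WithLp.toLp 2 fun i => φ (x i)

/-- The phase `ψ(x) · η`, linear in `η`. -/
def linearPhase {d : ℕ} (ψ : E d → E d) (x η : E d) : ℝ := inner ℝ (ψ x) η

/-- A non-negative test function. -/
structure IsCutoff {d : ℕ} (G : E d → ℝ) : Prop where
  smooth : ContDiff ℝ ∞ G
  compact : HasCompactSupport G
  nonneg : ∀ x, 0 ≤ G x

/-- The Fourier multiplier `⟨D⟩ ^ m`. -/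
def japD {d : ℕ} (m : ℝ) (h : E d → ℂ) : E d → ℂ :=
  𝓕⁻ (fun η : E d => (bracket m η : ℂ) * (𝓕 h) η)

/-- The adjoint of the composition operator `h ↦ h ∘ φ̃` with the product map `φ̃` of `φ`. -/
def compAdjoint {d : ℕ} (φ : ℝ ≃ ℝ) (h : E d → ℂ) (x : E d) : ℂ :=
  ((|(fderiv ℝ (prodMap (d := d) φ) (prodMap φ.symm x)).det|⁻¹ : ℝ) : ℂ) * h (prodMap φ.symm x)

/-- The operator `F f = G · ((⟨D⟩ ^ m f) ∘ φ̃)`. -/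
def opF {d : ℕ} (m : ℝ) (φ : ℝ ≃ ℝ) (G : E d → ℝ) (f : 𝓢(E d, ℂ)) (x : E d) : ℂ :=
  (G x : ℂ) * japD m f (prodMap φ x)

/-- The operator `F̃ f = H · ⟨D⟩ ^ m (T* (G f))`, where `T*` is the adjoint of `h ↦ h ∘ φ̃`. -/
def opFtilde {d : ℕ} (m : ℝ) (φ : ℝ ≃ ℝ) (G H : E d → ℝ) (f : 𝓢(E d, ℂ)) (x : E d) : ℂ :=
  (H x : ℂ) * japD m (compAdjoint φ fun y => (G y : ℂ) * f y) x

end FourierInt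

end

/-! Unboundedness. Put $e_l(y)=e^{2\pi i l(y_1+\dots+y_d)}$. The wave packet $G e_l$ has a norm
independent of $l$ in $\mathcal FL^p$ and in $M^p$, since modulation only translates the frequency
variable. On such a packet $\langle D\rangle^m$ acts to leading order as the scalar $d^{m/2}l^m$,
because $|(l,\dots,l)|^2=d\,l^2$. Composing with $\tilde\varphi$ turns the packet into a chirp with
phase $l\sum\varphi(x_i)$. Where $\varphi''\ne0$, van der Corput's second derivative test gives a
bound $O(l^{-d/2})$ for the Fourier transform of the chirp, uniformly in the frequency, while its
$L^2$ norm is constant in $l$. Interpolation then makes the $q$-norm of the chirp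
$O(l^{-d(1/2-1/q)})$ for $q\ge2$. For $p\le2$ the packet is fed to the operator and the output is
paired with a chirp in the conjugate exponent $q\ge2$. The pairing is $l^m$ times a quantity with
positive limit, so boundedness would force $l^m\lesssim l^{-d|1/2-1/p|}$, which is false for large
$l$. For $p>2$ the roles are exchanged: the chirp is the input, and the packet, of constant norm in
the conjugate exponent, is the test function. These are `not_isLocallyBounded_opF` and
`not_isLocallyBounded_opFtilde`. They use only duality, modulation invariance and interpolation,
collected in `IsDualScale`, so both scales of spaces are treated at once.

Fourier integral form. For `opF` the symbol is explicit. For `opFtilde` a symbol must be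
constructed. With $s>0$, $\langle D\rangle^{-2s}$ is convolution with a finite measure, the Gamma
mixture of Gaussians `besselLaw`. Hence $H\langle D\rangle^{-2s}(a\cdot f\circ\psi)$ has phase
$\psi(x)\cdot\eta$ and symbol $\int A(x,z)e^{2\pi i(\psi(x-z)-\psi(x))\cdot\eta}\,d\nu(z)$ with
$A(x,z)=H(x)a(x-z)$. The key estimate `norm_oscInt_besselLaw_le` says that an amplitude vanishing to
order $l$ at $z=0$ gives decay $\langle\eta\rangle^{-2s-l}$. An $\eta$-derivative brings out an
increment of $\psi$, which vanishes at $z=0$ and gains an order. An $x$-derivative brings out an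
increment of $\psi'$ times a coordinate of $\eta$, which is neutral. So the class generated by these
integrals and by multiplication by coordinates is closed under differentiation, and all symbol
estimates reduce to the bound of order zero. Larger orders follow from $\langle
D\rangle^{2k-2s}=\langle D\rangle^{-2s}(1-\Delta/4\pi^2)^k$ and the chain rule. -/

open MeasureTheory Set FourierTransform Distribution
open scoped SchwartzMap ENNReal NNReal ContDiff

noncomputable section

namespace FourierInt

/-! ### Generating symbol classes -/

section SymbolClasses

variable {d : ℕ} {V : Type*} [NormedAddCommGroup V] [NormedSpace ℝ V]

/-- The vector-valued one-form `v ⊗ dx_i`, depending linearly on `v`. -/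
def coordForm (d : ℕ) (V : Type*) [NormedAddCommGroup V] [NormedSpace ℝ V] (i : Fin d) :
    V →L[ℝ] (E d →L[ℝ] V) :=
  ContinuousLinearMap.smulRightL ℝ (E d) V (EuclideanSpace.proj i)

theorem coordForm_apply (i : Fin d) (v : V) (w : E d) : coordForm d V i v w = w i • v := rfl

theorem sum_coord_single (w : E d) : ∑ i, w i • (EuclideanSpace.single i (1 : ℝ) : E d) = w := by
  ext j
  simp [Finset.sum_apply, Pi.single_apply]

theorem eq_sum_coordForm (L : E d →L[ℝ] V) :
    L = ∑ i, coordForm d V i (L (EuclideanSpace.single i 1)) := by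
  ext w
  conv_lhs => rw [← sum_coord_single w]
  simp [coordForm_apply]

/-- The derivative splits as $\sum_i\partial_if\otimes dx_i$ with fixed continuous linear maps, so
only the partial derivatives need to be estimated. -/
theorem norm_iteratedFDeriv_succ_le {f : E d → V} (hf : ContDiff ℝ ∞ f) (k : ℕ) (x : E d) :
    ‖iteratedFDeriv ℝ (k + 1) f x‖ ≤ ∑ i, ‖coordForm d V i‖ *
      ‖iteratedFDeriv ℝ k (fun y => fderiv ℝ f y (EuclideanSpace.single i 1)) x‖ := by
  rw [← norm_iteratedFDeriv_fderiv]
  have h1 : fderiv ℝ f = fun y => ∑ i, (coordForm d V i ∘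
      fun y => fderiv ℝ f y (EuclideanSpace.single i 1)) y :=
    funext fun y => eq_sum_coordForm _
  have hf' : ContDiff ℝ ∞ (fderiv ℝ f) := hf.fderiv_right (by simp)
  have h2 : ∀ i, ContDiff ℝ ∞ fun y => fderiv ℝ f y (EuclideanSpace.single i (1 : ℝ)) :=
    fun i => hf'.clm_apply contDiff_const
  conv_lhs => rw [h1]
  rw [iteratedFDeriv_fun_sum_apply (fun i _ => (((coordForm d V i).contDiff.comp (h2 i)).of_le
    (by exact_mod_cast le_top)).contDiffAt)]
  refine (norm_sum_le _ _).trans (Finset.sum_le_sum fun i _ => ?_)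
  exact (coordForm d V i).norm_iteratedFDeriv_comp_left (h2 i).contDiffAt (by exact_mod_cast le_top)

/-- The map through which an iterated derivative of order `l` of `∂_i f` enters the iterated
derivative of order `l + 1` of `f`. -/
def coordFormIter (d : ℕ) (V : Type*) [NormedAddCommGroup V] [NormedSpace ℝ V] (l : ℕ) (i : Fin d) :
    (E d [×l]→L[ℝ] V) →L[ℝ] (E d [×(l + 1)]→L[ℝ] V) :=
  ((continuousMultilinearCurryRightEquiv' ℝ l (E d) V).symm.toContinuousLinearEquiv :
    (E d [×l]→L[ℝ] (E d →L[ℝ] V)) →L[ℝ] (E d [×(l + 1)]→L[ℝ] V)) ∘L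
  (ContinuousLinearMap.compContinuousMultilinearMapL ℝ (fun _ : Fin l => E d) V
    (E d →L[ℝ] V) (coordForm d V i))

/-- An identity is needed here instead of a bound: for mixed derivatives the right side is
differentiated again in $x$, and the maps `coordFormIter` are constant, hence commute with that. -/
theorem iteratedFDeriv_succ_eq_sum {f : E d → V} (hf : ContDiff ℝ ∞ f) (l : ℕ) (x : E d) :
    iteratedFDeriv ℝ (l + 1) f x = ∑ i, coordFormIter d V l i
      (iteratedFDeriv ℝ l (fun y => fderiv ℝ f y (EuclideanSpace.single i 1)) x) := by
  have h1 : (fun y => fderiv ℝ f y) = fun y => ∑ i, (coordForm d V i ∘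
      fun y => fderiv ℝ f y (EuclideanSpace.single i 1)) y :=
    funext fun y => eq_sum_coordForm _
  have hf' : ContDiff ℝ ∞ (fderiv ℝ f) := hf.fderiv_right (by simp)
  have h2 : ∀ i, ContDiff ℝ ∞ fun y => fderiv ℝ f y (EuclideanSpace.single i (1 : ℝ)) :=
    fun i => hf'.clm_apply contDiff_const
  rw [iteratedFDeriv_succ_eq_comp_right, Function.comp_apply, h1,
    iteratedFDeriv_fun_sum_apply (fun i _ => (((coordForm d V i).contDiff.comp (h2 i)).of_le
    (by exact_mod_cast le_top)).contDiffAt)]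
  refine (map_sum ((continuousMultilinearCurryRightEquiv' ℝ l (E d) V).symm.toContinuousLinearEquiv :
    (E d [×l]→L[ℝ] (E d →L[ℝ] V)) →L[ℝ] (E d [×(l + 1)]→L[ℝ] V)) _ _).trans ?_
  refine Finset.sum_congr rfl fun i _ => ?_
  rw [(coordForm d V i).iteratedFDeriv_comp_left (h2 i).contDiffAt (by exact_mod_cast le_top)]
  rfl

/-- A graded family of functions of `(x, η)` that is closed under differentiation, every derivative
in `η` lowering the order by one, with the bounds of a symbol at order zero. -/
structure SymbolFamily (𝒜 : ℝ → (E d × E d → ℂ) → Prop) : Prop where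
  diff : ∀ {n σ}, 𝒜 n σ → Differentiable ℝ σ
  deriv_left : ∀ {n σ}, 𝒜 n σ → ∀ i, 𝒜 n fun z => fderiv ℝ σ z (EuclideanSpace.single i 1, 0)
  deriv_right : ∀ {n σ}, 𝒜 n σ → ∀ i,
    𝒜 (n - 1) fun z => fderiv ℝ σ z (0, EuclideanSpace.single i 1)
  bound : ∀ {n σ}, 𝒜 n σ → ∃ C : ℝ, ∀ z, ‖σ z‖ ≤ C * bracket n z.2

namespace SymbolFamily

variable {𝒜 : ℝ → (E d × E d → ℂ) → Prop}

/-- The total derivative is assembled from the partial derivatives, which again belong to the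
family, so the regularity bootstraps one degree at a time. -/
theorem contDiff_nat (h : SymbolFamily 𝒜) (k : ℕ) :
    ∀ {n σ}, 𝒜 n σ → ContDiff ℝ k σ := by
  induction k with
  | zero => exact fun hσ => contDiff_zero.2 (h.diff hσ).continuous
  | succ k ih =>
    intro n σ hσ
    push_cast
    rw [contDiff_succ_iff_fderiv]
    refine ⟨h.diff hσ, by simp, ?_⟩
    have key : fderiv ℝ σ = fun z =>
        (∑ i, coordForm d ℂ i (fderiv ℝ σ z (EuclideanSpace.single i 1, 0))) ∘L
          ContinuousLinearMap.fst ℝ (E d) (E d) +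
        (∑ i, coordForm d ℂ i (fderiv ℝ σ z (0, EuclideanSpace.single i 1))) ∘L
          ContinuousLinearMap.snd ℝ (E d) (E d) := by
      funext z
      have h1 := eq_sum_coordForm (fderiv ℝ σ z ∘L ContinuousLinearMap.inl ℝ (E d) (E d))
      have h2 := eq_sum_coordForm (fderiv ℝ σ z ∘L ContinuousLinearMap.inr ℝ (E d) (E d))
      simp only [ContinuousLinearMap.comp_apply, ContinuousLinearMap.inl_apply,
        ContinuousLinearMap.inr_apply] at h1 h2
      rw [← h1, ← h2]
      refine ContinuousLinearMap.ext fun w => ?_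
      simp [← map_add]
    rw [key]
    refine ContDiff.add (ContDiff.clm_comp (ContDiff.sum fun i _ => ?_) contDiff_const)
      (ContDiff.clm_comp (ContDiff.sum fun i _ => ?_) contDiff_const)
    · exact (coordForm d ℂ i).contDiff.comp (ih (h.deriv_left hσ i))
    · exact (coordForm d ℂ i).contDiff.comp (ih (h.deriv_right hσ i))

theorem contDiff (h : SymbolFamily 𝒜) {n σ} (hσ : 𝒜 n σ) : ContDiff ℝ ∞ σ :=
  contDiff_infty.2 fun k => h.contDiff_nat k hσ

theorem fderiv_left (h : SymbolFamily 𝒜) {n σ} (hσ : 𝒜 n σ) (x η v : E d) :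
    fderiv ℝ (fun x' => σ (x', η)) x v = fderiv ℝ σ (x, η) (v, 0) := by
  have := ((h.diff hσ) (x, η)).hasFDerivAt.comp (f := fun x' => (x', η)) x
    (hasFDerivAt_prodMk_left x η)
  rw [show (fun x' => σ (x', η)) = σ ∘ fun x' => (x', η) from rfl, this.fderiv]
  rfl

theorem fderiv_right (h : SymbolFamily 𝒜) {n σ} (hσ : 𝒜 n σ) (x η v : E d) :
    fderiv ℝ (fun η' => σ (x, η')) η v = fderiv ℝ σ (x, η) (0, v) := by
  have := ((h.diff hσ) (x, η)).hasFDerivAt.comp (f := fun η' => (x, η')) η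
    (hasFDerivAt_prodMk_right x η)
  rw [show (fun η' => σ (x, η')) = σ ∘ fun η' => (x, η') from rfl, this.fderiv]
  rfl

theorem contDiff_left (h : SymbolFamily 𝒜) {n σ} (hσ : 𝒜 n σ) (η : E d) :
    ContDiff ℝ ∞ fun x => σ (x, η) :=
  (h.contDiff hσ).comp (contDiff_id.prodMk contDiff_const)

theorem contDiff_right (h : SymbolFamily 𝒜) {n σ} (hσ : 𝒜 n σ) (x : E d) :
    ContDiff ℝ ∞ fun η => σ (x, η) :=
  (h.contDiff hσ).comp (contDiff_const.prodMk contDiff_id)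

theorem iteratedFDeriv_right_succ (h : SymbolFamily 𝒜) {n σ} (hσ : 𝒜 n σ) (l : ℕ) (x η : E d) :
    iteratedFDeriv ℝ (l + 1) (fun η' => σ (x, η')) η = ∑ i, coordFormIter d ℂ l i
      (iteratedFDeriv ℝ l
        (fun η' => fderiv ℝ σ (x, η') (0, EuclideanSpace.single i 1)) η) := by
  rw [iteratedFDeriv_succ_eq_sum (h.contDiff_right hσ x)]
  simp only [h.fderiv_right hσ]

theorem contDiff_iteratedFDeriv_right (h : SymbolFamily 𝒜) (l : ℕ) (η : E d) : ∀ {n σ}, 𝒜 n σ →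
    ContDiff ℝ ∞ fun x => iteratedFDeriv ℝ l (fun η' => σ (x, η')) η := by
  induction l with
  | zero =>
    intro n σ hσ
    simp only [iteratedFDeriv_zero_eq_comp]
    exact (ContinuousLinearEquiv.contDiff
      (continuousMultilinearCurryFin0 ℝ (E d) ℂ).symm.toContinuousLinearEquiv).comp
      (h.contDiff_left hσ η)
  | succ l ih =>
    intro n σ hσ
    simp only [h.iteratedFDeriv_right_succ hσ]
    exact ContDiff.sum fun i _ => (coordFormIter d ℂ l i).contDiff.comp (ih (h.deriv_right hσ i))

theorem bound_left (h : SymbolFamily 𝒜) (k : ℕ) : ∀ {n σ}, 𝒜 n σ →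
    ∃ C : ℝ, ∀ x η : E d, ‖iteratedFDeriv ℝ k (fun x' => σ (x', η)) x‖ ≤ C * bracket n η := by
  induction k with
  | zero =>
    intro n σ hσ
    obtain ⟨C, hC⟩ := h.bound hσ
    exact ⟨C, fun x η => by simpa using hC (x, η)⟩
  | succ k ih =>
    intro n σ hσ
    choose C hC using fun i => ih (h.deriv_left hσ i)
    refine ⟨∑ i, ‖coordForm d ℂ i‖ * C i, fun x η => ?_⟩
    refine (norm_iteratedFDeriv_succ_le (h.contDiff_left hσ η) k x).trans ?_
    rw [Finset.sum_mul]
    refine Finset.sum_le_sum fun i _ => ?_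
    rw [mul_assoc]
    simp only [h.fderiv_left hσ]
    exact mul_le_mul_of_nonneg_left (hC i x η) (norm_nonneg (coordForm d ℂ i))

/-- Induction on the number of $\eta$-derivatives: the innermost one is replaced by partial
derivatives, which lie in the family one order lower. The base case is `bound_left`. -/
theorem bound_mixed (h : SymbolFamily 𝒜) (k l : ℕ) : ∀ {n σ}, 𝒜 n σ →
    ∃ C : ℝ, ∀ x η : E d,
      ‖iteratedFDeriv ℝ k (fun x' => iteratedFDeriv ℝ l (fun η' => σ (x', η')) η) x‖
        ≤ C * bracket (n - l) η := by
  induction l with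
  | zero =>
    intro n σ hσ
    obtain ⟨C, hC⟩ := h.bound_left k hσ
    refine ⟨C, fun x η => ?_⟩
    have := (continuousMultilinearCurryFin0 ℝ (E d) ℂ).symm.norm_iteratedFDeriv_comp_left
      (fun x' => σ (x', η)) x k
    simp only [iteratedFDeriv_zero_eq_comp, Nat.cast_zero, sub_zero]
    refine le_trans (le_of_eq ?_) (hC x η)
    exact this
  | succ l ih =>
    intro n σ hσ
    choose C hC using fun i => ih (h.deriv_right hσ i)
    refine ⟨∑ i, ‖coordFormIter d ℂ l i‖ * C i, fun x η => ?_⟩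
    have h2 := fun i => h.contDiff_iteratedFDeriv_right l η (h.deriv_right hσ i)
    simp only [h.iteratedFDeriv_right_succ hσ]
    rw [iteratedFDeriv_fun_sum_apply (f := fun i x' => coordFormIter d ℂ l i (iteratedFDeriv ℝ l
      (fun η' => fderiv ℝ σ (x', η') (0, EuclideanSpace.single i 1)) η))
      (fun i _ => (((coordFormIter d ℂ l i).contDiff.comp (h2 i)).of_le
      (by exact_mod_cast le_top)).contDiffAt)]
    refine (norm_sum_le _ _).trans ?_
    rw [Finset.sum_mul]
    refine Finset.sum_le_sum fun i _ => ?_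
    refine ((coordFormIter d ℂ l i).norm_iteratedFDeriv_comp_left (h2 i).contDiffAt
      (by exact_mod_cast le_top)).trans ?_
    rw [mul_assoc]
    refine mul_le_mul_of_nonneg_left ((hC i x η).trans_eq ?_)
      (norm_nonneg (coordFormIter d ℂ l i))
    push_cast
    rw [sub_sub, add_comm]

theorem isSymbol (h : SymbolFamily 𝒜) {m σ} (hσ : 𝒜 m σ) : IsSymbol m fun x η => σ (x, η) :=
  ⟨h.contDiff hσ, fun k l => h.bound_mixed k l hσ⟩

end SymbolFamily

/-- The graded family generated by `𝓑` under sums, multiples, and multiplication by the coordinates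
`η_i`, which raises the order by one. -/
inductive Generated (𝓑 : ℝ → (E d × E d → ℂ) → Prop) : ℝ → (E d × E d → ℂ) → Prop
  | base {n σ} : 𝓑 n σ → Generated 𝓑 n σ
  | add {n σ τ} : Generated 𝓑 n σ → Generated 𝓑 n τ → Generated 𝓑 n fun z => σ z + τ z
  | smul {n σ} (c : ℂ) : Generated 𝓑 n σ → Generated 𝓑 n fun z => c * σ z
  | coord {n σ} (i : Fin d) : Generated 𝓑 n σ → Generated 𝓑 (n + 1) fun z => (z.2 i : ℂ) * σ z

theorem one_le_one_add_normSq (η : E d) : 1 ≤ 1 + ‖η‖ ^ 2 := by nlinarith [sq_nonneg ‖η‖]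

theorem bracket_pos (m : ℝ) (η : E d) : 0 < bracket m η :=
  Real.rpow_pos_of_pos (by positivity) _

theorem bracket_add (m n : ℝ) (η : E d) : bracket (m + n) η = bracket m η * bracket n η := by
  rw [bracket, bracket, bracket, ← Real.rpow_add (by positivity), add_div]

theorem norm_le_bracket_one (η : E d) : ‖η‖ ≤ bracket 1 η := by
  rw [bracket, ← Real.sqrt_eq_rpow]
  exact Real.le_sqrt_of_sq_le (by linarith)

theorem abs_coord_le_norm (η : E d) (i : Fin d) : |η i| ≤ ‖η‖ := by
  simpa using PiLp.norm_apply_le η i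

theorem fderiv_coord_mul (i : Fin d) {σ : E d × E d → ℂ} (hσ : Differentiable ℝ σ)
    (z w : E d × E d) : fderiv ℝ (fun z : E d × E d => (z.2 i : ℂ) * σ z) z w =
      (w.2 i : ℂ) * σ z + (z.2 i : ℂ) * fderiv ℝ σ z w := by
  let L : E d × E d →L[ℝ] ℂ :=
    Complex.ofRealCLM ∘L EuclideanSpace.proj i ∘L ContinuousLinearMap.snd ℝ (E d) (E d)
  have h1 : HasFDerivAt (fun z : E d × E d => (z.2 i : ℂ)) L z := L.hasFDerivAt
  rw [(h1.fun_mul (hσ z).hasFDerivAt).fderiv]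
  have : L w = (w.2 i : ℂ) := rfl
  simp [this]
  ring

/-- By linearity and the Leibniz rule, closure under differentiation and the size bound only have to
be checked on generators. -/
theorem Generated.symbolFamily {𝓑 : ℝ → (E d × E d → ℂ) → Prop}
    (diff : ∀ {n σ}, 𝓑 n σ → Differentiable ℝ σ)
    (left : ∀ {n σ}, 𝓑 n σ → ∀ i,
      Generated 𝓑 n fun z => fderiv ℝ σ z (EuclideanSpace.single i 1, 0))
    (right : ∀ {n σ}, 𝓑 n σ → ∀ i,
      Generated 𝓑 (n - 1) fun z => fderiv ℝ σ z (0, EuclideanSpace.single i 1))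
    (bound : ∀ {n σ}, 𝓑 n σ → ∃ C : ℝ, ∀ z, ‖σ z‖ ≤ C * bracket n z.2) :
    SymbolFamily (Generated 𝓑) := by
  have hdiff : ∀ {n σ}, Generated 𝓑 n σ → Differentiable ℝ σ := by
    intro n σ h
    induction h with
    | base h => exact diff h
    | add _ _ h1 h2 => exact h1.add h2
    | smul c _ h => exact h.const_mul c
    | coord i _ h =>
      exact (Complex.ofRealCLM ∘L EuclideanSpace.proj i ∘L
        ContinuousLinearMap.snd ℝ (E d) (E d)).differentiable.mul h
  refine ⟨hdiff, ?_, ?_, ?_⟩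
  · intro n σ h i
    induction h with
    | base h => exact left h i
    | add h1 h2 ih1 ih2 =>
      convert ih1.add ih2 using 2 with z
      rw [fderiv_fun_add (hdiff h1 z) (hdiff h2 z)]
      rfl
    | smul c h ih =>
      convert ih.smul c using 2 with z
      rw [fderiv_const_mul (hdiff h z)]
      rfl
    | coord j h ih =>
      convert ih.coord j using 2 with z
      rw [fderiv_coord_mul j (hdiff h)]
      simp
  · intro n σ h i
    induction h with
    | base h => exact right h i
    | add h1 h2 ih1 ih2 =>
      convert ih1.add ih2 using 2 with z
      rw [fderiv_fun_add (hdiff h1 z) (hdiff h2 z)]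
      rfl
    | smul c h ih =>
      convert ih.smul c using 2 with z
      rw [fderiv_const_mul (hdiff h z)]
      rfl
    -- Since $\partial_i(\eta_j\sigma)=\delta_{ij}\sigma+\eta_j\partial_i\sigma$, both terms have
    -- order $n=(n+1)-1$.
    | @coord n σ j h ih =>
      have h2 := ih.coord j
      rw [sub_add_cancel] at h2
      rw [add_sub_cancel_right]
      convert (h.smul (((EuclideanSpace.single i (1 : ℝ) : E d) j : ℝ) : ℂ)).add h2 using 2 with z
      rw [fderiv_coord_mul j (hdiff h)]
  · intro n σ h
    induction h with
    | base h => exact bound h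
    | add _ _ h1 h2 =>
      obtain ⟨C, hC⟩ := h1
      obtain ⟨D, hD⟩ := h2
      exact ⟨C + D, fun z => (norm_add_le _ _).trans (by linarith [hC z, hD z])⟩
    | smul c _ h =>
      obtain ⟨C, hC⟩ := h
      refine ⟨‖c‖ * C, fun z => ?_⟩
      rw [norm_mul, mul_assoc]
      exact mul_le_mul_of_nonneg_left (hC z) (norm_nonneg _)
    | @coord n σ i _ h =>
      obtain ⟨C, hC⟩ := h
      refine ⟨C, fun z => ?_⟩
      have h1 : ‖((z.2 i : ℝ) : ℂ)‖ ≤ bracket 1 z.2 := by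
        rw [Complex.norm_real]
        exact (abs_coord_le_norm z.2 i).trans (norm_le_bracket_one _)
      rw [norm_mul, bracket_add]
      calc ‖((z.2 i : ℝ) : ℂ)‖ * ‖σ z‖ ≤ bracket 1 z.2 * (C * bracket n z.2) :=
            mul_le_mul h1 (hC z) (norm_nonneg _) (bracket_pos _ _).le
        _ = C * (bracket n z.2 * bracket 1 z.2) := by ring

end SymbolClasses

/-! ### Product maps, linear phases and the operator `opF` -/

section ProductMaps

variable {d : ℕ}

theorem prodMap_apply (φ : ℝ → ℝ) (x : E d) (i : Fin d) : prodMap φ x i = φ (x i) := rfl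

theorem contDiff_coord (i : Fin d) : ContDiff ℝ ∞ fun x : E d => x i :=
  (EuclideanSpace.proj i : E d →L[ℝ] ℝ).contDiff

theorem contDiff_prodMap {φ : ℝ → ℝ} (hφ : ContDiff ℝ ∞ φ) :
    ContDiff ℝ ∞ (prodMap φ : E d → E d) := by
  rw [contDiff_euclidean]
  exact fun i => hφ.comp (contDiff_coord i)

theorem hasFDerivAt_comp_coord {φ : ℝ → ℝ} (hφ : ContDiff ℝ ∞ φ) (i : Fin d) (x : E d) :
    HasFDerivAt (fun x : E d => φ (x i))
      (deriv φ (x i) • (EuclideanSpace.proj i : E d →L[ℝ] ℝ)) x :=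
  HasDerivAt.comp_hasFDerivAt x ((hφ.differentiable (by simp)) (x i)).hasDerivAt
    (EuclideanSpace.proj i : E d →L[ℝ] ℝ).hasFDerivAt

theorem prodMap_symm_prodMap (φ : ℝ ≃ ℝ) (x : E d) : prodMap φ.symm (prodMap φ x) = x := by
  ext i
  simp [prodMap_apply]

theorem prodMap_prodMap_symm (φ : ℝ ≃ ℝ) (x : E d) : prodMap φ (prodMap φ.symm x) = x := by
  ext i
  simp [prodMap_apply]

theorem fderiv_prodMap_apply {φ : ℝ → ℝ} (hφ : ContDiff ℝ ∞ φ) (x v : E d) (i : Fin d) :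
    fderiv ℝ (prodMap φ : E d → E d) x v i = deriv φ (x i) * v i := by
  have h1 := (((contDiff_prodMap (d := d) hφ).differentiable (by simp)) x).hasFDerivAt
  have h2 := (EuclideanSpace.proj i : E d →L[ℝ] ℝ).hasFDerivAt.comp x h1
  have h3 := h2.unique (hasFDerivAt_comp_coord hφ i x)
  simpa using congrArg (fun L => L v) h3

theorem det_fderiv_prodMap {φ : ℝ → ℝ} (hφ : ContDiff ℝ ∞ φ) (x : E d) :
    (fderiv ℝ (prodMap φ : E d → E d) x).det = ∏ i, deriv φ (x i) := by
  let b := (EuclideanSpace.basisFun (Fin d) ℝ).toBasis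
  have h : LinearMap.toMatrix b b (fderiv ℝ (prodMap φ : E d → E d) x : E d →ₗ[ℝ] E d) =
      Matrix.diagonal fun i => deriv φ (x i) := by
    ext i j
    rw [LinearMap.toMatrix_apply]
    simp only [b, OrthonormalBasis.coe_toBasis, EuclideanSpace.basisFun_apply,
      OrthonormalBasis.coe_toBasis_repr_apply, EuclideanSpace.basisFun_repr,
      ContinuousLinearMap.coe_coe]
    rw [fderiv_prodMap_apply hφ]
    by_cases hij : i = j
    · subst hij; simp
    · simp [hij]
  rw [ContinuousLinearMap.det, ← LinearMap.det_toMatrix b, h, Matrix.det_diagonal]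

theorem mixedHessian_linearPhase {φ : ℝ → ℝ} (hφ : ContDiff ℝ ∞ φ) (x η : E d) :
    mixedHessian (linearPhase (prodMap φ)) x η = Matrix.diagonal fun i => deriv φ (x i) := by
  ext i l
  have h1 : ∀ x' : E d, fderiv ℝ (linearPhase (prodMap φ) x') η (EuclideanSpace.single l 1) =
      φ (x' l) := by
    intro x'
    have : linearPhase (prodMap φ) x' = innerSL ℝ (prodMap φ x' : E d) := rfl
    rw [this, ContinuousLinearMap.fderiv]
    simp [prodMap_apply, EuclideanSpace.inner_single_right]
  simp only [mixedHessian, Matrix.of_apply, h1, (hasFDerivAt_comp_coord hφ l x).fderiv]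
  by_cases hil : i = l
  · subst hil; simp
  · simp [hil, Ne.symm hil]

theorem isPhase_linearPhase {φ : ℝ → ℝ} (hφ : ContDiff ℝ ∞ φ) (h0 : ∀ t, deriv φ t ≠ 0) :
    IsPhase (linearPhase (prodMap φ) : E d → E d → ℝ) where
  homogeneous x η t _ _ := by simp [linearPhase, inner_smul_right]
  smooth := (((contDiff_prodMap hφ).comp contDiff_fst).inner ℝ contDiff_snd).contDiffOn
  nondegenerate x η _ := by
    rw [mixedHessian_linearPhase hφ, Matrix.det_diagonal]
    exact Finset.prod_ne_zero_iff.2 fun i _ => h0 _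

theorem isLinearMap_linearPhase (ψ : E d → E d) (x : E d) : IsLinearMap ℝ (linearPhase ψ x) :=
  ⟨fun _ _ => inner_add_right _ _ _, fun _ _ => inner_smul_right _ _ _⟩

theorem IsNonlinearDiffeo.deriv_ne_zero {φ : ℝ ≃ ℝ} (h : IsNonlinearDiffeo φ) (t : ℝ) :
    deriv φ t ≠ 0 := by
  obtain ⟨c, C, hc, hb⟩ := h.deriv_bounds
  exact abs_pos.1 (hc.trans_le (hb t).1)

theorem IsNonlinearDiffeo.deriv_symm_mul {φ : ℝ ≃ ℝ} (h : IsNonlinearDiffeo φ) (t : ℝ) :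
    deriv φ (φ.symm t) * deriv φ.symm t = 1 := by
  have h1 := ((h.smooth.differentiable (by simp)) (φ.symm t)).hasDerivAt.comp t
    ((h.smooth_symm.differentiable (by simp)) t).hasDerivAt
  have h2 : φ ∘ φ.symm = id := by ext; simp
  rw [h2] at h1
  exact h1.unique (hasDerivAt_id t)

theorem IsNonlinearDiffeo.deriv_symm_ne_zero {φ : ℝ ≃ ℝ} (h : IsNonlinearDiffeo φ) (t : ℝ) :
    deriv φ.symm t ≠ 0 := fun h0 => by
  have := h.deriv_symm_mul t
  simp [h0] at this

/-! #### The symbol `G(x) ⟨η⟩ ^ m` -/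

theorem contDiff_bracket (m : ℝ) : ContDiff ℝ ∞ (bracket m : E d → ℝ) := by
  refine ContDiff.rpow_const_of_ne (contDiff_const.add (contDiff_norm_sq ℝ)) fun η => ?_
  positivity

theorem fderiv_bracket (m : ℝ) (η v : E d) :
    fderiv ℝ (bracket m : E d → ℝ) η v = m * inner ℝ η v * bracket (m - 2) η := by
  have h1 : HasFDerivAt (fun η : E d => 1 + ‖η‖ ^ 2) (2 • (innerSL ℝ η)) η :=
    (hasStrictFDerivAt_norm_sq η).hasFDerivAt.const_add 1
  have h2 := h1.rpow_const (p := m / 2) (Or.inl (by positivity))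
  have h3 : fderiv ℝ (bracket m : E d → ℝ) η = _ := h2.fderiv
  rw [h3, bracket, show (m - 2) / 2 = m / 2 - 1 by ring]
  simp
  ring

/-- The functions `G(x) ⟨η⟩ ^ n` with a test function `G`. -/
def IsProductSymbol (n : ℝ) (σ : E d × E d → ℂ) : Prop :=
  ∃ G : E d → ℂ, ContDiff ℝ ∞ G ∧ HasCompactSupport G ∧ σ = fun z => G z.1 * (bracket n z.2 : ℂ)

theorem fderiv_productSymbol {G : E d → ℂ} (hG : ContDiff ℝ ∞ G) (n : ℝ) (z w : E d × E d) :
    fderiv ℝ (fun z : E d × E d => G z.1 * (bracket n z.2 : ℂ)) z w =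
      fderiv ℝ G z.1 w.1 * (bracket n z.2 : ℂ) +
      G z.1 * ((n * inner ℝ z.2 w.2 * bracket (n - 2) z.2 : ℝ) : ℂ) := by
  have h1 := ((hG.differentiable (by simp)) z.1).hasFDerivAt.comp z (hasFDerivAt_fst (𝕜 := ℝ))
  have h2 := Complex.ofRealCLM.hasFDerivAt.comp z
    ((((contDiff_bracket (d := d) n).differentiable (by simp)) z.2).hasFDerivAt.comp z
    (hasFDerivAt_snd (𝕜 := ℝ)))
  have h3 := (h1.fun_mul h2).fderiv
  simp only [Function.comp_def, Complex.ofRealCLM_apply] at h3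
  rw [h3]
  simp [fderiv_bracket]
  ring

/-- The class closes up because $\partial_i\langle\eta\rangle^n=n\,\eta_i\langle\eta\rangle^{n-2}$
is a coordinate times a generator of order $n-2$, hence of order $n-1$. -/
theorem symbolFamily_productSymbol : SymbolFamily (Generated (IsProductSymbol (d := d))) := by
  apply Generated.symbolFamily
  · rintro n σ ⟨G, hG, -, rfl⟩
    refine Differentiable.mul ((hG.differentiable (by simp)).comp differentiable_fst) ?_
    exact Complex.ofRealCLM.differentiable.comp
      (((contDiff_bracket (d := d) n).differentiable (by simp)).comp differentiable_snd)
  · rintro n σ ⟨G, hG, hGc, rfl⟩ i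
    refine Generated.base ⟨fun x => fderiv ℝ G x (EuclideanSpace.single i 1),
      (hG.fderiv_right (by simp)).clm_apply contDiff_const, ?_, ?_⟩
    · exact hGc.fderiv_apply (𝕜 := ℝ) _
    · funext z
      rw [fderiv_productSymbol hG]
      simp
  · rintro n σ ⟨G, hG, hGc, rfl⟩ i
    have h1 : Generated (IsProductSymbol (d := d)) (n - 2)
        fun z => G z.1 * (bracket (n - 2) z.2 : ℂ) := Generated.base ⟨G, hG, hGc, rfl⟩
    have h2 := (h1.coord i).smul n
    rw [show n - 2 + 1 = n - 1 by ring] at h2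
    convert h2 using 2 with z
    rw [fderiv_productSymbol hG]
    simp [EuclideanSpace.inner_single_right]
    ring
  · rintro n σ ⟨G, hG, hGc, rfl⟩
    obtain ⟨C, hC⟩ := hGc.exists_bound_of_continuous hG.continuous
    refine ⟨C, fun z => ?_⟩
    rw [norm_mul, Complex.norm_real, Real.norm_of_nonneg (bracket_pos _ _).le]
    exact mul_le_mul_of_nonneg_right (hC _) (bracket_pos _ _).le

theorem IsCutoff.contDiff_ofReal {G : E d → ℝ} (hG : IsCutoff G) :
    ContDiff ℝ ∞ fun x => (G x : ℂ) := Complex.ofRealCLM.contDiff.comp hG.smooth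

theorem IsCutoff.hasCompactSupport_ofReal {G : E d → ℝ} (hG : IsCutoff G) :
    HasCompactSupport fun x => (G x : ℂ) := hG.compact.comp_left Complex.ofReal_zero

theorem isSymbol_cutoff_mul_bracket {G : E d → ℝ} (hG : IsCutoff G) (m : ℝ) :
    IsSymbol m fun x η : E d => (G x : ℂ) * (bracket m η : ℂ) :=
  symbolFamily_productSymbol.isSymbol (σ := fun z => (G z.1 : ℂ) * (bracket m z.2 : ℂ))
    (Generated.base ⟨_, hG.contDiff_ofReal, hG.hasCompactSupport_ofReal, rfl⟩)

theorem japD_apply (m : ℝ) (h : E d → ℂ) (x : E d) : japD m h x =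
    ∫ η, Complex.exp (2 * Real.pi * Complex.I * (inner ℝ x η : ℝ)) *
      ((bracket m η : ℂ) * (𝓕 h) η) := by
  rw [japD, Real.fourierInv_eq']
  refine integral_congr_ae (Filter.Eventually.of_forall fun η => ?_)
  simp only [smul_eq_mul, real_inner_comm x η]
  congr 2
  push_cast
  ring

theorem isFourierIntegral_opF {φ : ℝ ≃ ℝ} (hφ : IsNonlinearDiffeo φ) {G : E d → ℝ}
    (hG : IsCutoff G) (m : ℝ) :
    IsFourierIntegral m (linearPhase (prodMap φ))
      (fun x η => (G x : ℂ) * (bracket m η : ℂ)) (opF m φ G) where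
  phase := isPhase_linearPhase hφ.smooth hφ.deriv_ne_zero
  symbol := isSymbol_cutoff_mul_bracket hG m
  compact := ⟨tsupport G, hG.compact, fun x hx η => by simp [image_eq_zero_of_notMem_tsupport hx]⟩
  eq f x := by
    rw [opF, japD_apply, fio, ← integral_const_mul]
    refine integral_congr_ae (Filter.Eventually.of_forall fun η => ?_)
    simp only [linearPhase, SchwartzMap.fourier_coe]
    ring

end ProductMaps

/-! ### Amplitudes vanishing on the diagonal -/

section Amplitudes

variable {d : ℕ}

/-- Test functions of `(x, z)` vanishing to order `l` at `z = 0`, as sums of products of a test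
function with `l` smooth functions vanishing at `z = 0`. -/
inductive Vanishing : ℕ → (E d × E d → ℂ) → Prop
  | base {A} : ContDiff ℝ ∞ A → HasCompactSupport A → Vanishing 0 A
  | mul {l A B} : Vanishing l A → ContDiff ℝ ∞ B → (∀ x, B (x, 0) = 0) →
      Vanishing (l + 1) fun y => B y * A y
  | add {l A B} : Vanishing l A → Vanishing l B → Vanishing l fun y => A y + B y

namespace Vanishing

theorem contDiff {l : ℕ} {A : E d × E d → ℂ} (h : Vanishing l A) : ContDiff ℝ ∞ A := by
  induction h with
  | base h _ => exact h
  | mul _ hB _ ih => exact hB.mul ih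
  | add _ _ h1 h2 => exact h1.add h2

theorem hasCompactSupport {l : ℕ} {A : E d × E d → ℂ} (h : Vanishing l A) :
    HasCompactSupport A := by
  induction h with
  | base _ h => exact h
  | mul _ _ _ ih => exact ih.mul_left
  | add _ _ h1 h2 => exact h1.add h2

theorem smooth_mul {l : ℕ} {A B : E d × E d → ℂ} (h : Vanishing l A) (hB : ContDiff ℝ ∞ B) :
    Vanishing l fun y => B y * A y := by
  induction h with
  | base h1 h2 => exact base (hB.mul h1) h2.mul_left
  | mul _ hB' h0 ih =>
    convert ih.mul hB' h0 using 2
    ring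
  | add _ _ h1 h2 =>
    convert h1.add h2 using 2
    ring

/-- The last vanishing factor is merely smooth and can be absorbed into the remaining amplitude. -/
theorem pred {l : ℕ} {A : E d × E d → ℂ} (h : Vanishing l A) : Vanishing (l - 1) A := by
  induction h with
  | base h1 h2 => exact base h1 h2
  | mul h hB _ _ => exact h.smooth_mul hB
  | add _ _ h1 h2 => exact h1.add h2

theorem fderiv_mul {A B : E d × E d → ℂ} (hA : ContDiff ℝ ∞ A) (hB : ContDiff ℝ ∞ B)
    (y w : E d × E d) :
    fderiv ℝ (fun y => B y * A y) y w = fderiv ℝ B y w * A y + B y * fderiv ℝ A y w := by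
  rw [(((hB.differentiable (by simp)) y).hasFDerivAt.fun_mul
    ((hA.differentiable (by simp)) y).hasFDerivAt).fderiv]
  simp
  ring

theorem contDiff_fderiv_apply {A : E d × E d → ℂ} (hA : ContDiff ℝ ∞ A) (w : E d × E d) :
    ContDiff ℝ ∞ fun y => fderiv ℝ A y w :=
  (hA.fderiv_right (by simp)).clm_apply contDiff_const

/-- No order is lost: a factor that vanishes at $(x,0)$ for every $x$ has $x$-derivatives that
vanish there too. -/
theorem fderiv_left {l : ℕ} {A : E d × E d → ℂ} (h : Vanishing l A) (v : E d) :
    Vanishing l fun y => fderiv ℝ A y (v, 0) := by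
  induction h with
  | base h1 h2 =>
    exact base (contDiff_fderiv_apply h1 _) (h2.fderiv_apply (𝕜 := ℝ) _)
  | @mul l A B h hB h0 ih =>
    have h0' : ∀ x, fderiv ℝ B (x, 0) (v, 0) = 0 := by
      intro x
      have h1 := ((hB.differentiable (by simp)) (x, 0)).hasFDerivAt.comp
        (f := fun x' => (x', (0 : E d))) x (hasFDerivAt_prodMk_left x 0)
      have h2 : B ∘ (fun x' : E d => (x', (0 : E d))) = fun _ => 0 := funext h0
      rw [h2] at h1
      simpa using congrArg (fun L => L v) (h1.unique (hasFDerivAt_const 0 x))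
    simp only [fderiv_mul h.contDiff hB]
    exact (h.mul (contDiff_fderiv_apply hB _) h0').add (ih.mul hB h0)
  | @add l A B hA hB h1 h2 =>
    convert h1.add h2 using 2 with y
    rw [fderiv_fun_add ((hA.contDiff.differentiable (by simp)) y)
      ((hB.contDiff.differentiable (by simp)) y)]
    rfl

theorem fderiv_pred {l : ℕ} {A : E d × E d → ℂ} (h : Vanishing l A) (w : E d × E d) :
    Vanishing (l - 1) fun y => fderiv ℝ A y w := by
  induction h with
  | base h1 h2 =>
    exact base (contDiff_fderiv_apply h1 _) (h2.fderiv_apply (𝕜 := ℝ) _)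
  | @mul l A B h hB h0 ih =>
    simp only [fderiv_mul h.contDiff hB]
    refine (h.smooth_mul (contDiff_fderiv_apply hB _)).add ?_
    have h1 := ih.mul hB h0
    -- For $l=0$ the truncated difference $0-1=0$ makes the product vanish to order one, more than
    -- is asked, and `pred` discards the surplus.
    rcases l with _ | l
    · exact h1.pred
    · exact h1
  | @add l A B hA hB h1 h2 =>
    convert h1.add h2 using 2 with y
    rw [fderiv_fun_add ((hA.contDiff.differentiable (by simp)) y)
      ((hB.contDiff.differentiable (by simp)) y)]
    rfl

/-- Each vanishing factor is $O(|z|)$ by the mean value inequality on the segment from $(x,0)$ to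
$(x,z)$. That segment stays in a ball containing the support of the amplitude, because dropping $z$
does not increase the sup norm of the pair. -/
theorem bound {l : ℕ} {A : E d × E d → ℂ} (h : Vanishing l A) :
    ∃ C : ℝ, 0 ≤ C ∧ ∀ x z, ‖A (x, z)‖ ≤ C * ‖z‖ ^ l := by
  induction h with
  | base h1 h2 =>
    obtain ⟨C, hC⟩ := h2.exists_bound_of_continuous h1.continuous
    exact ⟨C, (norm_nonneg _).trans (hC 0), fun x z => by simpa using hC (x, z)⟩
  | @mul l A B h hB h0 ih =>
    obtain ⟨C, hC0, hC⟩ := ih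
    obtain ⟨R, hR⟩ := h.hasCompactSupport.isBounded.subset_closedBall (0 : E d × E d)
    have hcont : Continuous (fderiv ℝ B) := hB.continuous_fderiv (by simp)
    obtain ⟨D, hD⟩ := (isCompact_closedBall (0 : E d × E d) R).exists_bound_of_continuousOn
      hcont.continuousOn
    refine ⟨max D 0 * C, mul_nonneg (le_max_right _ _) hC0, fun x z => ?_⟩
    by_cases hxz : (x, z) ∈ tsupport A
    · have hmem := hR hxz
      have hmem0 : (x, (0 : E d)) ∈ Metric.closedBall (0 : E d × E d) R := by
        rw [mem_closedBall_zero_iff] at hmem ⊢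
        refine le_trans ?_ hmem
        simp [Prod.norm_def]
      have hB1 := (convex_closedBall (0 : E d × E d) R).norm_image_sub_le_of_norm_fderiv_le
        (fun y _ => (hB.differentiable (by simp)) y)
        (fun y hy => (hD y hy).trans (le_max_left D 0)) hmem0 hmem
      rw [h0, sub_zero] at hB1
      have hB2 : ‖B (x, z)‖ ≤ max D 0 * ‖z‖ := by simpa [Prod.norm_def] using hB1
      rw [norm_mul]
      calc ‖B (x, z)‖ * ‖A (x, z)‖ ≤ (max D 0 * ‖z‖) * (C * ‖z‖ ^ l) :=
            mul_le_mul hB2 (hC x z) (norm_nonneg _) (by positivity)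
        _ = max D 0 * C * ‖z‖ ^ (l + 1) := by ring
    · simp only [image_eq_zero_of_notMem_tsupport hxz, mul_zero, norm_zero]
      positivity
  | add _ _ h1 h2 =>
    obtain ⟨C, hC0, hC⟩ := h1
    obtain ⟨D, hD0, hD⟩ := h2
    exact ⟨C + D, by positivity, fun x z => (norm_add_le _ _).trans
      (by linarith [hC x z, hD x z])⟩

end Vanishing

/-! ### Gaussian oscillatory integrals -/

/-- The oscillating factor `exp (2 π i (ψ(x - z) - ψ(x)) · η)`, where `ψ` acts on each
coordinate. -/
def oscFactor (ψ : ℝ → ℝ) (x η z : E d) : ℂ :=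
  Complex.exp (2 * Real.pi * Complex.I *
    ((inner ℝ (prodMap ψ (x - z) - prodMap ψ x) η : ℝ) : ℂ))

theorem norm_oscFactor (ψ : ℝ → ℝ) (x η z : E d) : ‖oscFactor ψ x η z‖ = 1 := by
  rw [oscFactor, mul_comm, Complex.norm_exp]
  simp

theorem contDiff_oscFactor {ψ : ℝ → ℝ} (hψ : ContDiff ℝ ∞ ψ) :
    ContDiff ℝ ∞ fun y : (E d × E d) × E d => oscFactor ψ y.1.1 y.1.2 y.2 := by
  have h1 : ContDiff ℝ ∞ fun y : (E d × E d) × E d =>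
      (inner ℝ (prodMap ψ (y.1.1 - y.2) - prodMap ψ y.1.1) y.1.2 : ℝ) :=
    (((contDiff_prodMap hψ).comp ((contDiff_fst.comp contDiff_fst).sub contDiff_snd)).sub
      ((contDiff_prodMap hψ).comp (contDiff_fst.comp contDiff_fst))).inner ℝ
      (contDiff_snd.comp contDiff_fst)
  exact (contDiff_const.mul (Complex.ofRealCLM.contDiff.comp h1)).cexp

theorem contDiff_oscFactor_right {ψ : ℝ → ℝ} (hψ : ContDiff ℝ ∞ ψ) (x η : E d) :
    ContDiff ℝ ∞ (oscFactor ψ x η) :=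
  (contDiff_oscFactor hψ).comp (f := fun z : E d => ((x, η), z))
    (contDiff_const.prodMk contDiff_id)

theorem inner_prodMap_sub (ψ : ℝ → ℝ) (x η z : E d) :
    (inner ℝ (prodMap ψ (x - z) - prodMap ψ x) η : ℝ) =
      ∑ i, (ψ (x i - z i) - ψ (x i)) * η i := by
  rw [PiLp.inner_apply]
  refine Finset.sum_congr rfl fun i _ => ?_
  simp [prodMap_apply, mul_comm]

/-- The Gaussian weight `exp (-π |v|²)`. -/
def gauss (v : E d) : ℝ := Real.exp (-Real.pi * ‖v‖ ^ 2)

theorem gauss_pos (v : E d) : 0 < gauss v := Real.exp_pos _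

theorem contDiff_gauss : ContDiff ℝ ∞ (gauss : E d → ℝ) :=
  (contDiff_const.mul (contDiff_norm_sq ℝ)).exp

theorem fderiv_gauss (v w : E d) :
    fderiv ℝ (gauss : E d → ℝ) v w = -(2 * Real.pi * inner ℝ v w) * gauss v := by
  have h := (((hasStrictFDerivAt_norm_sq v).hasFDerivAt).const_mul (-Real.pi)).exp
  have h3 : fderiv ℝ (gauss : E d → ℝ) v = _ := h.fderiv
  rw [h3]
  simp [gauss]
  ring

theorem integrable_exp_neg_mul_normSq {b : ℝ} (hb : 0 < b) :
    Integrable fun v : E d => Real.exp (-b * ‖v‖ ^ 2) := by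
  have h := GaussianFourier.integrable_cexp_neg_mul_sq_norm_add (V := E d) (b := b)
    (by simpa using hb) 0 0
  refine h.norm.congr (Filter.Eventually.of_forall fun v => ?_)
  simp only [Complex.norm_exp]
  congr 1
  simp [← Complex.ofReal_pow, ← Complex.ofReal_neg, ← Complex.ofReal_mul]

theorem integrable_norm_pow_mul_gauss (l : ℕ) :
    Integrable fun v : E d => ‖v‖ ^ l * gauss v := by
  have hpi := Real.pi_pos
  refine Integrable.mono' (((integrable_exp_neg_mul_normSq (d := d) (b := Real.pi / 2)
    (by positivity)).const_mul (1 + (l.factorial : ℝ)))) ?_ ?_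
  · exact (((continuous_norm.pow l)).mul contDiff_gauss.continuous).aestronglyMeasurable
  refine Filter.Eventually.of_forall fun v => ?_
  rw [Real.norm_of_nonneg (mul_nonneg (by positivity) (gauss_pos v).le), gauss,
    show -Real.pi * ‖v‖ ^ 2 = Real.pi / 2 * -‖v‖ ^ 2 + -(Real.pi / 2) * ‖v‖ ^ 2 by ring,
    Real.exp_add, ← mul_assoc]
  refine mul_le_mul_of_nonneg_right ?_ (Real.exp_pos _).le
  have h1 : ‖v‖ ^ l ≤ 1 + (‖v‖ ^ 2) ^ l := by
    rcases le_total ‖v‖ 1 with h | h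
    · have := pow_le_one₀ (n := l) (norm_nonneg v) h
      have : 0 ≤ (‖v‖ ^ 2) ^ l := by positivity
      linarith
    · have : ‖v‖ ^ l ≤ (‖v‖ ^ 2) ^ l := pow_le_pow_left₀ (norm_nonneg v) (by nlinarith) l
      linarith
  have h2 : (‖v‖ ^ 2) ^ l ≤ l.factorial * Real.exp (Real.pi / 2 * ‖v‖ ^ 2) := by
    have h3 := Real.pow_div_factorial_le_exp (‖v‖ ^ 2) (sq_nonneg _) l
    rw [div_le_iff₀ (by positivity)] at h3
    have h4 : Real.exp (‖v‖ ^ 2) ≤ Real.exp (Real.pi / 2 * ‖v‖ ^ 2) := by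
      refine Real.exp_le_exp.2 (le_mul_of_one_le_left (sq_nonneg _) ?_)
      linarith [Real.two_le_pi]
    calc (‖v‖ ^ 2) ^ l ≤ Real.exp (‖v‖ ^ 2) * l.factorial := h3
      _ ≤ Real.exp (Real.pi / 2 * ‖v‖ ^ 2) * l.factorial := by gcongr
      _ = _ := mul_comm _ _
  have h5 : 1 ≤ Real.exp (Real.pi / 2 * ‖v‖ ^ 2) := Real.one_le_exp (by positivity)
  have h6 : Real.exp (Real.pi / 2 * -‖v‖ ^ 2) * Real.exp (Real.pi / 2 * ‖v‖ ^ 2) = 1 := by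
    rw [← Real.exp_add]; simp
  have h7 : ‖v‖ ^ l ≤ (1 + l.factorial) * Real.exp (Real.pi / 2 * ‖v‖ ^ 2) := by
    rw [add_mul, one_mul]; linarith
  calc ‖v‖ ^ l * Real.exp (Real.pi / 2 * -‖v‖ ^ 2)
      ≤ ((1 + l.factorial) * Real.exp (Real.pi / 2 * ‖v‖ ^ 2)) *
        Real.exp (Real.pi / 2 * -‖v‖ ^ 2) := by gcongr
    _ = 1 + l.factorial := by rw [mul_assoc, mul_comm (Real.exp _), h6, mul_one]

/-- The Gaussian oscillatory integral at scale `τ` with amplitude `A`. -/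
def gaussOsc (ψ : ℝ → ℝ) (A : E d × E d → ℂ) (τ : ℝ) (x η : E d) : ℂ :=
  ∫ v : E d, A (x, τ • v) * oscFactor ψ x η (τ • v) * (gauss v : ℂ)

/-- The oscillation is discarded: $|A(x,\tau v)|\le C\tau^l|v|^l$, and the moments of the Gaussian
are finite. -/
theorem norm_gaussOsc_le {l : ℕ} {A : E d × E d → ℂ} (h : Vanishing l A) (ψ : ℝ → ℝ) :
    ∃ C : ℝ, 0 ≤ C ∧ ∀ (τ : ℝ) (x η : E d), 0 < τ → ‖gaussOsc ψ A τ x η‖ ≤ C * τ ^ l := by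
  obtain ⟨C, hC0, hC⟩ := h.bound
  have hInt := integrable_norm_pow_mul_gauss (d := d) l
  refine ⟨C * ∫ v : E d, ‖v‖ ^ l * gauss v, mul_nonneg hC0
    (integral_nonneg fun v => mul_nonneg (by positivity) (gauss_pos v).le),
    fun τ x η hτ => ?_⟩
  calc ‖gaussOsc ψ A τ x η‖ ≤ ∫ v : E d, (C * τ ^ l) * (‖v‖ ^ l * gauss v) := by
        refine norm_integral_le_of_norm_le (hInt.const_mul _)
          (Filter.Eventually.of_forall fun v => ?_)
        rw [norm_mul, norm_mul, norm_oscFactor, Complex.norm_real,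
          Real.norm_of_nonneg (gauss_pos v).le, mul_one]
        calc ‖A (x, τ • v)‖ * gauss v ≤ C * ‖τ • v‖ ^ l * gauss v :=
              mul_le_mul_of_nonneg_right (hC _ _) (gauss_pos v).le
          _ = C * τ ^ l * (‖v‖ ^ l * gauss v) := by
              rw [norm_smul, Real.norm_of_nonneg hτ.le]; ring
    _ = _ := by rw [integral_const_mul]; ring

end Amplitudes

/-! ### Non-stationary phase for Gaussian oscillatory integrals -/

section GaussianEstimates

variable {d : ℕ}

theorem fderiv_oscFactor {ψ : ℝ → ℝ} (hψ : ContDiff ℝ ∞ ψ) (x η z : E d) (j : Fin d) :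
    fderiv ℝ (oscFactor ψ x η) z (EuclideanSpace.single j 1) =
      -(2 * Real.pi * Complex.I) * ((deriv ψ (x j - z j) : ℝ) : ℂ) * (η j : ℂ) * oscFactor ψ x η z := by
  have h1 : HasFDerivAt (fun z : E d => ∑ i, (ψ (x i - z i) - ψ (x i)) * η i)
      (∑ i, η i • (deriv ψ (x i - z i) • -(EuclideanSpace.proj i : E d →L[ℝ] ℝ))) z := by
    refine HasFDerivAt.fun_sum fun i _ => HasFDerivAt.mul_const ?_ _
    refine HasFDerivAt.sub_const _ ?_
    exact HasDerivAt.comp_hasFDerivAt z ((hψ.differentiable (by simp)) _).hasDerivAt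
      ((EuclideanSpace.proj i : E d →L[ℝ] ℝ).hasFDerivAt.const_sub (x i))
  have h2 := ((Complex.ofRealCLM.hasFDerivAt.comp z h1).const_mul (2 * Real.pi * Complex.I)).cexp
  have h3 : oscFactor ψ x η = fun z => Complex.exp (2 * Real.pi * Complex.I *
      (Complex.ofRealCLM ∘ fun z : E d => ∑ i, (ψ (x i - z i) - ψ (x i)) * η i) z) := by
    funext z
    rw [oscFactor, inner_prodMap_sub]
    rfl
  rw [h3, h2.fderiv]
  simp
  ring

/-- The reciprocal of the coefficient that a derivative of the oscillating factor brings out. -/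
def oscInv (ψ : ℝ → ℝ) (j : Fin d) (y : E d × E d) : ℂ :=
  (-(2 * Real.pi * Complex.I) * ((deriv ψ (y.1 j - y.2 j) : ℝ) : ℂ))⁻¹

theorem contDiff_oscInv {ψ : ℝ → ℝ} (hψ : ContDiff ℝ ∞ ψ) (h0 : ∀ t, deriv ψ t ≠ 0) (j : Fin d) :
    ContDiff ℝ ∞ (oscInv ψ j : E d × E d → ℂ) := by
  have h1 : ContDiff ℝ ∞ (deriv ψ) := (contDiff_infty_iff_deriv.1 hψ).2
  have h2 : ContDiff ℝ ∞ fun y : E d × E d => ((deriv ψ (y.1 j - y.2 j) : ℝ) : ℂ) :=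
    Complex.ofRealCLM.contDiff.comp (h1.comp
      (((contDiff_coord j).comp contDiff_fst).sub ((contDiff_coord j).comp contDiff_snd)))
  refine ContDiff.inv (contDiff_const.mul h2) fun y => ?_
  have := h0 (y.1 j - y.2 j)
  simp [this, Real.pi_ne_zero]

theorem hasCompactSupport_slice {A : E d × E d → ℂ} (hA : HasCompactSupport A) (x : E d) {τ : ℝ}
    (hτ : τ ≠ 0) : HasCompactSupport fun v : E d => A (x, τ • v) := by
  refine HasCompactSupport.intro (K := (fun y : E d × E d => τ⁻¹ • y.2) '' tsupport A)
    (hA.image (continuous_snd.const_smul τ⁻¹)) fun v hv => ?_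
  by_contra hne
  exact hv ⟨(x, τ • v), subset_tsupport A hne, by simp [smul_smul, inv_mul_cancel₀ hτ]⟩

theorem fderiv_slice {A : E d × E d → ℂ} (hA : ContDiff ℝ ∞ A) (x : E d) (τ : ℝ) (v w : E d) :
    fderiv ℝ (fun v : E d => A (x, τ • v)) v w = τ * fderiv ℝ A (x, τ • v) (0, w) := by
  have h1 : HasFDerivAt (fun v : E d => (x, τ • v))
      ((0 : E d →L[ℝ] E d).prod (τ • ContinuousLinearMap.id ℝ (E d))) v :=
    (hasFDerivAt_const x v).prodMk ((hasFDerivAt_id v).const_smul τ)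
  have h2 := ((hA.differentiable (by simp)) (x, τ • v)).hasFDerivAt.comp
    (f := fun v : E d => (x, τ • v)) v h1
  rw [show (fun v : E d => A (x, τ • v)) = A ∘ fun v : E d => (x, τ • v) from rfl, h2.fderiv]
  have h3 : ((0 : E d), τ • w) = τ • ((0 : E d), w) := by rw [Prod.smul_mk, smul_zero]
  change fderiv ℝ A (x, τ • v) ((0 : E d), τ • w) = _
  rw [h3, map_smul, Complex.real_smul]

/-- The phase has no stationary point in $z$: its $j$-th derivative is $-2\pi\psi'(x_j-z_j)\eta_j$
with $\psi'\ne0$. Dividing by $\psi'$ and integrating by parts in $v_j$, the derivative falls on the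
amplitude, giving a factor $\tau$, or on the Gaussian, giving $2\pi v_j=(2\pi/\tau)z_j$ at $z=\tau
v$. -/
theorem gaussOsc_integration_by_parts {ψ : ℝ → ℝ} (hψ : ContDiff ℝ ∞ ψ) (h0 : ∀ t, deriv ψ t ≠ 0)
    {A : E d × E d → ℂ} (hA : ContDiff ℝ ∞ A) (hAc : HasCompactSupport A) (j : Fin d) {τ : ℝ}
    (hτ : 0 < τ) (x η : E d) :
    (τ * η j : ℂ) * gaussOsc ψ A τ x η =
      -(τ * gaussOsc ψ (fun y => fderiv ℝ (fun y => oscInv ψ j y * A y) y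
        (0, EuclideanSpace.single j 1)) τ x η) +
      (2 * Real.pi / τ : ℂ) * gaussOsc ψ (fun y => (y.2 j : ℂ) * (oscInv ψ j y * A y)) τ x η := by
  set B : E d × E d → ℂ := fun y => oscInv ψ j y * A y with hB
  have hBs : ContDiff ℝ ∞ B := (contDiff_oscInv hψ h0 j).mul hA
  have hBc : HasCompactSupport B := hAc.mul_left
  set e : E d := EuclideanSpace.single j 1 with he
  have hlin : ContDiff ℝ ∞ fun v : E d => (x, τ • v) :=
    contDiff_const.prodMk (contDiff_id.const_smul τ)
  have hsm : ContDiff ℝ ∞ fun v : E d => τ • v := contDiff_id.const_smul τ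
  set f : E d → ℂ := fun v => B (x, τ • v) * (gauss v : ℂ) with hf
  set g : E d → ℂ := fun v => oscFactor ψ x η (τ • v) with hg
  have hgs : ContDiff ℝ ∞ g := (contDiff_oscFactor_right hψ x η).comp hsm
  have hgauss : ContDiff ℝ ∞ fun v : E d => (gauss v : ℂ) :=
    Complex.ofRealCLM.contDiff.comp contDiff_gauss
  have hfs : ContDiff ℝ ∞ f := (hBs.comp hlin).mul hgauss
  have hfc : HasCompactSupport f := (hasCompactSupport_slice hBc x hτ.ne').mul_right
  have hfd : ∀ v, fderiv ℝ f v e = τ * fderiv ℝ B (x, τ • v) (0, e) * gauss v -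
      2 * Real.pi * (v j : ℂ) * (B (x, τ • v) * gauss v) := by
    intro v
    have h1 := ((((hBs.comp hlin).differentiable (by simp)) v).hasFDerivAt.fun_mul
      (((hgauss.differentiable (by simp)) v).hasFDerivAt)).fderiv
    have h2 : fderiv ℝ (fun v : E d => (gauss v : ℂ)) v e =
        ((fderiv ℝ (gauss : E d → ℝ) v e : ℝ) : ℂ) := by
      have := Complex.ofRealCLM.hasFDerivAt.comp v
        (((contDiff_gauss (d := d)).differentiable (by simp)) v).hasFDerivAt
      rw [show (fun v : E d => (gauss v : ℂ)) = Complex.ofRealCLM ∘ gauss from rfl, this.fderiv]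
      rfl
    have h3 := fderiv_slice hBs x τ v e
    simp only [Function.comp_def] at h1
    rw [hf, h1]
    simp only [add_apply, smul_apply, smul_eq_mul]
    rw [h2, h3, fderiv_gauss]
    simp [he, EuclideanSpace.inner_single_right]
    ring
  have hgd : ∀ v, f v * fderiv ℝ g v e =
      (τ * η j : ℂ) * (A (x, τ • v) * oscFactor ψ x η (τ • v) * (gauss v : ℂ)) := by
    intro v
    have h1 : HasFDerivAt g (fderiv ℝ (oscFactor ψ x η) (τ • v) ∘L
        (τ • ContinuousLinearMap.id ℝ (E d))) v :=
      (((contDiff_oscFactor_right hψ x η).differentiable (by simp)) (τ • v)).hasFDerivAt.comp v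
        ((hasFDerivAt_id v).const_smul τ)
    have h2 := fderiv_oscFactor hψ x η (τ • v) j
    rw [← he] at h2
    rw [h1.fderiv]
    have hne : ((deriv ψ (x j - τ * v j) : ℝ) : ℂ) ≠ 0 := by exact_mod_cast h0 _
    have hpi : (Real.pi : ℂ) ≠ 0 := by exact_mod_cast Real.pi_ne_zero
    simp only [ContinuousLinearMap.comp_apply, smul_apply,
      ContinuousLinearMap.id_apply, map_smul, h2, hf, hB, oscInv, PiLp.smul_apply, smul_eq_mul,
      Complex.real_smul]
    field_simp [Complex.I_ne_zero]
  have hI1 : Integrable fun v => fderiv ℝ f v e * g v := by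
    refine Continuous.integrable_of_hasCompactSupport ?_ ?_
    · exact ((hfs.continuous_fderiv (by simp)).clm_apply continuous_const).mul hgs.continuous
    · exact (hfc.fderiv_apply (𝕜 := ℝ) e).mul_right
  have hI2 : Integrable fun v => f v * fderiv ℝ g v e := by
    refine Continuous.integrable_of_hasCompactSupport ?_ hfc.mul_right
    exact hfs.continuous.mul ((hgs.continuous_fderiv (by simp)).clm_apply continuous_const)
  have hI3 : Integrable fun v => f v * g v :=
    Continuous.integrable_of_hasCompactSupport (hfs.continuous.mul hgs.continuous) hfc.mul_right
  have key := integral_mul_fderiv_eq_neg_fderiv_mul_of_integrable (v := e) hI1 hI2 hI3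
    (fun v _ => (hfs.differentiable (by simp)) v) (fun v _ => (hgs.differentiable (by simp)) v)
  simp only [hgd] at key
  rw [integral_const_mul] at key
  rw [gaussOsc, key, gaussOsc, gaussOsc, ← integral_const_mul, ← integral_const_mul,
    ← integral_neg, ← integral_neg, ← integral_add]
  · refine integral_congr_ae (Filter.Eventually.of_forall fun v => ?_)
    have hτ' : (τ : ℂ) ≠ 0 := by exact_mod_cast hτ.ne'
    simp only [hfd, hg, PiLp.smul_apply, smul_eq_mul, Complex.ofReal_mul]
    field_simp
    ring
  · have hc : ContDiff ℝ ∞ fun y => fderiv ℝ B y (0, e) := Vanishing.contDiff_fderiv_apply hBs _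
    refine Integrable.neg (Integrable.const_mul
      (Continuous.integrable_of_hasCompactSupport
      (((hc.comp hlin).continuous.mul hgs.continuous).mul hgauss.continuous) ?_) _)
    exact ((hasCompactSupport_slice (hBc.fderiv_apply (𝕜 := ℝ) _) x hτ.ne').mul_right).mul_right
  · have hc : ContDiff ℝ ∞ fun y : E d × E d => (y.2 j : ℂ) * B y :=
      (Complex.ofRealCLM.contDiff.comp ((contDiff_coord j).comp contDiff_snd)).mul hBs
    refine Integrable.const_mul (Continuous.integrable_of_hasCompactSupport
      (((hc.comp hlin).continuous.mul hgs.continuous).mul hgauss.continuous) ?_) _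
    exact ((hasCompactSupport_slice (A := fun y : E d × E d => (y.2 j : ℂ) * B y) hBc.mul_left x
      hτ.ne').mul_right).mul_right

/-- The two terms of the integration by parts balance: $\tau$ times an amplitude of vanishing order
$l-1$, and $\tau^{-1}$ times one of order $l+1$. Each is comparable to $\tau^l$, so every power of
$\tau|\eta_j|$ costs at most a factor $1+\tau$. -/
theorem norm_gaussOsc_mul_coord_pow_le {ψ : ℝ → ℝ} (hψ : ContDiff ℝ ∞ ψ)
    (h0 : ∀ t, deriv ψ t ≠ 0) (j : Fin d) (N : ℕ) :
    ∀ {l : ℕ} {A : E d × E d → ℂ}, Vanishing l A → ∃ C : ℝ, 0 ≤ C ∧ ∀ (τ : ℝ) (x η : E d), 0 < τ →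
      (τ * |η j|) ^ N * ‖gaussOsc ψ A τ x η‖ ≤ C * ((1 + τ) ^ N * τ ^ l) := by
  induction N with
  | zero =>
    intro l A hA
    obtain ⟨C, hC0, hC⟩ := norm_gaussOsc_le hA ψ
    exact ⟨C, hC0, fun τ x η hτ => by simpa using hC τ x η hτ⟩
  | succ N ih =>
    intro l A hA
    have hB := hA.smooth_mul (contDiff_oscInv hψ h0 j)
    obtain ⟨C, hC0, hC⟩ := ih (hB.fderiv_pred (0, EuclideanSpace.single j 1))
    obtain ⟨D, hD0, hD⟩ := ih (hB.mul (B := fun y : E d × E d => (y.2 j : ℂ))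
      (Complex.ofRealCLM.contDiff.comp ((contDiff_coord j).comp contDiff_snd)) (by simp))
    refine ⟨C + 2 * Real.pi * D, by positivity, fun τ x η hτ => ?_⟩
    have key := congrArg norm
      (gaussOsc_integration_by_parts hψ h0 hA.contDiff hA.hasCompactSupport j hτ x η)
    have hle := key.le.trans (norm_add_le _ _)
    rw [norm_neg, norm_mul, norm_mul, norm_mul, norm_mul] at hle
    have e1 : ‖(τ : ℂ)‖ = τ := by rw [Complex.norm_real, Real.norm_of_nonneg hτ.le]
    have e2 : ‖((η j : ℝ) : ℂ)‖ = |η j| := by rw [Complex.norm_real, Real.norm_eq_abs]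
    have e3 : ‖(2 * Real.pi / τ : ℂ)‖ = 2 * Real.pi / τ := by
      rw [norm_div, norm_mul, e1, Complex.norm_real, Real.norm_of_nonneg Real.pi_pos.le]
      simp
    rw [e1, e2, e3] at hle
    have h1 := hC τ x η hτ
    have h2 := hD τ x η hτ
    have hp : 0 ≤ (τ * |η j|) ^ N := by positivity
    -- The factor $1+\tau$ is needed only for $l=0$, where truncated subtraction leaves $\tau\cdot1$
    -- on the left.
    have h3 : τ * τ ^ (l - 1) ≤ (1 + τ) * τ ^ l := by
      rcases l with _ | l
      · simp
      · rw [Nat.add_sub_cancel, pow_succ]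
        nlinarith [pow_pos hτ l, mul_pos (pow_pos hτ l) hτ]
    set X := ‖gaussOsc ψ (fun y => fderiv ℝ (fun y => oscInv ψ j y * A y) y
        (0, EuclideanSpace.single j 1)) τ x η‖
    set Y := ‖gaussOsc ψ (fun y => (y.2 j : ℂ) * (oscInv ψ j y * A y)) τ x η‖
    have h4 : (1 + τ) ^ N * τ ^ l ≤ (1 + τ) ^ (N + 1) * τ ^ l := by
      gcongr
      · linarith
      · omega
    calc (τ * |η j|) ^ (N + 1) * ‖gaussOsc ψ A τ x η‖
        = (τ * |η j|) ^ N * (τ * |η j| * ‖gaussOsc ψ A τ x η‖) := by ring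
      _ ≤ (τ * |η j|) ^ N * (τ * X + 2 * Real.pi / τ * Y) := by gcongr
      _ = τ * ((τ * |η j|) ^ N * X) + 2 * Real.pi / τ * ((τ * |η j|) ^ N * Y) := by ring
      _ ≤ τ * (C * ((1 + τ) ^ N * τ ^ (l - 1))) +
          2 * Real.pi / τ * (D * ((1 + τ) ^ N * τ ^ (l + 1))) := by gcongr
      _ = C * ((1 + τ) ^ N * (τ * τ ^ (l - 1))) +
          2 * Real.pi * D * ((1 + τ) ^ N * τ ^ l) := by field_simp; ring
      _ ≤ C * ((1 + τ) ^ N * ((1 + τ) * τ ^ l)) +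
          2 * Real.pi * D * ((1 + τ) ^ (N + 1) * τ ^ l) := by gcongr
      _ = (C + 2 * Real.pi * D) * ((1 + τ) ^ (N + 1) * τ ^ l) := by ring

theorem exists_norm_le_card_mul_abs_coord (hd : 0 < d) (η : E d) : ∃ j, ‖η‖ ≤ d * |η j| := by
  have : Nonempty (Fin d) := ⟨⟨0, hd⟩⟩
  obtain ⟨j, -, hj⟩ := Finset.exists_max_image Finset.univ (fun i => |η i|) Finset.univ_nonempty
  refine ⟨j, ?_⟩
  calc ‖η‖ = ‖∑ i, η i • (EuclideanSpace.single i (1 : ℝ) : E d)‖ := by rw [sum_coord_single]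
    _ ≤ ∑ i, |η i| := (norm_sum_le _ _).trans (by simp [norm_smul])
    _ ≤ ∑ _i : Fin d, |η j| := Finset.sum_le_sum fun i hi => hj i hi
    _ = d * |η j| := by simp

theorem bracket_one_le (η : E d) : bracket 1 η ≤ 1 + ‖η‖ := by
  rw [bracket, ← Real.sqrt_eq_rpow]
  exact Real.sqrt_le_iff.2 ⟨by positivity, by nlinarith [norm_nonneg η]⟩

/-- The previous bound is used for the coordinate of $\eta$ of largest modulus, which controls
$|\eta|$ up to the factor $d$. The trivial bound covers the $1$ in $\langle\eta\rangle\le1+|\eta|$.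
-/
theorem norm_gaussOsc_mul_pow_le (hd : 0 < d) {ψ : ℝ → ℝ} (hψ : ContDiff ℝ ∞ ψ)
    (h0 : ∀ t, deriv ψ t ≠ 0) (N : ℕ) {l : ℕ} {A : E d × E d → ℂ} (hA : Vanishing l A) :
    ∃ C : ℝ, 0 ≤ C ∧ ∀ (τ : ℝ) (x η : E d), 0 < τ →
      (τ * bracket 1 η) ^ N * ‖gaussOsc ψ A τ x η‖ ≤ C * ((1 + τ) ^ N * τ ^ l) := by
  choose C hC0 hC using fun j => norm_gaussOsc_mul_coord_pow_le hψ h0 j N hA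
  obtain ⟨D, hD0, hD⟩ := norm_gaussOsc_le hA ψ
  have hS : ∀ j, C j ≤ ∑ i, C i := fun j =>
    Finset.single_le_sum (fun i _ => hC0 i) (Finset.mem_univ j)
  have hS0 : 0 ≤ ∑ i, C i := Finset.sum_nonneg fun i _ => hC0 i
  refine ⟨2 ^ N * (D + d ^ N * ∑ i, C i), by positivity, fun τ x η hτ => ?_⟩
  obtain ⟨j, hj⟩ := exists_norm_le_card_mul_abs_coord hd η
  set J := ‖gaussOsc ψ A τ x η‖
  have h1 : (τ * bracket 1 η) ^ N ≤ 2 ^ N * (τ ^ N + (d * (τ * |η j|)) ^ N) := by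
    have h2 : τ * bracket 1 η ≤ τ + d * (τ * |η j|) := by
      calc τ * bracket 1 η ≤ τ * (1 + ‖η‖) := by gcongr; exact bracket_one_le η
        _ ≤ τ * (1 + d * |η j|) := by gcongr
        _ = _ := by ring
    have h3 : 0 ≤ τ * bracket 1 η := mul_nonneg hτ.le (bracket_pos _ _).le
    have ha : 0 ≤ d * (τ * |η j|) := by positivity
    calc (τ * bracket 1 η) ^ N ≤ (τ + d * (τ * |η j|)) ^ N := pow_le_pow_left₀ h3 h2 N
      _ ≤ (2 * max τ (d * (τ * |η j|))) ^ N := by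
          refine pow_le_pow_left₀ (by positivity) ?_ N
          linarith [le_max_left τ (d * (τ * |η j|)), le_max_right τ (d * (τ * |η j|))]
      _ = 2 ^ N * max τ (d * (τ * |η j|)) ^ N := mul_pow _ _ _
      _ ≤ 2 ^ N * (τ ^ N + (d * (τ * |η j|)) ^ N) := by
          gcongr
          rcases max_cases τ (d * (τ * |η j|)) with ⟨h, -⟩ | ⟨h, -⟩ <;> rw [h]
          · linarith [pow_nonneg ha N]
          · linarith [pow_pos hτ N]
  have h5 : τ ^ N * J ≤ D * ((1 + τ) ^ N * τ ^ l) := by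
    calc τ ^ N * J ≤ (1 + τ) ^ N * (D * τ ^ l) := by
          gcongr
          · linarith
          · exact hD τ x η hτ
      _ = _ := by ring
  have h6 : (τ * |η j|) ^ N * J ≤ (∑ i, C i) * ((1 + τ) ^ N * τ ^ l) :=
    (hC j τ x η hτ).trans (mul_le_mul_of_nonneg_right (hS j) (by positivity))
  calc (τ * bracket 1 η) ^ N * J ≤ 2 ^ N * (τ ^ N + (d * (τ * |η j|)) ^ N) * J := by gcongr
    _ = 2 ^ N * (τ ^ N * J + d ^ N * ((τ * |η j|) ^ N * J)) := by rw [mul_pow]; ring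
    _ ≤ 2 ^ N * (D * ((1 + τ) ^ N * τ ^ l) + d ^ N * ((∑ i, C i) * ((1 + τ) ^ N * τ ^ l))) := by
        gcongr
    _ = _ := by ring

end GaussianEstimates

/-! ### The Bessel potential as a mixture of Gaussians -/

section BesselLaw

variable {d : ℕ}

/-- The density of the Gamma law of shape `s` and rate `π`. -/
def gammaDensity (s t : ℝ) : ℝ :=
  Real.pi ^ s / Real.Gamma s * (t ^ (s - 1) * Real.exp (-Real.pi * t))

theorem gammaDensity_nonneg {s : ℝ} (hs : 0 < s) {t : ℝ} (ht : 0 < t) : 0 ≤ gammaDensity s t := by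
  have := Real.Gamma_pos_of_pos hs
  have := Real.pi_pos
  have := Real.rpow_pos_of_pos ht (s - 1)
  unfold gammaDensity
  positivity

theorem integrableOn_gammaDensity {s : ℝ} (hs : 0 < s) :
    IntegrableOn (gammaDensity s) (Ioi 0) := by
  have h := integrableOn_rpow_mul_exp_neg_mul_rpow (p := 1) (s := s - 1) (b := Real.pi)
    (by linarith) one_pos Real.pi_pos
  simp only [Real.rpow_one] at h
  exact h.const_mul _

theorem measurable_gammaDensity (s : ℝ) : Measurable (gammaDensity s) := by
  unfold gammaDensity
  fun_prop

/-- The Gamma law of shape `s` and rate `π`. -/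
def gammaLaw (s : ℝ) : Measure ℝ :=
  (volume.restrict (Ioi 0)).withDensity fun t => ENNReal.ofReal (gammaDensity s t)

/-- The Gaussian law of density `exp (-π |v|²)`. -/
def gaussLaw (d : ℕ) : Measure (E d) := volume.withDensity fun v => ENNReal.ofReal (gauss v)

theorem isFiniteMeasure_gammaLaw {s : ℝ} (hs : 0 < s) : IsFiniteMeasure (gammaLaw s) :=
  isFiniteMeasure_withDensity_ofReal (integrableOn_gammaDensity hs).2

theorem integrable_gauss : Integrable (gauss : E d → ℝ) :=
  integrable_exp_neg_mul_normSq Real.pi_pos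

instance isFiniteMeasure_gaussLaw : IsFiniteMeasure (gaussLaw d) :=
  isFiniteMeasure_withDensity_ofReal integrable_gauss.2

/-- The law of `√t v` where `t` has a Gamma law of shape `s` and `v` a Gaussian law: the kernel of
`⟨D⟩ ^ (-2 s)`. -/
def besselLaw (d : ℕ) (s : ℝ) : Measure (E d) :=
  ((gammaLaw s).prod (gaussLaw d)).map fun q => Real.sqrt q.1 • q.2

theorem isFiniteMeasure_besselLaw {s : ℝ} (hs : 0 < s) : IsFiniteMeasure (besselLaw d s) := by
  have := isFiniteMeasure_gammaLaw hs
  unfold besselLaw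
  infer_instance

theorem integral_besselLaw {s : ℝ} (hs : 0 < s) {f : E d → ℂ} (hf : Continuous f)
    {C : ℝ} (hC : ∀ z, ‖f z‖ ≤ C) :
    ∫ z, f z ∂(besselLaw d s) = ∫ t in Ioi (0 : ℝ), (gammaDensity s t : ℂ) *
      ∫ v : E d, f (Real.sqrt t • v) * (gauss v : ℂ) := by
  have := isFiniteMeasure_gammaLaw hs
  have hcont : Continuous fun q : ℝ × E d => Real.sqrt q.1 • q.2 := by fun_prop
  have hInt : Integrable (fun q : ℝ × E d => f (Real.sqrt q.1 • q.2))
      ((gammaLaw s).prod (gaussLaw d)) :=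
    Integrable.of_bound (hf.comp hcont).aestronglyMeasurable C
      (Filter.Eventually.of_forall fun q => hC _)
  rw [besselLaw, integral_map hcont.aemeasurable hf.aestronglyMeasurable, integral_prod _ hInt,
    gammaLaw, integral_withDensity_eq_integral_toReal_smul
      (measurable_gammaDensity s).ennreal_ofReal (by simp)]
  refine setIntegral_congr_fun measurableSet_Ioi fun t ht => ?_
  simp only
  rw [ENNReal.toReal_ofReal (gammaDensity_nonneg hs ht), gaussLaw,
    integral_withDensity_eq_integral_toReal_smul
      (contDiff_gauss.continuous.measurable).ennreal_ofReal (by simp), Complex.real_smul]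
  congr 1
  refine integral_congr_ae (Filter.Eventually.of_forall fun v => ?_)
  simp only
  rw [ENNReal.toReal_ofReal (gauss_pos v).le, Complex.real_smul, mul_comm]

theorem integral_character_mul_gauss (τ : ℝ) (ξ : E d) :
    ∫ v : E d, Complex.exp (-(2 * Real.pi * Complex.I) * (inner ℝ (τ • v) ξ : ℝ)) * (gauss v : ℂ) =
      (Real.exp (-Real.pi * (τ ^ 2 * ‖ξ‖ ^ 2)) : ℝ) := by
  have h := fourier_gaussian_innerProductSpace (V := E d) (b := (Real.pi : ℂ))
    (by simpa using Real.pi_pos) (τ • ξ)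
  have hpi : (Real.pi : ℂ) ≠ 0 := by exact_mod_cast Real.pi_ne_zero
  rw [Real.fourier_eq', div_self hpi, Complex.one_cpow, one_mul] at h
  convert h using 1
  · refine integral_congr_ae (Filter.Eventually.of_forall fun v => ?_)
    simp only [gauss, smul_eq_mul, inner_smul_left, inner_smul_right]
    congr 2
    · push_cast
      simp only [conj_trivial]
      ring
    · push_cast
      ring_nf
  · push_cast
    congr 1
    have h1 : (‖τ • ξ‖ : ℂ) ^ 2 = (τ : ℂ) ^ 2 * (‖ξ‖ : ℂ) ^ 2 := by
      rw [norm_smul, Real.norm_eq_abs]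
      norm_cast
      rw [mul_pow, sq_abs]
    rw [h1]
    field_simp

/-- The Gaussian integral leaves $e^{-\pi t|\xi|^2}$, and the Gamma integral gives
$\frac{\pi^s}{\Gamma(s)}\int_0^\infty t^{s-1}e^{-\pi t(1+|\xi|^2)}\,dt=(1+|\xi|^2)^{-s}$. -/
theorem integral_character_besselLaw {s : ℝ} (hs : 0 < s) (ξ : E d) :
    ∫ z, Complex.exp (-(2 * Real.pi * Complex.I) * (inner ℝ z ξ : ℝ)) ∂(besselLaw d s) =
      (bracket (-2 * s) ξ : ℝ) := by
  have hcont : Continuous fun z : E d =>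
      Complex.exp (-(2 * Real.pi * Complex.I) * (inner ℝ z ξ : ℝ)) := by fun_prop
  rw [integral_besselLaw hs hcont (C := 1)]
  · simp only [integral_character_mul_gauss]
    have hpi := Real.pi_pos
    have hG := Real.Gamma_pos_of_pos hs
    have hr : 0 < Real.pi * (1 + ‖ξ‖ ^ 2) := by positivity
    have h1 := Real.integral_rpow_mul_exp_neg_mul_Ioi hs hr
    have h2 : ∫ t in Ioi (0 : ℝ), gammaDensity s t * Real.exp (-Real.pi * (Real.sqrt t ^ 2 *
        ‖ξ‖ ^ 2)) = bracket (-2 * s) ξ := by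
      calc _ = ∫ t in Ioi (0 : ℝ), Real.pi ^ s / Real.Gamma s *
            (t ^ (s - 1) * Real.exp (-(Real.pi * (1 + ‖ξ‖ ^ 2) * t))) := by
            refine setIntegral_congr_fun measurableSet_Ioi fun t ht => ?_
            rw [Real.sq_sqrt (le_of_lt ht), gammaDensity, mul_assoc, mul_assoc, ← Real.exp_add]
            ring_nf
        _ = bracket (-2 * s) ξ := by
            rw [integral_const_mul, h1, one_div, mul_inv, Real.mul_rpow (by positivity)
              (by positivity), Real.inv_rpow hpi.le, bracket,
              show -2 * s / 2 = -s by ring, Real.rpow_neg (by positivity),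
              Real.inv_rpow (by positivity)]
            field_simp
    rw [← h2, ← integral_complex_ofReal]
    push_cast
    rfl
  · intro z
    rw [Complex.norm_exp]
    simp

/-- The first bound is integrable at $0$ because $\alpha>0$, the second at infinity because
$N>2\alpha$. If `f` is not integrable its integral is $0$ by convention and the claim is trivial. -/
theorem norm_integral_Ioi_le_of_two_bounds {α : ℝ} (hα : 0 < α) {N : ℕ} (hN : 2 * α < N) {K R : ℝ}
    (hR : 0 < R) {f : ℝ → ℂ} (h1 : ∀ t, 0 < t → ‖f t‖ ≤ K * t ^ (α - 1))
    (h2 : ∀ t, 0 < t → ‖f t‖ ≤ K * R ^ (-N : ℝ) * t ^ (α - N / 2 - 1)) :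
    ‖∫ t in Ioi (0 : ℝ), f t‖ ≤ K * (1 / α + 1 / (N / 2 - α)) * R ^ (-2 * α) := by
  have hK : 0 ≤ K := by simpa using (norm_nonneg _).trans (h1 1 one_pos)
  have hβ : 0 < N / 2 - α := by linarith
  by_cases hf : IntegrableOn f (Ioi 0)
  swap
  · rw [integral_undef hf, norm_zero]
    positivity
  -- The splitting point is where the two bounds coincide, $t^{N/2}=R^{-N}$.
  set a : ℝ := R ^ (-2 : ℝ) with ha
  have ha0 : 0 < a := Real.rpow_pos_of_pos hR _
  have hsplit : ∫ t in Ioi (0 : ℝ), f t = (∫ t in Ioc 0 a, f t) + ∫ t in Ioi a, f t := by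
    rw [← setIntegral_union (Ioc_disjoint_Ioi le_rfl) measurableSet_Ioi
      (hf.mono_set Ioc_subset_Ioi_self) (hf.mono_set (Ioi_subset_Ioi ha0.le)),
      Ioc_union_Ioi_eq_Ioi ha0.le]
  have i1 : IntegrableOn (fun t : ℝ => t ^ (α - 1)) (Ioc 0 a) :=
    (intervalIntegrable_iff_integrableOn_Ioc_of_le ha0.le).1
      (intervalIntegral.intervalIntegrable_rpow' (by linarith))
  have i2 : IntegrableOn (fun t : ℝ => t ^ (α - N / 2 - 1)) (Ioi a) :=
    integrableOn_Ioi_rpow_of_lt (by linarith) ha0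
  have b1 : ‖∫ t in Ioc 0 a, f t‖ ≤ K * (a ^ α / α) := by
    have h3 : ‖∫ t in Ioc 0 a, f t‖ ≤ ∫ t in Ioc 0 a, K * t ^ (α - 1) :=
      norm_integral_le_of_norm_le (i1.const_mul K)
        ((ae_restrict_iff' measurableSet_Ioc).2 (Filter.Eventually.of_forall
          fun t ht => h1 t ht.1))
    refine h3.trans_eq ?_
    rw [integral_const_mul, ← intervalIntegral.integral_of_le ha0.le,
      integral_rpow (Or.inl (by linarith)), sub_add_cancel, Real.zero_rpow hα.ne', sub_zero]
  have b2 : ‖∫ t in Ioi a, f t‖ ≤ K * R ^ (-N : ℝ) * (a ^ (α - N / 2) / (N / 2 - α)) := by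
    have h3 : ‖∫ t in Ioi a, f t‖ ≤ ∫ t in Ioi a, K * R ^ (-N : ℝ) * t ^ (α - N / 2 - 1) :=
      norm_integral_le_of_norm_le (i2.const_mul _)
        ((ae_restrict_iff' measurableSet_Ioi).2 (Filter.Eventually.of_forall
          fun t ht => h2 t (ha0.trans ht)))
    refine h3.trans_eq ?_
    rw [integral_const_mul, integral_Ioi_rpow_of_lt (by linarith) ha0, sub_add_cancel,
      neg_div, ← div_neg, neg_sub]
  have e1 : a ^ α = R ^ (-2 * α) := by rw [ha, ← Real.rpow_mul hR.le]
  have e2 : R ^ (-N : ℝ) * a ^ (α - N / 2) = R ^ (-2 * α) := by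
    rw [ha, ← Real.rpow_mul hR.le, ← Real.rpow_add hR]
    congr 1
    ring
  rw [hsplit]
  calc _ ≤ _ := norm_add_le _ _
    _ ≤ K * (a ^ α / α) + K * R ^ (-N : ℝ) * (a ^ (α - N / 2) / (N / 2 - α)) := add_le_add b1 b2
    _ = K * (a ^ α / α) + K * ((R ^ (-N : ℝ) * a ^ (α - N / 2)) / (N / 2 - α)) := by ring
    _ = _ := by rw [e1, e2]; ring

/-- The exponential factor of the Gamma density absorbs the losses $(1+\tau)^N$, with $\tau=\sqrt
t$, of the integrations by parts. -/
theorem one_add_sqrt_pow_mul_exp_le (N : ℕ) {t : ℝ} (ht : 0 < t) :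
    (1 + Real.sqrt t) ^ N * Real.exp (-Real.pi * t) ≤ 2 ^ N * (N.factorial * Real.exp 1) := by
  have h1 : 1 + Real.sqrt t ≤ 2 * (1 + t) := by
    have := Real.sqrt_le_sqrt (show t ≤ (1 + t) ^ 2 by nlinarith)
    rw [Real.sqrt_sq (by linarith)] at this
    linarith
  have h2 : (1 + t) ^ N ≤ N.factorial * Real.exp (1 + t) := by
    have h3 := Real.pow_div_factorial_le_exp (1 + t) (by linarith) N
    rw [div_le_iff₀ (by positivity)] at h3
    linarith
  have h4 : Real.exp (1 + t) * Real.exp (-Real.pi * t) ≤ Real.exp 1 := by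
    rw [← Real.exp_add]
    exact Real.exp_le_exp.2 (by nlinarith [Real.two_le_pi])
  calc (1 + Real.sqrt t) ^ N * Real.exp (-Real.pi * t)
      ≤ (2 * (1 + t)) ^ N * Real.exp (-Real.pi * t) := by gcongr
    _ = 2 ^ N * ((1 + t) ^ N * Real.exp (-Real.pi * t)) := by rw [mul_pow]; ring
    _ ≤ 2 ^ N * ((N.factorial * Real.exp (1 + t)) * Real.exp (-Real.pi * t)) := by gcongr
    _ = 2 ^ N * (N.factorial * (Real.exp (1 + t) * Real.exp (-Real.pi * t))) := by ring
    _ ≤ _ := by gcongr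

/-- The oscillatory integral with amplitude `A` against the measure `ν`. -/
def oscInt (ν : Measure (E d)) (ψ : ℝ → ℝ) (A : E d × E d → ℂ) (y : E d × E d) : ℂ :=
  ∫ z, A (y.1, z) * oscFactor ψ y.1 y.2 z ∂ν

/-- At scale $\tau=\sqrt t$ the Gaussian integral is $O(t^{l/2})$, and also
$O((1+\tau)^Nt^{l/2}(\sqrt t\,\langle\eta\rangle)^{-N})$. Against the density $t^{s-1}e^{-\pi t}$
these are the hypotheses of `norm_integral_Ioi_le_of_two_bounds` with $\alpha=s+l/2$ and
$R=\langle\eta\rangle$, which yields $\langle\eta\rangle^{-2\alpha}$. -/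
theorem norm_oscInt_besselLaw_le (hd : 0 < d) {s : ℝ} (hs : 0 < s) {ψ : ℝ → ℝ}
    (hψ : ContDiff ℝ ∞ ψ) (h0 : ∀ t, deriv ψ t ≠ 0) {l : ℕ} {A : E d × E d → ℂ}
    (hA : Vanishing l A) :
    ∃ C : ℝ, ∀ y, ‖oscInt (besselLaw d s) ψ A y‖ ≤ C * bracket (-2 * s - l) y.2 := by
  set α : ℝ := s + l / 2 with hα
  have hα0 : 0 < α := by positivity
  obtain ⟨N, hN⟩ := exists_nat_gt (2 * α)
  obtain ⟨C, hC0, hC⟩ := norm_gaussOsc_le hA ψ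
  obtain ⟨D, hD0, hD⟩ := norm_gaussOsc_mul_pow_le hd hψ h0 N hA
  set c : ℝ := Real.pi ^ s / Real.Gamma s with hc
  have hG := Real.Gamma_pos_of_pos hs
  have hpi := Real.pi_pos
  have hc0 : 0 < c := by positivity
  set M : ℝ := 2 ^ N * (N.factorial * Real.exp 1) with hM
  have hM0 : 0 < M := by positivity
  have hM1 : 1 ≤ M := by
    have h1 : (1 : ℝ) ≤ 2 ^ N := one_le_pow₀ (by norm_num)
    have h2 : (1 : ℝ) ≤ N.factorial := by exact_mod_cast N.factorial_pos
    have h3 : (1 : ℝ) ≤ Real.exp 1 := Real.one_le_exp (by norm_num)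
    have h4 : (1 : ℝ) ≤ N.factorial * Real.exp 1 := by nlinarith
    nlinarith
  set K : ℝ := c * (M * (C + D)) with hK
  refine ⟨K * (1 / α + 1 / (N / 2 - α)), fun y => ?_⟩
  set R : ℝ := bracket 1 y.2 with hR
  have hR0 : 0 < R := bracket_pos _ _
  have hcont : Continuous fun z : E d => A (y.1, z) * oscFactor ψ y.1 y.2 z :=
    (hA.contDiff.continuous.comp (by fun_prop : Continuous fun z : E d => (y.1, z))).mul
      (contDiff_oscFactor_right hψ _ _).continuous
  obtain ⟨B, hB⟩ := hA.hasCompactSupport.exists_bound_of_continuous hA.contDiff.continuous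
  rw [oscInt, integral_besselLaw hs hcont (C := B) (fun z => by
    rw [norm_mul, norm_oscFactor, mul_one]; exact hB _)]
  have hpow : ∀ t : ℝ, 0 < t → Real.sqrt t ^ l = t ^ ((l : ℝ) / 2) := fun t ht => by
    rw [Real.sqrt_eq_rpow, ← Real.rpow_natCast, ← Real.rpow_mul ht.le]
    congr 1
    ring
  have hn : ∀ t : ℝ, 0 < t → ‖(gammaDensity s t : ℂ)‖ =
      c * (t ^ (s - 1) * Real.exp (-Real.pi * t)) := fun t ht => by
    rw [Complex.norm_real, Real.norm_of_nonneg (gammaDensity_nonneg hs ht)]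
    rfl
  have main := norm_integral_Ioi_le_of_two_bounds (α := α) hα0 hN (K := K) hR0
    (f := fun t => (gammaDensity s t : ℂ) * gaussOsc ψ A (Real.sqrt t) y.1 y.2) ?_ ?_
  · refine main.trans_eq ?_
    congr 1
    rw [hR, bracket, bracket, ← Real.rpow_mul (by positivity)]
    congr 1
    rw [hα]
    ring
  · intro t ht
    have hexp : Real.exp (-Real.pi * t) ≤ 1 := Real.exp_le_one_iff.2 (by nlinarith)
    have htp := Real.rpow_pos_of_pos ht (s - 1)
    rw [norm_mul, hn t ht]
    calc c * (t ^ (s - 1) * Real.exp (-Real.pi * t)) * ‖gaussOsc ψ A (Real.sqrt t) y.1 y.2‖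
        ≤ c * (t ^ (s - 1) * 1) * (C * t ^ ((l : ℝ) / 2)) := by
          gcongr
          exact (hC _ _ _ (Real.sqrt_pos.2 ht)).trans_eq (by rw [hpow t ht])
      _ = c * (1 * C) * t ^ (α - 1) := by
          rw [show α - 1 = (s - 1) + (l : ℝ) / 2 by rw [hα]; ring, Real.rpow_add ht]
          ring
      _ ≤ K * t ^ (α - 1) := by
          gcongr
          rw [hK]
          gcongr
          nlinarith
  · intro t ht
    have hτ := Real.sqrt_pos.2 ht
    have htp := Real.rpow_pos_of_pos ht (s - 1)
    have h3 := hD (Real.sqrt t) y.1 y.2 hτ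
    have h4 : ‖gaussOsc ψ A (Real.sqrt t) y.1 y.2‖ ≤
        D * ((1 + Real.sqrt t) ^ N * Real.sqrt t ^ l) / (Real.sqrt t * R) ^ N := by
      rw [le_div_iff₀ (by positivity), mul_comm]
      exact h3
    have h5 : Real.sqrt t ^ N = t ^ ((N : ℝ) / 2) := by
      rw [Real.sqrt_eq_rpow, ← Real.rpow_natCast, ← Real.rpow_mul ht.le]
      congr 1
      ring
    have h6 : R ^ N = R ^ (N : ℝ) := (Real.rpow_natCast R N).symm
    have h7 := one_add_sqrt_pow_mul_exp_le N ht
    rw [norm_mul, hn t ht]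
    have hRN := Real.rpow_pos_of_pos hR0 (-N : ℝ)
    have htN := Real.rpow_pos_of_pos ht (-(N / 2) : ℝ)
    have htl := Real.rpow_pos_of_pos ht ((l : ℝ) / 2)
    calc c * (t ^ (s - 1) * Real.exp (-Real.pi * t)) * ‖gaussOsc ψ A (Real.sqrt t) y.1 y.2‖
        ≤ c * (t ^ (s - 1) * Real.exp (-Real.pi * t)) *
          (D * ((1 + Real.sqrt t) ^ N * Real.sqrt t ^ l) / (Real.sqrt t * R) ^ N) := by gcongr
      _ = c * t ^ (s - 1) * D * ((1 + Real.sqrt t) ^ N * Real.exp (-Real.pi * t)) *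
          t ^ ((l : ℝ) / 2) * (t ^ (-(N / 2) : ℝ) * R ^ (-N : ℝ)) := by
          rw [mul_pow, hpow t ht, h5, h6, Real.rpow_neg ht.le, Real.rpow_neg hR0.le]
          field_simp
      _ ≤ c * t ^ (s - 1) * D * M * t ^ ((l : ℝ) / 2) *
          (t ^ (-(N / 2) : ℝ) * R ^ (-N : ℝ)) := by gcongr
      _ = c * (M * D) * R ^ (-N : ℝ) * t ^ (α - N / 2 - 1) := by
          rw [show α - N / 2 - 1 = (s - 1) + (l : ℝ) / 2 + (-(N / 2)) by rw [hα]; ring,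
            Real.rpow_add ht, Real.rpow_add ht]
          ring
      _ ≤ K * R ^ (-N : ℝ) * t ^ (α - N / 2 - 1) := by
          have := Real.rpow_pos_of_pos ht (α - N / 2 - 1)
          gcongr
          rw [hK]
          gcongr
          linarith

end BesselLaw

/-! ### Symbols given by oscillatory integrals -/

section OscillatorySymbols

variable {d : ℕ}

/-- On a unit ball in $y$ the derivative of the integrand is bounded by a constant, thanks to the
common compact support in $z$. Constants are integrable since the measure is finite. -/
theorem hasFDerivAt_integral_of_compact {ν : Measure (E d)} [IsFiniteMeasure ν]
    {F : (E d × E d) × E d → ℂ} (hF : ContDiff ℝ ∞ F) {K : Set (E d)} (hK : IsCompact K)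
    (h0 : ∀ y z, z ∉ K → F (y, z) = 0) (y : E d × E d) :
    Integrable (fun z => fderiv ℝ (fun y => F (y, z)) y) ν ∧
    HasFDerivAt (fun y => ∫ z, F (y, z) ∂ν) (∫ z, fderiv ℝ (fun y => F (y, z)) y ∂ν) y := by
  have hd : ∀ y z, HasFDerivAt (fun y => F (y, z))
      (fderiv ℝ F (y, z) ∘L ContinuousLinearMap.inl ℝ (E d × E d) (E d)) y := fun y z =>
    ((hF.differentiable (by simp)) (y, z)).hasFDerivAt.comp (f := fun y => (y, z)) y
      (hasFDerivAt_prodMk_left y z)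
  have hcont : Continuous fun q : (E d × E d) × E d =>
      fderiv ℝ F q ∘L ContinuousLinearMap.inl ℝ (E d × E d) (E d) :=
    (hF.continuous_fderiv (by simp)).clm_comp continuous_const
  obtain ⟨C, hC⟩ := ((isCompact_closedBall y 1).prod hK).exists_bound_of_continuousOn
    hcont.continuousOn
  have hbound : ∀ y' ∈ Metric.closedBall y 1, ∀ z,
      ‖fderiv ℝ (fun y => F (y, z)) y'‖ ≤ max C 0 := by
    intro y' hy' z
    by_cases hz : z ∈ K
    · rw [(hd y' z).fderiv]
      exact (hC (y', z) ⟨hy', hz⟩).trans (le_max_left _ _)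
    · have : (fun y => F (y, z)) = fun _ => 0 := funext fun y => h0 y z hz
      rw [this]
      simp
  obtain ⟨D, hD⟩ := hK.exists_bound_of_continuousOn
    (hF.continuous.comp (by fun_prop : Continuous fun z : E d => (y, z))).continuousOn
  have hmeas : ∀ y', AEStronglyMeasurable (fun z => F (y', z)) ν := fun y' =>
    (hF.continuous.comp (by fun_prop : Continuous fun z : E d => (y', z))).aestronglyMeasurable
  have hInt : Integrable (fun z => F (y, z)) ν := by
    refine Integrable.of_bound (hmeas y) (max D 0) (Filter.Eventually.of_forall fun z => ?_)
    by_cases hz : z ∈ K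
    · exact (hD z hz).trans (le_max_left _ _)
    · rw [h0 y z hz, norm_zero]
      exact le_max_right _ _
  have hmeas' : AEStronglyMeasurable (fun z => fderiv ℝ (fun y => F (y, z)) y) ν := by
    simp only [(hd y _).fderiv]
    exact (hcont.comp (by fun_prop : Continuous fun z : E d => (y, z))).aestronglyMeasurable
  refine ⟨Integrable.of_bound hmeas' (max C 0) (Filter.Eventually.of_forall fun z =>
    hbound y (Metric.mem_closedBall_self zero_le_one) z), ?_⟩
  exact hasFDerivAt_integral_of_dominated_of_fderiv_le (F := fun y z => F (y, z))
    (F' := fun y z => fderiv ℝ (fun y => F (y, z)) y) (Metric.closedBall_mem_nhds y one_pos)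
    (Filter.Eventually.of_forall hmeas) hInt hmeas'
    (Filter.Eventually.of_forall fun z y' hy' => hbound y' hy' z) (integrable_const _)
    (Filter.Eventually.of_forall fun z y' _ => (hd y' z).differentiableAt.hasFDerivAt)

/-- The increment `f(x_j - z_j) - f(x_j)` of a function of one coordinate. -/
def increment (f : ℝ → ℝ) (j : Fin d) (y : E d × E d) : ℂ := ((f (y.1 j - y.2 j) - f (y.1 j) : ℝ) : ℂ)

theorem contDiff_increment {f : ℝ → ℝ} (hf : ContDiff ℝ ∞ f) (j : Fin d) :
    ContDiff ℝ ∞ (increment f j : E d × E d → ℂ) := by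
  have h1 : ContDiff ℝ ∞ fun y : E d × E d => y.1 j := (contDiff_coord j).comp contDiff_fst
  have h2 : ContDiff ℝ ∞ fun y : E d × E d => y.2 j := (contDiff_coord j).comp contDiff_snd
  exact Complex.ofRealCLM.contDiff.comp ((hf.comp (h1.sub h2)).sub (hf.comp h1))

theorem increment_zero (f : ℝ → ℝ) (j : Fin d) (x : E d) : increment f j (x, 0) = 0 := by
  simp [increment]

theorem fderiv_mul_oscFactor {ψ : ℝ → ℝ} (hψ : ContDiff ℝ ∞ ψ) {A : E d × E d → ℂ}
    (hA : ContDiff ℝ ∞ A) (y w : E d × E d) (z : E d) :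
    fderiv ℝ (fun y : E d × E d => A (y.1, z) * oscFactor ψ y.1 y.2 z) y w =
      (fderiv ℝ A (y.1, z) (w.1, 0) + (2 * Real.pi * Complex.I) *
        (∑ i, (increment (deriv ψ) i (y.1, z) * (w.1 i : ℂ) * (y.2 i : ℂ) +
          increment ψ i (y.1, z) * (w.2 i : ℂ))) * A (y.1, z)) * oscFactor ψ y.1 y.2 z := by
  have h1 : HasFDerivAt (fun y : E d × E d => A (y.1, z)) (fderiv ℝ A (y.1, z) ∘L
      ((ContinuousLinearMap.fst ℝ (E d) (E d)).prod 0)) y :=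
    ((hA.differentiable (by simp)) (y.1, z)).hasFDerivAt.comp
      (f := fun y : E d × E d => (y.1, z)) y (hasFDerivAt_fst.prodMk (hasFDerivAt_const z y))
  let P : Fin d → (E d × E d →L[ℝ] ℝ) := fun i =>
    EuclideanSpace.proj i ∘L ContinuousLinearMap.fst ℝ (E d) (E d)
  let Q : Fin d → (E d × E d →L[ℝ] ℝ) := fun i =>
    EuclideanSpace.proj i ∘L ContinuousLinearMap.snd ℝ (E d) (E d)
  have hP : ∀ i, HasFDerivAt (fun y : E d × E d => y.1 i) (P i) y := fun i => (P i).hasFDerivAt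
  have hQ : ∀ i, HasFDerivAt (fun y : E d × E d => y.2 i) (Q i) y := fun i => (Q i).hasFDerivAt
  have hψd := hψ.differentiable (by simp)
  have h2 : HasFDerivAt (fun y : E d × E d => ∑ i, (ψ (y.1 i - z i) - ψ (y.1 i)) * y.2 i)
      (∑ i, ((ψ (y.1 i - z i) - ψ (y.1 i)) • Q i + y.2 i •
        (deriv ψ (y.1 i - z i) • P i - deriv ψ (y.1 i) • P i))) y := by
    refine HasFDerivAt.fun_sum fun i _ => HasFDerivAt.fun_mul ?_ (hQ i)
    exact (HasDerivAt.comp_hasFDerivAt y (hψd _).hasDerivAt ((hP i).sub_const (z i))).sub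
      (HasDerivAt.comp_hasFDerivAt y (hψd _).hasDerivAt (hP i))
  have h3 := ((Complex.ofRealCLM.hasFDerivAt.comp y h2).const_mul (2 * Real.pi * Complex.I)).cexp
  have h4 : (fun y : E d × E d => A (y.1, z) * oscFactor ψ y.1 y.2 z) = fun y =>
      A (y.1, z) * Complex.exp (2 * Real.pi * Complex.I * (Complex.ofRealCLM ∘
        fun y : E d × E d => ∑ i, (ψ (y.1 i - z i) - ψ (y.1 i)) * y.2 i) y) := by
    funext y
    rw [oscFactor, inner_prodMap_sub]
    rfl
  rw [h4, (h1.fun_mul h3).fderiv, oscFactor, inner_prodMap_sub]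
  have hPw : ∀ i, P i w = w.1 i := fun i => rfl
  have hQw : ∀ i, Q i w = w.2 i := fun i => rfl
  simp only [add_apply, smul_apply, ContinuousLinearMap.comp_apply, smul_eq_mul,
    sum_apply, sub_apply, Function.comp_apply, Complex.ofRealCLM_apply, hPw, hQw, increment,
    ContinuousLinearMap.prod_apply, ContinuousLinearMap.coe_fst', zero_apply]
  push_cast
  rw [add_mul, add_comm]
  congr 1
  · ring
  · rw [show ∀ a b c e : ℂ, a * (b * (c * e)) = (c * e) * a * b from fun a b c e => by ring]
    congr 3
    refine Finset.sum_congr rfl fun i _ => ?_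
    ring

theorem Vanishing.exists_compact_right {l : ℕ} {A : E d × E d → ℂ} (hA : Vanishing l A) :
    ∃ K : Set (E d), IsCompact K ∧ ∀ x z, z ∉ K → A (x, z) = 0 :=
  ⟨Prod.snd '' tsupport A, hA.hasCompactSupport.image continuous_snd, fun x z hz =>
    image_eq_zero_of_notMem_tsupport fun h => hz ⟨(x, z), h, rfl⟩⟩

theorem Vanishing.integrable_mul_oscFactor {l : ℕ} {A : E d × E d → ℂ} (hA : Vanishing l A)
    {ψ : ℝ → ℝ} (hψ : ContDiff ℝ ∞ ψ) (ν : Measure (E d)) [IsFiniteMeasure ν] (y : E d × E d) :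
    Integrable (fun z => A (y.1, z) * oscFactor ψ y.1 y.2 z) ν := by
  obtain ⟨B, hB⟩ := hA.hasCompactSupport.exists_bound_of_continuous hA.contDiff.continuous
  refine Integrable.of_bound (Continuous.aestronglyMeasurable ?_) B
    (Filter.Eventually.of_forall fun z => ?_)
  · exact (hA.contDiff.continuous.comp (by fun_prop : Continuous fun z : E d => (y.1, z))).mul
      (contDiff_oscFactor_right hψ _ _).continuous
  · rw [norm_mul, norm_oscFactor, mul_one]
    exact hB _

theorem hasFDerivAt_oscInt {l : ℕ} {A : E d × E d → ℂ} (hA : Vanishing l A)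
    {ψ : ℝ → ℝ} (hψ : ContDiff ℝ ∞ ψ) (ν : Measure (E d)) [IsFiniteMeasure ν] (y : E d × E d) :
    DifferentiableAt ℝ (oscInt ν ψ A) y ∧ ∀ w, fderiv ℝ (oscInt ν ψ A) y w =
      ∫ z, fderiv ℝ (fun y : E d × E d => A (y.1, z) * oscFactor ψ y.1 y.2 z) y w ∂ν := by
  obtain ⟨K, hK, hK0⟩ := hA.exists_compact_right
  have hF : ContDiff ℝ ∞ fun q : (E d × E d) × E d =>
      A (q.1.1, q.2) * oscFactor ψ q.1.1 q.1.2 q.2 :=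
    (hA.contDiff.comp ((contDiff_fst.comp contDiff_fst).prodMk contDiff_snd)).mul
      (contDiff_oscFactor hψ)
  obtain ⟨h1, h2⟩ := hasFDerivAt_integral_of_compact (ν := ν) hF hK
    (fun y z hz => by simp [hK0 y.1 z hz]) y
  have h3 : HasFDerivAt (oscInt ν ψ A) _ y := h2
  refine ⟨h3.differentiableAt, fun w => ?_⟩
  rw [h3.fderiv, ← ContinuousLinearMap.integral_apply h1]

/-- The order is preserved: the factor $\eta_j$ coming from the phase is accompanied by the
increment of $\psi'$, which vanishes at $z=0$. -/
theorem fderiv_oscInt_left {l : ℕ} {A : E d × E d → ℂ} (hA : Vanishing l A)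
    {ψ : ℝ → ℝ} (hψ : ContDiff ℝ ∞ ψ) (ν : Measure (E d)) [IsFiniteMeasure ν] (j : Fin d)
    (y : E d × E d) :
    fderiv ℝ (oscInt ν ψ A) y (EuclideanSpace.single j 1, 0) =
      oscInt ν ψ (fun y => fderiv ℝ A y (EuclideanSpace.single j 1, 0)) y + (y.2 j : ℂ) *
      oscInt ν ψ (fun y => (2 * Real.pi * Complex.I * increment (deriv ψ) j y) * A y) y := by
  have hψ' : ContDiff ℝ ∞ (deriv ψ) := (contDiff_infty_iff_deriv.1 hψ).2
  rw [(hasFDerivAt_oscInt hA hψ ν y).2, oscInt, oscInt, ← integral_const_mul, ← integral_add]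
  · refine integral_congr_ae (Filter.Eventually.of_forall fun z => ?_)
    simp only [fderiv_mul_oscFactor hψ hA.contDiff]
    simp [apply_ite ((↑) : ℝ → ℂ)]
    ring
  · exact (hA.fderiv_left _).integrable_mul_oscFactor hψ ν y
  · exact ((hA.smooth_mul (contDiff_const.mul
      (contDiff_increment hψ' j))).integrable_mul_oscFactor hψ ν y).const_mul _

/-- The factor coming from the phase is an increment of $\psi$, vanishing at $z=0$, so one order of
vanishing is gained. -/
theorem fderiv_oscInt_right {l : ℕ} {A : E d × E d → ℂ} (hA : Vanishing l A)
    {ψ : ℝ → ℝ} (hψ : ContDiff ℝ ∞ ψ) (ν : Measure (E d)) [IsFiniteMeasure ν] (j : Fin d)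
    (y : E d × E d) :
    fderiv ℝ (oscInt ν ψ A) y (0, EuclideanSpace.single j 1) =
      oscInt ν ψ (fun y => (2 * Real.pi * Complex.I * increment ψ j y) * A y) y := by
  rw [(hasFDerivAt_oscInt hA hψ ν y).2, oscInt]
  refine integral_congr_ae (Filter.Eventually.of_forall fun z => ?_)
  simp only [fderiv_mul_oscFactor hψ hA.contDiff]
  simp [apply_ite ((↑) : ℝ → ℂ), ← Prod.zero_eq_mk]

/-- The oscillatory integrals against the Bessel kernel of order `-2 s` with an amplitude vanishing
to order `l` at the diagonal, as functions of order at least `-2 s - l`. -/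
def IsOscSymbol (s : ℝ) (ψ : ℝ → ℝ) (n : ℝ) (σ : E d × E d → ℂ) : Prop :=
  ∃ (l : ℕ) (A : E d × E d → ℂ), Vanishing l A ∧ -2 * s - l ≤ n ∧ σ = oscInt (besselLaw d s) ψ A

theorem bracket_mono {m n : ℝ} (h : m ≤ n) (η : E d) : bracket m η ≤ bracket n η :=
  Real.rpow_le_rpow_of_exponent_le (one_le_one_add_normSq η) (by linarith)

theorem symbolFamily_oscSymbol (hd : 0 < d) {s : ℝ} (hs : 0 < s) {ψ : ℝ → ℝ}
    (hψ : ContDiff ℝ ∞ ψ) (h0 : ∀ t, deriv ψ t ≠ 0) :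
    SymbolFamily (Generated (IsOscSymbol (d := d) s ψ)) := by
  have := isFiniteMeasure_besselLaw (d := d) hs
  have hψ' : ContDiff ℝ ∞ (deriv ψ) := (contDiff_infty_iff_deriv.1 hψ).2
  apply Generated.symbolFamily
  · rintro n σ ⟨l, A, hA, -, rfl⟩ y
    exact (hasFDerivAt_oscInt hA hψ _ y).1
  · rintro n σ ⟨l, A, hA, hn, rfl⟩ j
    simp only [fderiv_oscInt_left hA hψ]
    refine Generated.add (.base ⟨l, _, hA.fderiv_left _, hn, rfl⟩) ?_
    -- One order of vanishing is gained and one coordinate $\eta_j$ is spent, so the term returns to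
    -- order $n$.
    rw [show n = n - 1 + 1 by ring]
    refine Generated.coord j (.base ⟨l + 1, _, hA.mul
      (contDiff_const.mul (contDiff_increment hψ' j)) ?_, ?_, rfl⟩)
    · simp [increment_zero]
    · push_cast
      linarith
  · rintro n σ ⟨l, A, hA, hn, rfl⟩ j
    simp only [fderiv_oscInt_right hA hψ]
    refine Generated.base ⟨l + 1, _, hA.mul
      (contDiff_const.mul (contDiff_increment hψ j)) ?_, ?_, rfl⟩
    · simp [increment_zero]
    · push_cast
      linarith
  · rintro n σ ⟨l, A, hA, hn, rfl⟩
    obtain ⟨C, hC⟩ := norm_oscInt_besselLaw_le hd hs hψ h0 hA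
    refine ⟨max C 0, fun z => (hC z).trans ?_⟩
    exact mul_le_mul (le_max_left _ _) (bracket_mono hn _) (bracket_pos _ _).le (le_max_right _ _)

theorem Generated.mono {𝓑 : ℝ → (E d × E d → ℂ) → Prop}
    (h𝓑 : ∀ {n n' σ}, 𝓑 n σ → n ≤ n' → 𝓑 n' σ) {n : ℝ} {σ} (h : Generated 𝓑 n σ) :
    ∀ {n'}, n ≤ n' → Generated 𝓑 n' σ := by
  induction h with
  | base h => exact fun hn => .base (h𝓑 h hn)
  | add _ _ h1 h2 => exact fun hn => (h1 hn).add (h2 hn)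
  | smul c _ h => exact fun hn => (h hn).smul c
  | coord i _ h =>
    intro n' hn
    rw [show n' = n' - 1 + 1 by ring]
    exact (h (by linarith)).coord i

theorem IsOscSymbol.mono {s : ℝ} {ψ : ℝ → ℝ} {n n' : ℝ} {σ : E d × E d → ℂ}
    (h : IsOscSymbol s ψ n σ) (hn : n ≤ n') : IsOscSymbol s ψ n' σ := by
  obtain ⟨l, A, hA, h1, rfl⟩ := h
  exact ⟨l, A, hA, h1.trans hn, rfl⟩

theorem compactInX_of_generated_oscSymbol {s : ℝ} {ψ : ℝ → ℝ} {n : ℝ} {σ : E d × E d → ℂ}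
    (h : Generated (IsOscSymbol s ψ) n σ) : CompactInX fun x η => σ (x, η) := by
  induction h with
  | base h =>
    obtain ⟨l, A, hA, -, rfl⟩ := h
    refine ⟨Prod.fst '' tsupport A, hA.hasCompactSupport.image continuous_fst, fun x hx η => ?_⟩
    have : ∀ z, A (x, z) = 0 := fun z =>
      image_eq_zero_of_notMem_tsupport fun h => hx ⟨(x, z), h, rfl⟩
    simp [oscInt, this]
  | add _ _ h1 h2 =>
    obtain ⟨K, hK, hK0⟩ := h1
    obtain ⟨L, hL, hL0⟩ := h2
    refine ⟨K ∪ L, hK.union hL, fun x hx η => ?_⟩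
    simp only [mem_union, not_or] at hx
    simp [hK0 x hx.1 η, hL0 x hx.2 η]
  | smul c _ h =>
    obtain ⟨K, hK, hK0⟩ := h
    exact ⟨K, hK, fun x hx η => by simp [hK0 x hx η]⟩
  | coord i _ h =>
    obtain ⟨K, hK, hK0⟩ := h
    exact ⟨K, hK, fun x hx η => by simp [hK0 x hx η]⟩

end OscillatorySymbols

/-! ### The operator `opFtilde` is a Fourier integral operator -/

section Representation

open LineDeriv

variable {d : ℕ}

theorem fourier_inversion_apply (u : 𝓢(E d, ℂ)) (x : E d) :
    ∫ η, Complex.exp (2 * Real.pi * Complex.I * (inner ℝ x η : ℝ)) * (𝓕 u) η = u x := by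
  have h1 : 𝓕⁻ (𝓕 u) = u := fourierInv_fourier_eq u
  conv_rhs => rw [← h1, SchwartzMap.fourierInv_coe, Real.fourierInv_eq']
  refine integral_congr_ae (Filter.Eventually.of_forall fun η => ?_)
  simp only [smul_eq_mul, real_inner_comm x η]
  congr 2
  push_cast
  ring

/-- After Fubini the $\eta$-integral is Fourier inversion at the point `W z`. This turns an average
of point evaluations of `u` into an oscillatory integral with explicit symbol. -/
theorem integral_superposition {ν : Measure (E d)} [IsFiniteMeasure ν] (u : 𝓢(E d, ℂ))
    {W : E d → E d} (hW : Continuous W) {b : E d → ℂ} (hb : Continuous b) {C : ℝ}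
    (hC : ∀ z, ‖b z‖ ≤ C) :
    ∫ η, (∫ z, b z * Complex.exp (2 * Real.pi * Complex.I * (inner ℝ (W z) η : ℝ)) ∂ν) *
      (𝓕 u) η = ∫ z, b z * u (W z) ∂ν := by
  have hInt : Integrable (fun q : E d × E d => (b q.2 *
      Complex.exp (2 * Real.pi * Complex.I * (inner ℝ (W q.2) q.1 : ℝ))) * (𝓕 u) q.1)
      (volume.prod ν) := by
    refine Integrable.mono' (((𝓕 u).integrable.norm.mul_prod (integrable_const (μ := ν) C)))
      (Continuous.aestronglyMeasurable ?_) (Filter.Eventually.of_forall fun q => ?_)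
    · have h1 : Continuous fun q : E d × E d => b q.2 := hb.comp continuous_snd
      have h2 : Continuous fun q : E d × E d => W q.2 := hW.comp continuous_snd
      have h3 : Continuous fun q : E d × E d => (𝓕 u) q.1 := (𝓕 u).continuous.comp continuous_fst
      fun_prop
    · have : ‖Complex.exp (2 * Real.pi * Complex.I * (inner ℝ (W q.2) q.1 : ℝ))‖ = 1 := by
        rw [Complex.norm_exp]; simp
      rw [norm_mul, norm_mul, this, mul_one, mul_comm]
      exact mul_le_mul_of_nonneg_left (hC _) (norm_nonneg _)
  simp only [← integral_mul_const]
  rw [integral_integral_swap hInt]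
  refine integral_congr_ae (Filter.Eventually.of_forall fun z => ?_)
  simp only [mul_assoc, integral_const_mul]
  have := fourier_inversion_apply u (W z)
  simp only [mul_assoc] at this
  rw [this]

/-- For negative order the multiplier is the characteristic function of a finite measure, so the
operator is convolution with that measure. -/
theorem japD_eq_integral_besselLaw {s : ℝ} (hs : 0 < s) (u : 𝓢(E d, ℂ)) (x : E d) :
    japD (-2 * s) u x = ∫ z, u (x - z) ∂(besselLaw d s) := by
  have := isFiniteMeasure_besselLaw (d := d) hs
  have h := integral_superposition (ν := besselLaw d s) u (W := fun z => x - z) (by fun_prop)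
    (b := fun _ => 1) continuous_const (C := 1) (by simp)
  simp only [one_mul] at h
  rw [← h, japD_apply]
  refine integral_congr_ae (Filter.Eventually.of_forall fun η => ?_)
  simp only
  rw [← integral_character_besselLaw hs η, ← mul_assoc, ← integral_const_mul]
  congr 1
  refine integral_congr_ae (Filter.Eventually.of_forall fun z => ?_)
  simp only
  rw [← Complex.exp_add, inner_sub_left]
  congr 1
  push_cast
  ring

theorem hasTemperateGrowth_bracket (m : ℝ) :
    (fun η : E d => (bracket m η : ℂ)).HasTemperateGrowth :=
  Function.HasTemperateGrowth.comp (g := Complex.ofReal) (by fun_prop) (Function.hasTemperateGrowth_one_add_norm_sq_rpow (E d) (m / 2))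

theorem integrable_bracket_mul (m : ℝ) (u : 𝓢(E d, ℂ)) :
    Integrable fun η => (bracket m η : ℂ) * u η := by
  refine (SchwartzMap.smulLeftCLM ℂ (fun η : E d => (bracket m η : ℂ)) u).integrable.congr
    (Filter.Eventually.of_forall fun η => ?_)
  rw [SchwartzMap.smulLeftCLM_apply_apply (hasTemperateGrowth_bracket m), smul_eq_mul]

theorem norm_exp_two_pi_I_mul (t : ℝ) :
    ‖Complex.exp (2 * Real.pi * Complex.I * (t : ℂ))‖ = 1 := by
  rw [Complex.norm_exp]; simp

theorem integrable_fio {Φ : E d → ℝ} (hΦ : Continuous Φ) {σ : E d → ℂ} (hσ : Continuous σ)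
    {C n : ℝ} (hC : ∀ η, ‖σ η‖ ≤ C * bracket n η) (u : 𝓢(E d, ℂ)) :
    Integrable fun η => Complex.exp (2 * Real.pi * Complex.I * (Φ η : ℂ)) * σ η * u η := by
  have h3 := u.continuous
  refine Integrable.mono' ((integrable_bracket_mul n u).norm.const_mul C)
    (Continuous.aestronglyMeasurable (by fun_prop)) (Filter.Eventually.of_forall fun η => ?_)
  rw [norm_mul, norm_mul, norm_exp_two_pi_I_mul, one_mul, norm_mul, Complex.norm_real,
    Real.norm_of_nonneg (bracket_pos _ _).le, ← mul_assoc]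
  exact mul_le_mul_of_nonneg_right (hC η) (norm_nonneg _)

theorem japD_add (m : ℝ) (u v : 𝓢(E d, ℂ)) (x : E d) :
    japD m (u + v : 𝓢(E d, ℂ)) x = japD m u x + japD m v x := by
  have hb : Continuous fun η : E d => (bracket m η : ℂ) :=
    Complex.continuous_ofReal.comp (contDiff_bracket m).continuous
  have hC : ∀ η : E d, ‖(bracket m η : ℂ)‖ ≤ 1 * bracket m η := fun η => by
    rw [Complex.norm_real, Real.norm_of_nonneg (bracket_pos _ _).le, one_mul]
  have hI : ∀ u : 𝓢(E d, ℂ), Integrable fun η => Complex.exp (2 * Real.pi * Complex.I *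
      (inner ℝ x η : ℝ)) * ((bracket m η : ℂ) * (𝓕 u) η) := fun u => by
    simpa only [mul_assoc] using integrable_fio (Φ := fun η => inner ℝ x η) (by fun_prop) hb hC (𝓕 u)
  simp only [japD_apply, ← SchwartzMap.fourier_coe]
  rw [← integral_add (hI u) (hI v)]
  refine integral_congr_ae (Filter.Eventually.of_forall fun η => ?_)
  simp only [FourierTransform.fourier_add, add_apply]
  ring

theorem japD_smul (m : ℝ) (c : ℂ) (u : 𝓢(E d, ℂ)) (x : E d) :
    japD m (c • u : 𝓢(E d, ℂ)) x = c * japD m u x := by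
  simp only [japD_apply, ← SchwartzMap.fourier_coe, ← integral_const_mul]
  refine integral_congr_ae (Filter.Eventually.of_forall fun η => ?_)
  simp only [FourierTransform.fourier_smul, smul_apply, smul_eq_mul]
  ring

/-- The partial derivative `∂_j` on Schwartz functions. -/
def coordDeriv (j : Fin d) (u : 𝓢(E d, ℂ)) : 𝓢(E d, ℂ) :=
  ∂_{(EuclideanSpace.single j (1 : ℝ) : E d)} u

theorem coordDeriv_apply (j : Fin d) (u : 𝓢(E d, ℂ)) (x : E d) :
    coordDeriv j u x = fderiv ℝ u x (EuclideanSpace.single j 1) := rfl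

theorem coordDeriv_add (j : Fin d) (u v : 𝓢(E d, ℂ)) :
    coordDeriv j (u + v) = coordDeriv j u + coordDeriv j v := lineDerivOp_add _ _ _

theorem fourier_coordDeriv (f : 𝓢(E d, ℂ)) (j : Fin d) (η : E d) :
    (𝓕 (coordDeriv j f)) η =
      2 * Real.pi * Complex.I * (η j : ℂ) * (𝓕 f) η := by
  rw [coordDeriv, SchwartzMap.fourier_lineDerivOp_eq, smul_apply,
    SchwartzMap.smulLeftCLM_apply_apply (by fun_prop)]
  simp [EuclideanSpace.inner_single_right]
  ring

/-- The Schwartz function `1 - Δ / (4 π²)` applied to `u`. -/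
def oneSubLaplacian (u : 𝓢(E d, ℂ)) : 𝓢(E d, ℂ) :=
  u + ∑ j, (-(1 / (4 * Real.pi ^ 2) : ℂ)) • coordDeriv j
    (coordDeriv j u)

theorem fourier_sum {ι : Type*} (s : Finset ι) (u : ι → 𝓢(E d, ℂ)) :
    𝓕 (∑ j ∈ s, u j) = ∑ j ∈ s, 𝓕 (u j) :=
  map_sum (fourierCLM ℂ 𝓢(E d, ℂ)) u s

theorem fourier_oneSubLaplacian (u : 𝓢(E d, ℂ)) (η : E d) :
    (𝓕 (oneSubLaplacian u)) η = ((1 + ‖η‖ ^ 2 : ℝ) : ℂ) * (𝓕 u) η := by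
  rw [oneSubLaplacian, FourierTransform.fourier_add, fourier_sum, add_apply,
    sum_apply]
  simp only [FourierTransform.fourier_smul, smul_apply, fourier_coordDeriv]
  have hpi : (Real.pi : ℂ) ≠ 0 := by exact_mod_cast Real.pi_ne_zero
  have h1 : ∀ j : Fin d, (-(1 / (4 * Real.pi ^ 2) : ℂ)) • (2 * Real.pi * Complex.I * (η j : ℂ) *
      (2 * Real.pi * Complex.I * (η j : ℂ) * (𝓕 u) η)) = ((η j ^ 2 : ℝ) : ℂ) * (𝓕 u) η := by
    intro j
    rw [smul_eq_mul]
    field_simp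
    push_cast
    linear_combination (-4 * (η j : ℂ) ^ 2 * (𝓕 u) η) * Complex.I_sq
  simp only [h1]
  rw [← Finset.sum_mul, EuclideanSpace.real_norm_sq_eq]
  push_cast
  ring

theorem japD_add_two (m : ℝ) (u : 𝓢(E d, ℂ)) (x : E d) :
    japD (m + 2) u x = japD m (oneSubLaplacian u) x := by
  simp only [japD_apply, ← SchwartzMap.fourier_coe]
  refine integral_congr_ae (Filter.Eventually.of_forall fun η => ?_)
  have h : bracket 2 η = 1 + ‖η‖ ^ 2 := by simp [bracket]
  simp only [fourier_oneSubLaplacian, bracket_add, h]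
  push_cast
  ring

/-- The twisted product `a · (f ∘ ψ)`, where `ψ` acts on each coordinate, for a test
function `a`. -/
def twist {ψ : ℝ → ℝ} (hψ : ContDiff ℝ ∞ ψ) {a : E d → ℂ} (ha : ContDiff ℝ ∞ a)
    (hac : HasCompactSupport a) (f : 𝓢(E d, ℂ)) : 𝓢(E d, ℂ) :=
  HasCompactSupport.toSchwartzMap (f := fun y => a y * f (prodMap ψ y)) hac.mul_right
    (ha.mul ((f.smooth ⊤).comp (contDiff_prodMap hψ)))

theorem twist_apply {ψ : ℝ → ℝ} (hψ : ContDiff ℝ ∞ ψ) {a : E d → ℂ} (ha : ContDiff ℝ ∞ a)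
    (hac : HasCompactSupport a) (f : 𝓢(E d, ℂ)) (y : E d) :
    twist hψ ha hac f y = a y * f (prodMap ψ y) := rfl

theorem contDiff_deriv_coord {ψ : ℝ → ℝ} (hψ : ContDiff ℝ ∞ ψ) (j : Fin d) :
    ContDiff ℝ ∞ fun y : E d => ((deriv ψ (y j) : ℝ) : ℂ) :=
  Complex.ofRealCLM.contDiff.comp (((contDiff_infty_iff_deriv.1 hψ).2).comp (contDiff_coord j))

theorem contDiff_fderiv_single {a : E d → ℂ} (ha : ContDiff ℝ ∞ a) (j : Fin d) :
    ContDiff ℝ ∞ fun y => fderiv ℝ a y (EuclideanSpace.single j 1) :=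
  (ha.fderiv_right (by simp)).clm_apply contDiff_const

theorem coordDeriv_twist {ψ : ℝ → ℝ} (hψ : ContDiff ℝ ∞ ψ) {a : E d → ℂ} (ha : ContDiff ℝ ∞ a)
    (hac : HasCompactSupport a) (f : 𝓢(E d, ℂ)) (j : Fin d) :
    coordDeriv j (twist hψ ha hac f) =
      twist hψ (contDiff_fderiv_single ha j) (hac.fderiv_apply (𝕜 := ℝ) _) f +
      twist hψ (ha.mul (contDiff_deriv_coord hψ j)) hac.mul_right
        (coordDeriv j f) := by
  ext y
  rw [add_apply, twist_apply, twist_apply, coordDeriv_apply,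
    coordDeriv_apply]
  have h1 := ((ha.differentiable (by simp)) y).hasFDerivAt
  have h2 := (f.differentiableAt (x := prodMap ψ y)).hasFDerivAt.comp y
    (((contDiff_prodMap (d := d) hψ).differentiable (by simp)) y).hasFDerivAt
  have h3 := (h1.fun_mul h2).fderiv
  have h4 : (twist hψ ha hac f : E d → ℂ) = fun y => a y * (f ∘ prodMap ψ) y := rfl
  have h5 : fderiv ℝ (prodMap ψ : E d → E d) y (EuclideanSpace.single j 1) =
      deriv ψ (y j) • EuclideanSpace.single j 1 := by
    ext i
    rw [fderiv_prodMap_apply hψ]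
    by_cases hij : i = j
    · subst hij; simp
    · simp [hij]
  rw [h4, h3]
  simp only [add_apply, smul_apply, ContinuousLinearMap.comp_apply, h5, map_smul,
    Function.comp_apply, smul_eq_mul, Complex.real_smul]
  ring

/-- `T` is given by an oscillatory integral with phase `ψ(x) · η` and a symbol of order `n`. -/
def IsOscOperator (s : ℝ) (ψ : ℝ → ℝ) (n : ℝ) (T : 𝓢(E d, ℂ) → E d → ℂ) : Prop :=
  ∃ σ : E d × E d → ℂ, Generated (IsOscSymbol s ψ) n σ ∧
    ∀ f x, T f x = fio (linearPhase (prodMap ψ)) (fun x η => σ (x, η)) f x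

namespace IsOscOperator

variable {s : ℝ} {ψ : ℝ → ℝ}

theorem mono {n n' : ℝ} {T : 𝓢(E d, ℂ) → E d → ℂ} (h : IsOscOperator s ψ n T) (hn : n ≤ n') :
    IsOscOperator s ψ n' T := by
  obtain ⟨σ, h1, h2⟩ := h
  exact ⟨σ, h1.mono (fun h hn => h.mono hn) hn, h2⟩

theorem add (hd : 0 < d) (hs : 0 < s) (hψ : ContDiff ℝ ∞ ψ) (h0 : ∀ t, deriv ψ t ≠ 0) {n : ℝ}
    {T U : 𝓢(E d, ℂ) → E d → ℂ} (hT : IsOscOperator s ψ n T) (hU : IsOscOperator s ψ n U) :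
    IsOscOperator s ψ n fun f x => T f x + U f x := by
  obtain ⟨σ, h1, h2⟩ := hT
  obtain ⟨τ, h3, h4⟩ := hU
  refine ⟨_, h1.add h3, fun f x => ?_⟩
  have hfam := symbolFamily_oscSymbol (d := d) hd hs hψ h0
  have hI : ∀ {σ}, Generated (IsOscSymbol s ψ) n σ → Integrable fun η =>
      Complex.exp (2 * Real.pi * Complex.I * (linearPhase (prodMap ψ) x η : ℂ)) * σ (x, η) *
        (𝓕 f) η := by
    intro σ hσ
    obtain ⟨C, hC⟩ := hfam.bound hσ
    exact integrable_fio (by unfold linearPhase; fun_prop) (hfam.contDiff_right hσ x).continuous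
      (fun η => hC (x, η)) _
  simp only [h2, h4]
  rw [fio, fio, fio, ← integral_add (hI h1) (hI h3)]
  refine integral_congr_ae (Filter.Eventually.of_forall fun η => ?_)
  simp only
  ring

theorem smul (c : ℂ) {n : ℝ} {T : 𝓢(E d, ℂ) → E d → ℂ} (hT : IsOscOperator s ψ n T) :
    IsOscOperator s ψ n fun f x => c * T f x := by
  obtain ⟨σ, h1, h2⟩ := hT
  refine ⟨_, h1.smul c, fun f x => ?_⟩
  simp only [h2]
  rw [fio, fio, ← integral_const_mul]
  refine integral_congr_ae (Filter.Eventually.of_forall fun η => ?_)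
  simp only
  ring

theorem comp_coordDeriv (j : Fin d) {n : ℝ} {T : 𝓢(E d, ℂ) → E d → ℂ}
    (hT : IsOscOperator s ψ n T) : IsOscOperator s ψ (n + 1)
      fun f => T (coordDeriv j f) := by
  obtain ⟨σ, h1, h2⟩ := hT
  refine ⟨_, (h1.coord j).smul (2 * Real.pi * Complex.I), fun f x => ?_⟩
  simp only [h2]
  rw [fio, fio]
  refine integral_congr_ae (Filter.Eventually.of_forall fun η => ?_)
  simp only [fourier_coordDeriv]
  ring

theorem add_sum (hd : 0 < d) (hs : 0 < s) (hψ : ContDiff ℝ ∞ ψ) (h0 : ∀ t, deriv ψ t ≠ 0) {n : ℝ}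
    {T : 𝓢(E d, ℂ) → E d → ℂ} (hT : IsOscOperator s ψ n T) {ι : Type*} (S : Finset ι)
    {U : ι → 𝓢(E d, ℂ) → E d → ℂ} (hU : ∀ i, IsOscOperator s ψ n (U i)) :
    IsOscOperator s ψ n fun f x => T f x + ∑ i ∈ S, U i f x := by
  classical
  induction S using Finset.induction_on with
  | empty => simpa using hT
  | insert i S hi ih =>
    convert add hd hs hψ h0 ih (hU i) using 3
    rw [Finset.sum_insert hi]
    ring

end IsOscOperator

/-- Writing the Bessel potential as an average over `z` and expanding `f` at $\psi(x-z)$ by Fourier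
inversion, the phase $\psi(x)\cdot\eta$ factors out. What remains is an oscillatory integral with
amplitude $H(x)a(x-z)$, which has compact support in both variables. -/
theorem isOscOperator_japD_twist_base {s : ℝ} (hs : 0 < s) {ψ : ℝ → ℝ} (hψ : ContDiff ℝ ∞ ψ)
    {H a : E d → ℂ} (hH : ContDiff ℝ ∞ H) (hHc : HasCompactSupport H) (ha : ContDiff ℝ ∞ a)
    (hac : HasCompactSupport a) :
    IsOscOperator s ψ (-2 * s) fun f x => H x * japD (-2 * s) (twist hψ ha hac f) x := by
  have := isFiniteMeasure_besselLaw (d := d) hs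
  have hA : Vanishing 0 fun y : E d × E d => H y.1 * a (y.1 - y.2) := by
    refine .base ((hH.comp contDiff_fst).mul (ha.comp (contDiff_fst.sub contDiff_snd))) ?_
    refine HasCompactSupport.intro (K := (fun q : E d × E d => (q.1, q.1 - q.2)) ''
      (tsupport H ×ˢ tsupport a)) ((hHc.prod hac).image (by fun_prop)) fun y hy => ?_
    by_contra hne
    refine hy ⟨(y.1, y.1 - y.2), ⟨subset_tsupport _ (left_ne_zero_of_mul hne),
      subset_tsupport _ (right_ne_zero_of_mul hne)⟩, ?_⟩
    simp
  refine ⟨_, .base ⟨0, _, hA, by simp, rfl⟩, fun f x => ?_⟩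
  obtain ⟨C, hC⟩ := hac.exists_bound_of_continuous ha.continuous
  have hψc : Continuous (prodMap ψ : E d → E d) := (contDiff_prodMap hψ).continuous
  have hac' := ha.continuous
  have key := integral_superposition (ν := besselLaw d s) f (W := fun z => prodMap ψ (x - z))
    (by fun_prop) (b := fun z => H x * a (x - z)) (by fun_prop) (C := ‖H x‖ * C) (fun z => by
      rw [norm_mul]; exact mul_le_mul_of_nonneg_left (hC _) (norm_nonneg _))
  simp only [japD_eq_integral_besselLaw hs, ← integral_const_mul]
  simp only [twist_apply, ← mul_assoc]
  rw [← key, fio]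
  refine integral_congr_ae (Filter.Eventually.of_forall fun η => ?_)
  simp only [oscInt]
  rw [← integral_const_mul]
  congr 1
  refine integral_congr_ae (Filter.Eventually.of_forall fun z => ?_)
  simp only [oscFactor, linearPhase]
  have h1 : ∀ b e₁ e₂ : ℂ, e₁ * (b * e₂) = b * (e₁ * e₂) := fun b e₁ e₂ => by ring
  rw [h1, ← Complex.exp_add, inner_sub_left]
  congr 2
  push_cast
  ring

theorem oneSubLaplacian_twist {ψ : ℝ → ℝ} (hψ : ContDiff ℝ ∞ ψ) {a : E d → ℂ}
    (ha : ContDiff ℝ ∞ a) (hac : HasCompactSupport a) (m : ℝ) (f : 𝓢(E d, ℂ)) (x : E d) :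
    japD m (oneSubLaplacian (twist hψ ha hac f)) x = japD m (twist hψ ha hac f) x +
      ∑ j, (-(1 / (4 * Real.pi ^ 2) : ℂ)) *
        japD m (coordDeriv j
          (coordDeriv j (twist hψ ha hac f))) x := by
  have h : ∀ (S : Finset (Fin d)) (u : 𝓢(E d, ℂ)) (v : Fin d → 𝓢(E d, ℂ)),
      japD m (u + ∑ j ∈ S, v j : 𝓢(E d, ℂ)) x = japD m u x + ∑ j ∈ S, japD m (v j) x := by
    intro S u v
    classical
    induction S using Finset.induction_on generalizing u with
    | empty => simp
    | insert i S hi ih =>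
      rw [Finset.sum_insert hi, Finset.sum_insert hi, ← add_assoc, ih, japD_add, add_assoc]
  rw [oneSubLaplacian, h]
  simp only [japD_smul]

/-- Each step of the induction on `k` trades $\langle D\rangle^2$ for $1-\Delta/4\pi^2$ acting on
the twisted product. The amplitude is kept arbitrary, since differentiation produces the new
amplitudes $\partial_ja$ and $a\,\psi'(y_j)$. -/
theorem isOscOperator_japD_twist (hd : 0 < d) {s : ℝ} (hs : 0 < s) {ψ : ℝ → ℝ}
    (hψ : ContDiff ℝ ∞ ψ) (h0 : ∀ t, deriv ψ t ≠ 0)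
    {H : E d → ℂ} (hH : ContDiff ℝ ∞ H) (hHc : HasCompactSupport H) (k : ℕ) :
    ∀ {a : E d → ℂ} (ha : ContDiff ℝ ∞ a) (hac : HasCompactSupport a),
    IsOscOperator s ψ (-2 * s + 2 * k)
      fun f x => H x * japD (-2 * s + 2 * k) (twist hψ ha hac f) x := by
  induction k with
  | zero =>
    intro a ha hac
    simpa using isOscOperator_japD_twist_base hs hψ hH hHc ha hac
  | succ k ih =>
    intro a ha hac
    set m : ℝ := -2 * s + 2 * k with hm
    have hm2 : -2 * s + 2 * ((k + 1 : ℕ) : ℝ) = m + 2 := by push_cast; rw [hm]; ring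
    rw [hm2]
    have hterm : ∀ j : Fin d, IsOscOperator s ψ (m + 2) fun f x =>
        (-(1 / (4 * Real.pi ^ 2) : ℂ)) * (H x * japD m (coordDeriv j
          (coordDeriv j (twist hψ ha hac f))) x) := by
      intro j
      refine IsOscOperator.smul _ ?_
      have c1 := contDiff_fderiv_single ha j
      have k1 : HasCompactSupport fun y => fderiv ℝ a y (EuclideanSpace.single j 1) :=
        hac.fderiv_apply (𝕜 := ℝ) _
      have c2 := ha.mul (contDiff_deriv_coord hψ j)
      have k2 : HasCompactSupport fun y : E d => a y * ((deriv ψ (y j) : ℝ) : ℂ) := hac.mul_right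
      -- The four terms of $\partial_j^2(a\cdot f\circ\psi)$, according to whether each derivative
      -- falls on the amplitude or on `f`. Each derivative of `f` raises the order by one; `mono`
      -- brings all four to order $m+2$.
      have t1 := (ih (contDiff_fderiv_single c1 j) (k1.fderiv_apply (𝕜 := ℝ) _)).mono
        (show m ≤ m + 2 by linarith)
      have t2 := ((ih (c1.mul (contDiff_deriv_coord hψ j)) k1.mul_right).comp_coordDeriv j).mono
        (show m + 1 ≤ m + 2 by linarith)
      have t3 := ((ih (contDiff_fderiv_single c2 j)
        (k2.fderiv_apply (𝕜 := ℝ) _)).comp_coordDeriv j).mono (show m + 1 ≤ m + 2 by linarith)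
      have t4 := ((ih (c2.mul (contDiff_deriv_coord hψ j))
        k2.mul_right).comp_coordDeriv j).comp_coordDeriv j
      rw [show m + 1 + 1 = m + 2 by ring] at t4
      have t := IsOscOperator.add hd hs hψ h0 (IsOscOperator.add hd hs hψ h0 t1 t2)
        (IsOscOperator.add hd hs hψ h0 t3 t4)
      convert t using 3 with f x
      rw [coordDeriv_twist hψ ha hac, coordDeriv_add, coordDeriv_twist, coordDeriv_twist,
        japD_add, japD_add, japD_add]
      ring
    have t := IsOscOperator.add_sum hd hs hψ h0 ((ih ha hac).mono (show m ≤ m + 2 by linarith))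
      Finset.univ hterm
    convert t using 3 with f x
    rw [japD_add_two, oneSubLaplacian_twist, mul_add, Finset.mul_sum]
    congr 1
    refine Finset.sum_congr rfl fun j _ => ?_
    ring

/-- The amplitude of the adjoint of composition with the product map of `φ`, cut off by `G`. -/
def adjointAmplitude (φ : ℝ ≃ ℝ) (G : E d → ℝ) (y : E d) : ℂ :=
  ((|∏ i, deriv φ (φ.symm (y i))|⁻¹ * G (prodMap φ.symm y) : ℝ) : ℂ)

theorem compAdjoint_eq {φ : ℝ ≃ ℝ} (hφ : IsNonlinearDiffeo φ) (G : E d → ℝ) (f : E d → ℂ) :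
    compAdjoint φ (fun y => (G y : ℂ) * f y) = fun y =>
      adjointAmplitude φ G y * f (prodMap φ.symm y) := by
  funext y
  rw [compAdjoint, det_fderiv_prodMap hφ.smooth, adjointAmplitude]
  push_cast
  rw [mul_assoc]
  rfl

theorem contDiff_adjointAmplitude {φ : ℝ ≃ ℝ} (hφ : IsNonlinearDiffeo φ) {G : E d → ℝ}
    (hG : ContDiff ℝ ∞ G) : ContDiff ℝ ∞ (adjointAmplitude φ G) := by
  have h1 : ContDiff ℝ ∞ fun y : E d => ∏ i, deriv φ (φ.symm (y i)) :=
    contDiff_prod fun i _ => ((contDiff_infty_iff_deriv.1 hφ.smooth).2.comp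
      hφ.smooth_symm).comp (contDiff_coord i)
  have h2 : ∀ y : E d, ∏ i, deriv φ (φ.symm (y i)) ≠ 0 := fun y =>
    Finset.prod_ne_zero_iff.2 fun i _ => hφ.deriv_ne_zero _
  exact Complex.ofRealCLM.contDiff.comp (((h1.abs h2).inv fun y => abs_ne_zero.2 (h2 y)).mul
    (hG.comp (contDiff_prodMap hφ.smooth_symm)))

theorem hasCompactSupport_comp_prodMap_symm {φ : ℝ ≃ ℝ} (hφ : IsNonlinearDiffeo φ) {G : E d → ℝ}
    (hG : HasCompactSupport G) : HasCompactSupport fun y : E d => G (prodMap φ.symm y) := by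
  refine HasCompactSupport.intro (K := prodMap φ '' tsupport G)
    (hG.image (contDiff_prodMap hφ.smooth).continuous) fun y hy => ?_
  by_contra hne
  exact hy ⟨prodMap φ.symm y, subset_tsupport _ hne, prodMap_prodMap_symm φ y⟩

theorem hasCompactSupport_adjointAmplitude {φ : ℝ ≃ ℝ} (hφ : IsNonlinearDiffeo φ) {G : E d → ℝ}
    (hG : HasCompactSupport G) : HasCompactSupport (adjointAmplitude φ G) :=
  ((hasCompactSupport_comp_prodMap_symm hφ hG).mul_left).comp_left Complex.ofReal_zero

theorem exists_isFourierIntegral_opFtilde (hd : 0 < d) (m : ℝ) {φ : ℝ ≃ ℝ}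
    (hφ : IsNonlinearDiffeo φ) {G H : E d → ℝ} (hG : IsCutoff G) (hH : IsCutoff H) :
    ∃ σ, IsFourierIntegral m (linearPhase (prodMap φ.symm)) σ (opFtilde m φ G H) := by
  -- Any $k>m/2$ writes $m=2k-2s$ with $s>0$, as the Gamma law requires.
  obtain ⟨k, hk⟩ := exists_nat_gt (m / 2)
  set s : ℝ := (2 * k - m) / 2 with hs
  have hs0 : 0 < s := by rw [hs]; linarith
  have hm : -2 * s + 2 * k = m := by rw [hs]; ring
  obtain ⟨σ, h1, h2⟩ := isOscOperator_japD_twist hd hs0 hφ.smooth_symm hφ.deriv_symm_ne_zero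
    hH.contDiff_ofReal hH.hasCompactSupport_ofReal k (contDiff_adjointAmplitude hφ hG.smooth)
    (hasCompactSupport_adjointAmplitude hφ hG.compact)
  rw [hm] at h1 h2
  refine ⟨fun x η => σ (x, η), isPhase_linearPhase hφ.smooth_symm hφ.deriv_symm_ne_zero,
    (symbolFamily_oscSymbol hd hs0 hφ.smooth_symm hφ.deriv_symm_ne_zero).isSymbol h1,
    compactInX_of_generated_oscSymbol h1, fun f x => ?_⟩
  rw [← h2, opFtilde, compAdjoint_eq hφ]
  rfl

end Representation

/-! ### Decay of the Fourier transform of a chirp -/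

section Chirp

variable {d : ℕ}

/-- The integrand is the derivative of $s\arctan(q/\sqrt L)/\sqrt L$, and $\arctan$ varies by at
most $\pi$. -/
theorem integral_deriv_div_sq_add_le {a b L s : ℝ} (hL : 0 < L) (hs : |s| = 1)
    {q q' : ℝ → ℝ} (hq : ∀ x, HasDerivAt q (q' x) x) (hq' : Continuous q') :
    ∫ x in a..b, s * q' x / (q x ^ 2 + L) ≤ Real.pi / √L := by
  have hqc : Continuous q := continuous_iff_continuousAt.2 fun x => (hq x).continuousAt
  have hL' : 0 < √L := Real.sqrt_pos.2 hL
  have hpos : ∀ x, 0 < q x ^ 2 + L := fun x => by positivity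
  have hF : ∀ x, HasDerivAt (fun x => s * (Real.arctan (q x / √L) / √L))
      (s * q' x / (q x ^ 2 + L)) x := fun x => by
    refine ((((hq x).div_const √L).arctan.div_const √L).const_mul s).congr_deriv ?_
    have h1 : 1 + (q x / √L) ^ 2 = (q x ^ 2 + L) / L := by
      rw [div_pow, Real.sq_sqrt hL.le]; field_simp; ring
    have h2 : √L * √L = L := Real.mul_self_sqrt hL.le
    rw [h1]
    have := (hpos x).ne'
    field_simp
    rw [pow_two, h2]
    ring
  rw [intervalIntegral.integral_eq_sub_of_hasDerivAt (fun x _ => hF x)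
    (Continuous.intervalIntegrable ((continuous_const.mul hq').div (by fun_prop)
      fun x => (hpos x).ne') a b), ← mul_sub, ← sub_div, mul_div_assoc']
  refine div_le_div_of_nonneg_right ?_ hL'.le
  refine (le_abs_self _).trans ?_
  rw [abs_mul, hs, one_mul, abs_le]
  have h1 := Real.arctan_lt_pi_div_two (q b / √L)
  have h2 := Real.neg_pi_div_two_lt_arctan (q b / √L)
  have h3 := Real.arctan_lt_pi_div_two (q a / √L)
  have h4 := Real.neg_pi_div_two_lt_arctan (q a / √L)
  constructor <;> linarith

theorem abs_div_sq_add_le {L : ℝ} (hL : 0 < L) (t : ℝ) : |t / (t ^ 2 + L)| ≤ 1 / √L := by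
  have hL' : 0 < √L := Real.sqrt_pos.2 hL
  have h2 : √L * √L = L := Real.mul_self_sqrt hL.le
  rw [abs_div, abs_of_pos (a := t ^ 2 + L) (by positivity), div_le_div_iff₀ (by positivity) hL',
    ← sq_abs t]
  nlinarith [sq_nonneg (|t| - √L), abs_nonneg t, mul_nonneg (abs_nonneg t) hL'.le]

/-- Van der Corput's second derivative test, with a smooth amplitude. -/
theorem norm_integral_mul_cexp_le {a b L M s : ℝ} (hab : a ≤ b) (hL : 0 < L) (hs : |s| = 1)
    {Φ q q' θ θ' : ℝ → ℝ} (hΦ : ∀ x, HasDerivAt Φ (q x) x) (hq : ∀ x, HasDerivAt q (q' x) x)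
    (hq' : Continuous q') (hsq : ∀ x ∈ Icc a b, L ≤ s * q' x)
    (hθ : ∀ x, HasDerivAt θ (θ' x) x) (hθ' : Continuous θ') (hθa : θ a = 0) (hθb : θ b = 0)
    (hM : ∀ x, |θ x| ≤ M) :
    ‖∫ x in a..b, (θ x : ℂ) * Complex.exp (Complex.I * (Φ x : ℂ))‖ ≤
      ((∫ x in a..b, |θ' x|) + 2 * M * Real.pi) / √L := by
  have hΦc : Continuous Φ := continuous_iff_continuousAt.2 fun x => (hΦ x).continuousAt
  have hqc : Continuous q := continuous_iff_continuousAt.2 fun x => (hq x).continuousAt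
  have hθc : Continuous θ := continuous_iff_continuousAt.2 fun x => (hθ x).continuousAt
  have hL' : 0 < √L := Real.sqrt_pos.2 hL
  have hpos : ∀ x, 0 < q x ^ 2 + L := fun x => by positivity
  have hM0 : 0 ≤ M := (abs_nonneg _).trans (hM a)
  -- The usual multiplier $\theta/q$ of the integration by parts is singular at stationary points.
  -- Its regularisation $\theta q/(q^2+L)$ removes any need to isolate them.
  set r : ℝ → ℝ := fun x => θ x * (q x / (q x ^ 2 + L)) with hr
  set r' : ℝ → ℝ := fun x => θ' x * (q x / (q x ^ 2 + L)) +
    θ x * (q' x * (L - q x ^ 2) / (q x ^ 2 + L) ^ 2) with hr'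
  have hrd : ∀ x, HasDerivAt r (r' x) x := fun x => by
    refine ((hθ x).mul ((hq x).div (((hq x).pow 2).add_const L) (hpos x).ne')).congr_deriv ?_
    simp only [hr', Pi.pow_apply, Pi.div_apply]
    push_cast
    ring
  have hr'c : Continuous r' := by
    refine (hθ'.mul (hqc.div (by fun_prop) fun x => (hpos x).ne')).add
      (hθc.mul (Continuous.div (by fun_prop) (by fun_prop) fun x => (pow_pos (hpos x) 2).ne'))
  set e : ℝ → ℂ := fun x => Complex.exp (Complex.I * (Φ x : ℂ)) with he
  have hec : Continuous e := by fun_prop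
  have hen : ∀ x, ‖e x‖ = 1 := fun x => by simp [he, Complex.norm_exp]
  have hed : ∀ x, HasDerivAt e (Complex.I * (q x : ℂ) * e x) x := fun x =>
    (((hΦ x).ofReal_comp.const_mul Complex.I).cexp).congr_deriv (by simp only [he]; ring)
  have hrc : Continuous r := continuous_iff_continuousAt.2 fun x => (hrd x).continuousAt
  have hzero : ∫ x in a..b, ((r' x : ℂ) * e x + (r x : ℂ) * (Complex.I * (q x : ℂ) * e x)) = 0 := by
    rw [intervalIntegral.integral_eq_sub_of_hasDerivAt
      (fun x _ => (hrd x).ofReal_comp.mul (hed x)) (Continuous.intervalIntegrable (by fun_prop) _ _)]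
    simp [hr, hθa, hθb]
  -- Adding $i$ times the vanishing integral of $(re)'$ replaces $\theta$ by $\theta-rq+ir'$, and
  -- $\theta-rq=\theta L/(q^2+L)$.
  have hsplit : ∫ x in a..b, (θ x : ℂ) * e x =
      ∫ x in a..b, (((θ x * (L / (q x ^ 2 + L)) : ℝ) : ℂ) + Complex.I * (r' x : ℂ)) * e x := by
    rw [← add_zero (∫ x in a..b, (θ x : ℂ) * e x), ← mul_zero Complex.I, ← hzero,
      ← intervalIntegral.integral_const_mul, ← intervalIntegral.integral_add
        (Continuous.intervalIntegrable (by fun_prop) _ _)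
        (Continuous.intervalIntegrable (by fun_prop) _ _)]
    refine intervalIntegral.integral_congr fun x _ => ?_
    have h1 : θ x * (L / (q x ^ 2 + L)) = θ x - r x * q x := by
      have := (hpos x).ne'
      simp only [hr]
      field_simp
      ring
    simp only [h1]
    push_cast
    linear_combination ((r x : ℂ) * q x * e x) * Complex.I_mul_I
  rw [hsplit]
  -- Since $L\le sq'$, the term $\theta L/(q^2+L)$ and the part of $r'$ where $q/(q^2+L)$ is
  -- differentiated are each at most $M\,sq'/(q^2+L)$, whose integral is controlled by $\arctan$.
  have hbd : ∀ x ∈ Icc a b, ‖(((θ x * (L / (q x ^ 2 + L)) : ℝ) : ℂ) +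
      Complex.I * (r' x : ℂ)) * e x‖ ≤ |θ' x| * (1 / √L) + 2 * M * (s * q' x / (q x ^ 2 + L)) := by
    intro x hx
    rw [norm_mul, hen, mul_one]
    have hsx := hsq x hx
    have habs : |q' x| = s * q' x := by
      rw [← abs_of_pos (hL.trans_le hsx), abs_mul, hs, one_mul]
    have h1 : |θ x * (L / (q x ^ 2 + L))| ≤ M * (s * q' x / (q x ^ 2 + L)) := by
      rw [abs_mul]
      refine mul_le_mul (hM x) ?_ (abs_nonneg _) hM0
      rw [abs_of_pos (div_pos hL (hpos x))]
      exact div_le_div_of_nonneg_right hsx (hpos x).le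
    have h2 : |θ x * (q' x * (L - q x ^ 2) / (q x ^ 2 + L) ^ 2)| ≤
        M * (s * q' x / (q x ^ 2 + L)) := by
      rw [abs_mul]
      refine mul_le_mul (hM x) ?_ (abs_nonneg _) hM0
      rw [abs_div, abs_mul, habs, abs_of_pos (pow_pos (hpos x) 2),
        div_le_div_iff₀ (pow_pos (hpos x) 2) (hpos x), pow_two (q x ^ 2 + L), ← mul_assoc]
      refine mul_le_mul_of_nonneg_right (mul_le_mul_of_nonneg_left ?_ (hL.le.trans hsx)) (hpos x).le
      rw [abs_le]
      constructor <;> nlinarith [sq_nonneg (q x)]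
    have h3 : |θ' x * (q x / (q x ^ 2 + L))| ≤ |θ' x| * (1 / √L) := by
      rw [abs_mul]
      exact mul_le_mul_of_nonneg_left (abs_div_sq_add_le hL _) (abs_nonneg _)
    refine (norm_add_le _ _).trans ?_
    rw [norm_mul, Complex.norm_I, one_mul, Complex.norm_real, Complex.norm_real,
      Real.norm_eq_abs, Real.norm_eq_abs]
    have h4 := abs_add_le (θ' x * (q x / (q x ^ 2 + L)))
      (θ x * (q' x * (L - q x ^ 2) / (q x ^ 2 + L) ^ 2))
    simp only [hr']
    linarith
  have hqi : IntervalIntegrable (fun x => s * q' x / (q x ^ 2 + L)) volume a b :=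
    Continuous.intervalIntegrable ((continuous_const.mul hq').div (by fun_prop)
      fun x => (hpos x).ne') a b
  have hθi : IntervalIntegrable (fun x => |θ' x| * (1 / √L)) volume a b :=
    Continuous.intervalIntegrable (by fun_prop) a b
  refine (intervalIntegral.norm_integral_le_of_norm_le hab
    (Filter.Eventually.of_forall fun x hx => hbd x (Ioc_subset_Icc_self hx))
    (hθi.add (hqi.const_mul _))).trans ?_
  rw [intervalIntegral.integral_add hθi (hqi.const_mul _), intervalIntegral.integral_mul_const,
    intervalIntegral.integral_const_mul, add_div, mul_one_div, mul_div_assoc (2 * M)]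
  exact add_le_add le_rfl (mul_le_mul_of_nonneg_left
    (integral_deriv_div_sq_add_le hL hs hq hq') (by positivity))

/-- The bump is placed inside the interval where $|\varphi''|\ge\rho$. The second derivative of the
phase is then at least $2\pi\rho l$ in modulus for every $\xi$, as the term $x\xi$ is linear, and
van der Corput gives a bound independent of $\xi$. -/
theorem exists_bump_norm_integral_le {φ : ℝ ≃ ℝ} (hφ : IsNonlinearDiffeo φ) :
    ∃ θ : ℝ → ℝ, ContDiff ℝ ∞ θ ∧ HasCompactSupport θ ∧ (∀ x, 0 ≤ θ x) ∧
      tsupport θ ⊆ Ioo 0 1 ∧ (∃ x, θ x ≠ 0) ∧ ∃ C : ℝ, 0 ≤ C ∧ ∀ l ξ : ℝ, 0 < l →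
        ‖∫ x, (θ x : ℂ) * Complex.exp (2 * Real.pi * Complex.I * ((l * φ x - x * ξ : ℝ) : ℂ))‖ ≤
          C / √l := by
  obtain ⟨a₀, b₀, ρ, ha₀, hab₀, hb₀, hρ, hbound⟩ := hφ.nonlinear
  obtain ⟨a, ha, c₀⟩ := exists_between hab₀
  obtain ⟨b, hab, hb⟩ := exists_between c₀
  have hsub : Icc a b ⊆ Ioo a₀ b₀ := fun x hx => ⟨ha.trans_le hx.1, hx.2.trans_lt hb⟩
  have hc : (a + b) / 2 ∈ Ioo a b := ⟨by linarith, by linarith⟩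
  obtain ⟨θ, hθs, hθc, hθ, hθr, hθ1⟩ :=
    exists_contDiff_tsupport_subset (n := (⊤ : ℕ∞)) (isOpen_Ioo.mem_nhds hc)
  have hθ0 : ∀ x, 0 ≤ θ x := fun x => (hθr ⟨x, rfl⟩).1
  have hθle : ∀ x, |θ x| ≤ 1 := fun x => by
    rw [abs_of_nonneg (hθ0 x)]; exact (hθr ⟨x, rfl⟩).2
  have hout : ∀ x, x ∉ Ioo a b → θ x = 0 := fun x hx =>
    image_eq_zero_of_notMem_tsupport fun h => hx (hθs h)
  have hφd : ∀ x, HasDerivAt φ (deriv φ x) x := fun x =>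
    (hφ.smooth.differentiable (by simp) x).hasDerivAt
  have hφ1 : ContDiff ℝ ∞ (deriv φ) := (contDiff_infty_iff_deriv.1 hφ.smooth).2
  have hφd2 : ∀ x, HasDerivAt (deriv φ) (deriv (deriv φ) x) x := fun x =>
    (hφ1.differentiable (by simp) x).hasDerivAt
  have hφ2 : Continuous (deriv (deriv φ)) := (contDiff_infty_iff_deriv.1 hφ1).2.continuous
  have hbound' : ∀ t ∈ Icc a b, ρ ≤ |deriv (deriv φ) t| := fun t ht => by
    have := hbound t (hsub ht)
    rwa [iteratedDeriv_succ, iteratedDeriv_one] at this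
  -- A continuous second derivative bounded away from zero has constant sign on the interval, by the
  -- intermediate value theorem.
  obtain ⟨s, hs, hsq⟩ : ∃ s : ℝ, |s| = 1 ∧ ∀ t ∈ Icc a b, ρ ≤ s * deriv (deriv φ) t := by
    have hpre : IsPreconnected (Icc a b) := isPreconnected_Icc
    by_cases hex : ∃ t ∈ Icc a b, 0 ≤ deriv (deriv φ) t
    · obtain ⟨t, ht, ht0⟩ := hex
      refine ⟨1, by simp, fun u hu => ?_⟩
      by_contra! hlt
      have hu' := hbound' u hu
      have : deriv (deriv φ) u ≤ 0 := by
        by_contra! h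
        rw [abs_of_pos h] at hu'
        linarith
      obtain ⟨w, hw, hw0⟩ := hpre.intermediate_value hu ht hφ2.continuousOn ⟨this, ht0⟩
      have := hbound' w hw
      rw [hw0, abs_zero] at this
      linarith
    · push Not at hex
      refine ⟨-1, by simp, fun u hu => ?_⟩
      have := hbound' u hu
      rw [abs_of_neg (hex u hu)] at this
      linarith
  have hθd : ∀ x, HasDerivAt θ (deriv θ x) x := fun x =>
    (hθ.differentiable (by simp) x).hasDerivAt
  have hθ' : Continuous (deriv θ) := (contDiff_infty_iff_deriv.1 hθ).2.continuous
  have hI0 : 0 ≤ ∫ x in a..b, |deriv θ x| :=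
    intervalIntegral.integral_nonneg hab.le fun x _ => abs_nonneg _
  refine ⟨θ, hθ, hθc, hθ0, fun x hx => ?_, ⟨_, by rw [hθ1]; exact one_ne_zero⟩,
    ((∫ x in a..b, |deriv θ x|) + 2 * 1 * Real.pi) / √(2 * Real.pi * ρ), by positivity,
    fun l ξ hl => ?_⟩
  · have := hsub (Ioo_subset_Icc_self (hθs hx))
    exact ⟨ha₀.trans_lt this.1, this.2.trans_le hb₀⟩
  · have key := norm_integral_mul_cexp_le (a := a) (b := b) (L := 2 * Real.pi * ρ * l) (M := 1)
      (s := s) hab.le (by positivity) hs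
      (Φ := fun x => 2 * Real.pi * (l * φ x - x * ξ))
      (q := fun x => 2 * Real.pi * (l * deriv φ x - 1 * ξ))
      (q' := fun x => 2 * Real.pi * (l * deriv (deriv φ) x)) (θ := θ) (θ' := deriv θ)
      (fun x => (((hφd x).const_mul l).sub ((hasDerivAt_id x).mul_const ξ)).const_mul _)
      (fun x => (((hφd2 x).const_mul l).sub_const _).const_mul _) (by fun_prop)
      (fun x hx => by
        have := mul_le_mul_of_nonneg_left (hsq x hx) (by positivity : 0 ≤ 2 * Real.pi * l)
        linarith) hθd hθ' (hout a (by simp)) (hout b (by simp)) hθle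
    rw [Real.sqrt_mul (by positivity), ← div_div] at key
    refine le_trans (le_of_eq ?_) key
    rw [intervalIntegral.integral_eq_integral_of_support_subset]
    · congr 1
      refine integral_congr_ae (Filter.Eventually.of_forall fun x => ?_)
      simp only
      congr 2
      push_cast
      ring
    · intro x hx
      by_contra hx'
      refine hx ?_
      simp only [hout x fun h => hx' (Ioo_subset_Ioc_self h), Complex.ofReal_zero, zero_mul]

/-- The plane wave of frequency `(l, …, l)`. -/
def wave (l : ℝ) (y : E d) : ℂ :=
  Complex.exp (2 * Real.pi * Complex.I * ((l * ∑ i, y i : ℝ) : ℂ))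

theorem norm_wave (l : ℝ) (y : E d) : ‖wave l y‖ = 1 := norm_exp_two_pi_I_mul _

theorem conj_wave_mul (l : ℝ) (y : E d) : (starRingEnd ℂ) (wave l y) * wave l y = 1 := by
  rw [← Complex.normSq_eq_conj_mul_self, Complex.normSq_eq_norm_sq, norm_wave]; simp

theorem contDiff_wave (l : ℝ) : ContDiff ℝ ∞ (wave (d := d) l) := by
  have h : ∀ i : Fin d, ContDiff ℝ ∞ fun y : E d => y i := contDiff_coord
  have : ContDiff ℝ ∞ fun y : E d => ((l * ∑ i, y i : ℝ) : ℂ) :=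
    Complex.ofRealCLM.contDiff.comp (contDiff_const.mul (ContDiff.sum fun i _ => h i))
  exact (contDiff_const.mul this).cexp

/-- The tensor power of a function of one real variable. -/
def tensorPow (θ : ℝ → ℝ) (x : E d) : ℝ := ∏ i, θ (x i)

theorem contDiff_tensorPow {θ : ℝ → ℝ} (hθ : ContDiff ℝ ∞ θ) :
    ContDiff ℝ ∞ (tensorPow (d := d) θ) :=
  contDiff_prod fun i _ => hθ.comp (contDiff_coord i)

theorem isCompact_setOf_coord_mem {K : Set ℝ} (hK : IsCompact K) :
    IsCompact {x : E d | ∀ i, x i ∈ K} := by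
  have h := (EuclideanSpace.equiv (Fin d) ℝ).toHomeomorph.isCompact_preimage.2
    (isCompact_univ_pi fun _ : Fin d => hK)
  refine h.of_isClosed_subset ?_ fun x hx => ?_
  · simp only [Set.ofPred_forall]
    exact isClosed_iInter fun i => hK.isClosed.preimage (contDiff_coord i).continuous
  · exact fun i _ => hx i

theorem tensorPow_eq_zero {θ : ℝ → ℝ} {x : E d} (hx : ∃ i, x i ∉ tsupport θ) :
    tensorPow θ x = 0 := by
  obtain ⟨i, hi⟩ := hx
  exact Finset.prod_eq_zero (Finset.mem_univ i) (image_eq_zero_of_notMem_tsupport hi)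

theorem hasCompactSupport_tensorPow {θ : ℝ → ℝ} (hθ : HasCompactSupport θ) :
    HasCompactSupport (tensorPow (d := d) θ) :=
  HasCompactSupport.intro (isCompact_setOf_coord_mem hθ) fun x hx =>
    tensorPow_eq_zero (by simpa using hx)

theorem contDiff_mul_wave_prodMap {G : E d → ℝ} (hG : ContDiff ℝ ∞ G) {φ : ℝ → ℝ}
    (hφ : ContDiff ℝ ∞ φ) (l : ℝ) :
    ContDiff ℝ ∞ fun x => (G x : ℂ) * wave l (prodMap φ x) :=
  (Complex.ofRealCLM.contDiff.comp hG).mul ((contDiff_wave l).comp (contDiff_prodMap hφ))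

theorem hasCompactSupport_ofReal_mul {G : E d → ℝ} (hG : HasCompactSupport G) (w : E d → ℂ) :
    HasCompactSupport fun x => (G x : ℂ) * w x :=
  (hG.comp_left (g := Complex.ofReal) Complex.ofReal_zero).mul_right

/-- The Schwartz function `x ↦ G(x) exp (2 π i l ∑ φ(x_i))`. -/
def chirp {G : E d → ℝ} (hG : ContDiff ℝ ∞ G) (hGc : HasCompactSupport G) {φ : ℝ → ℝ}
    (hφ : ContDiff ℝ ∞ φ) (l : ℝ) : 𝓢(E d, ℂ) :=
  (hasCompactSupport_ofReal_mul hGc _).toSchwartzMap (contDiff_mul_wave_prodMap hG hφ l)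

theorem chirp_apply {G : E d → ℝ} (hG : ContDiff ℝ ∞ G) (hGc : HasCompactSupport G) {φ : ℝ → ℝ}
    (hφ : ContDiff ℝ ∞ φ) (l : ℝ) (x : E d) :
    chirp hG hGc hφ l x = (G x : ℂ) * wave l (prodMap φ x) := rfl

theorem tsupport_chirp_subset {G : E d → ℝ} (hG : ContDiff ℝ ∞ G) (hGc : HasCompactSupport G)
    {φ : ℝ → ℝ} (hφ : ContDiff ℝ ∞ φ) (l : ℝ) : tsupport (chirp hG hGc hφ l) ⊆ tsupport G :=
  closure_mono fun x hx => by
    by_contra h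
    refine hx ?_
    rw [chirp_apply, Function.notMem_support.1 h, Complex.ofReal_zero, zero_mul]

theorem norm_chirp {G : E d → ℝ} (hG : ContDiff ℝ ∞ G) (hGc : HasCompactSupport G) {φ : ℝ → ℝ}
    (hφ : ContDiff ℝ ∞ φ) (l : ℝ) (x : E d) : ‖chirp hG hGc hφ l x‖ = |G x| := by
  rw [chirp_apply, norm_mul, norm_wave, mul_one, Complex.norm_real, Real.norm_eq_abs]

/-- Amplitude and phase both split over the coordinates, so Fubini reduces the transform to
one-dimensional integrals. -/
theorem fourier_chirp_tensorPow {θ : ℝ → ℝ} (hθ : ContDiff ℝ ∞ θ) (hθc : HasCompactSupport θ)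
    {φ : ℝ → ℝ} (hφ : ContDiff ℝ ∞ φ) (l : ℝ) (ξ : E d) :
    (𝓕 (chirp (contDiff_tensorPow hθ) (hasCompactSupport_tensorPow hθc) hφ l)) ξ =
      ∏ i, ∫ t, (θ t : ℂ) *
        Complex.exp (2 * Real.pi * Complex.I * ((l * φ t - t * ξ i : ℝ) : ℂ)) := by
  rw [SchwartzMap.fourier_coe, Real.fourier_eq', ← integral_fintype_prod_volume_eq_prod
    (f := fun i t => (θ t : ℂ) *
        Complex.exp (2 * Real.pi * Complex.I * ((l * φ t - t * ξ i : ℝ) : ℂ))),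
    ← (PiLp.volume_preserving_ofLp (Fin d)).integral_comp
      (MeasurableEquiv.toLp 2 (Fin d → ℝ)).symm.measurableEmbedding]
  refine integral_congr_ae (Filter.Eventually.of_forall fun x => ?_)
  simp only [chirp_apply, tensorPow, wave, prodMap_apply, smul_eq_mul, Finset.prod_mul_distrib,
    Complex.ofReal_prod]
  rw [mul_left_comm, ← Complex.exp_add, ← Complex.exp_sum]
  congr 2
  rw [PiLp.inner_apply]
  simp only [Complex.ofReal_sum, Complex.ofReal_mul, Finset.mul_sum]
  rw [Finset.sum_mul, ← Finset.sum_add_distrib]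
  refine Finset.sum_congr rfl fun i _ => ?_
  simp
  ring

theorem exists_bump_norm_fourier_chirp_le {φ : ℝ ≃ ℝ} (hφ : IsNonlinearDiffeo φ) :
    ∃ (θ : ℝ → ℝ) (hθ : ContDiff ℝ ∞ θ) (hθc : HasCompactSupport θ), (∀ x, 0 ≤ θ x) ∧
      tsupport θ ⊆ Ioo 0 1 ∧ (∃ x, θ x ≠ 0) ∧ ∃ C : ℝ, 0 ≤ C ∧ ∀ (l : ℝ) (ξ : E d), 0 < l →
        ‖(𝓕 (chirp (contDiff_tensorPow hθ) (hasCompactSupport_tensorPow hθc) hφ.smooth l)) ξ‖ ≤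
          C * l ^ (-(d : ℝ) / 2) := by
  obtain ⟨θ, hθ, hθc, h0, hs, hne, C, hC, hle⟩ := exists_bump_norm_integral_le hφ
  refine ⟨θ, hθ, hθc, h0, hs, hne, C ^ d, by positivity, fun l ξ hl => ?_⟩
  rw [fourier_chirp_tensorPow hθ hθc, norm_prod]
  refine (Finset.prod_le_prod (fun i _ => norm_nonneg _) fun i _ => hle l (ξ i) hl).trans
    (le_of_eq ?_)
  rw [Finset.prod_const, Finset.card_univ, Fintype.card_fin, div_pow, Real.sqrt_eq_rpow,
    ← Real.rpow_natCast, ← Real.rpow_natCast (l ^ _), ← Real.rpow_mul hl.le, div_eq_mul_inv,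
    ← Real.rpow_neg hl.le]
  congr 2
  ring

end Chirp

/-! ### Fourier–Lebesgue norms of Schwartz functions -/

section FourierLebesgue

variable {d : ℕ}

/-- Interpolation between `L^r` and a uniform bound. -/
theorem eLpNorm_le_of_enorm_le {α : Type*} [MeasurableSpace α] {μ : Measure α} {f : α → ℂ}
    {B : ℝ≥0} (hB : ∀ x, ‖f x‖ₑ ≤ B) {r : ℝ} (hr : 0 < r) {q : ℝ≥0∞}
    (hrq : ENNReal.ofReal r ≤ q) :
    eLpNorm f q μ ≤ (B : ℝ≥0∞) ^ (1 - r * (q⁻¹).toReal) *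
      eLpNorm f (ENNReal.ofReal r) μ ^ (r * (q⁻¹).toReal) := by
  by_cases hq : q = ⊤
  · subst hq
    simp only [ENNReal.inv_top, ENNReal.toReal_zero, mul_zero, sub_zero, ENNReal.rpow_one,
      ENNReal.rpow_zero, mul_one]
    exact eLpNormEssSup_le_of_ae_enorm_bound (Filter.Eventually.of_forall hB)
  have hq0 : q ≠ 0 := (lt_of_lt_of_le (ENNReal.ofReal_pos.2 hr) hrq).ne'
  have hqt : 0 < q.toReal := ENNReal.toReal_pos hq0 hq
  have hrt : r ≤ q.toReal := (ENNReal.ofReal_le_iff_le_toReal hq).1 hrq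
  have hr0 : ENNReal.ofReal r ≠ 0 := (ENNReal.ofReal_pos.2 hr).ne'
  rw [eLpNorm_eq_lintegral_rpow_enorm_toReal hq0 hq,
    eLpNorm_eq_lintegral_rpow_enorm_toReal hr0 ENNReal.ofReal_ne_top, ENNReal.toReal_inv,
    ENNReal.toReal_ofReal hr.le, ← ENNReal.rpow_mul]
  have hle : ∫⁻ x, ‖f x‖ₑ ^ q.toReal ∂μ ≤
      (B : ℝ≥0∞) ^ (q.toReal - r) * ∫⁻ x, ‖f x‖ₑ ^ r ∂μ := by
    rw [← lintegral_const_mul' _ _ (ENNReal.rpow_ne_top_of_nonneg (by linarith)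
      ENNReal.coe_ne_top)]
    refine lintegral_mono fun x => ?_
    calc ‖f x‖ₑ ^ q.toReal = ‖f x‖ₑ ^ (q.toReal - r) * ‖f x‖ₑ ^ r := by
          rw [← ENNReal.rpow_add_of_nonneg _ _ (by linarith) hr.le]; congr 1; ring
      _ ≤ _ := by gcongr; exact hB x
  refine (ENNReal.rpow_le_rpow hle (by positivity)).trans (le_of_eq ?_)
  rw [ENNReal.mul_rpow_of_nonneg _ _ (by positivity), ← ENNReal.rpow_mul]
  congr 2
  · field_simp
  · field_simp

theorem enorm_integral_conj_mul_le {α : Type*} [MeasurableSpace α] {μ : Measure α} {u v : α → ℂ}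
    (hu : AEStronglyMeasurable u μ) (hv : AEStronglyMeasurable v μ) {p q : ℝ≥0∞}
    [ENNReal.HolderConjugate p q] :
    ‖∫ x, (starRingEnd ℂ) (v x) * u x ∂μ‖ₑ ≤ eLpNorm u p μ * eLpNorm v q μ := by
  refine (enorm_integral_le_lintegral_enorm _).trans ?_
  have h := eLpNorm_smul_le_mul_eLpNorm (μ := μ) (p := p) (q := q) (r := 1) hv hu
  rw [eLpNorm_one_eq_lintegral_enorm] at h
  refine le_trans (le_of_eq (lintegral_congr fun x => ?_)) h
  rw [enorm_mul, Pi.smul_apply', smul_eq_mul, enorm_mul, mul_comm]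
  congr 1
  simp [enorm_eq_nnnorm]

/-- The properties shared by the norms of `𝓕L^p` and of `M^p` on Schwartz functions: duality,
invariance under modulations, and interpolation. -/
structure IsDualScale (N : ℝ≥0∞ → 𝓢(E d, ℂ) → ℝ≥0∞) : Prop where
  lt_top : ∀ q : ℝ≥0∞, 1 ≤ q → ∀ f, N q f < ⊤
  pairing : ∀ (p q : ℝ≥0∞) [ENNReal.HolderConjugate p q], ∃ A : ℝ≥0, ∀ w k : 𝓢(E d, ℂ),
    ‖∫ x, (starRingEnd ℂ) (k x) * w x‖ₑ ≤ A * (N p w * N q k)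
  modulation : ∀ (q : ℝ≥0∞) (l : ℝ) (f h : 𝓢(E d, ℂ)), (∀ x, h x = f x * wave l x) →
    N q h = N q f
  interpolation : ∀ q : ℝ≥0∞, 2 ≤ q → ∃ A : ℝ≥0, ∀ (k : 𝓢(E d, ℂ)) (B : ℝ≥0),
    (∀ ξ, ‖(𝓕 k) ξ‖ₑ ≤ B) → N q k ≤ A * ((B : ℝ≥0∞) ^ (1 - 2 * (q⁻¹).toReal) *
      eLpNorm k 2 volume ^ (2 * (q⁻¹).toReal))

theorem eLpNorm_fourier_two (k : 𝓢(E d, ℂ)) :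
    eLpNorm (𝓕 k : 𝓢(E d, ℂ)) 2 volume = eLpNorm k 2 volume := by
  have h := SchwartzMap.norm_fourier_toL2_eq k
  rw [SchwartzMap.norm_toLp, SchwartzMap.norm_toLp] at h
  exact (ENNReal.toReal_eq_toReal_iff' ((𝓕 k).memLp 2 volume).2.ne (k.memLp 2 volume).2.ne).1 h

/-- The vector `(l, …, l)`. -/
def diag (l : ℝ) : E d := WithLp.toLp 2 fun _ => l

theorem inner_diag (l : ℝ) (y : E d) : inner ℝ y (diag l) = l * ∑ i, y i := by
  simp [PiLp.inner_apply, diag, Finset.mul_sum]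

theorem wave_eq (l : ℝ) (y : E d) :
    wave l y = Complex.exp (2 * Real.pi * Complex.I * ((inner ℝ y (diag l) : ℝ) : ℂ)) := by
  rw [inner_diag, wave]

theorem fourier_mul_wave {f h : 𝓢(E d, ℂ)} {l : ℝ} (hh : ∀ x, h x = f x * wave l x) (ξ : E d) :
    (𝓕 h) ξ = (𝓕 f) (ξ - diag l) := by
  simp only [SchwartzMap.fourier_coe, Real.fourier_eq']
  refine integral_congr_ae (Filter.Eventually.of_forall fun x => ?_)
  simp only [hh, wave_eq, smul_eq_mul]
  rw [mul_left_comm, ← Complex.exp_add, mul_comm]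
  congr 2
  rw [inner_sub_right]
  push_cast
  ring

/-- Duality is Parseval and Hölder, modulation translates the Fourier transform, and interpolation
runs between the sup bound on $\hat k$ and Plancherel. -/
theorem isDualScale_eLpNorm_fourier :
    IsDualScale fun (q : ℝ≥0∞) (f : 𝓢(E d, ℂ)) => eLpNorm (𝓕 f : 𝓢(E d, ℂ)) q volume where
  lt_top q _ f := ((𝓕 f).memLp q volume).2
  pairing p q _ := ⟨1, fun w k => by
    have h := SchwartzMap.integral_inner_fourier_fourier k w
    simp only [RCLike.inner_apply] at h
    simp only [mul_comm ((starRingEnd ℂ) _)]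
    rw [← h]
    simp only [mul_comm _ ((starRingEnd ℂ) _), ENNReal.coe_one, one_mul]
    exact enorm_integral_conj_mul_le (𝓕 w).continuous.aestronglyMeasurable
      (𝓕 k).continuous.aestronglyMeasurable⟩
  modulation q l f h hh := by
    have : ((𝓕 h : 𝓢(E d, ℂ)) : E d → ℂ) = (𝓕 f : 𝓢(E d, ℂ)) ∘ fun ξ => ξ - diag l :=
      funext fun ξ => fourier_mul_wave hh ξ
    rw [this]
    exact eLpNorm_comp_measurePreserving (𝓕 f).continuous.aestronglyMeasurable
      (measurePreserving_sub_right volume (diag l))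
  interpolation q hq := ⟨1, fun k B hB => by
    have := eLpNorm_le_of_enorm_le (μ := volume) hB two_pos (q := q) (by simpa using hq)
    rw [ENNReal.coe_one, one_mul, ← eLpNorm_fourier_two]
    simpa using this⟩

/-- The infimum is over a single element, since functions in $L^p$ embed injectively into tempered
distributions. -/
theorem flNorm_coe (p : ℝ≥0∞) [Fact (1 ≤ p)] (w : 𝓢(E d, ℂ)) :
    flNorm p (w : 𝓢'(E d, ℂ)) = eLpNorm (𝓕 w : 𝓢(E d, ℂ)) p volume := by
  have hcoe : (((𝓕 w).toLp p volume : Lp ℂ p (volume : Measure (E d))) : 𝓢'(E d, ℂ)) =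
      𝓕 (w : 𝓢'(E d, ℂ)) := by
    rw [Lp.toTemperedDistribution_toLp_eq, TemperedDistribution.fourier_toTemperedDistributionCLM_eq]
  have hn : ‖(𝓕 w).toLp p volume‖ₑ = eLpNorm (𝓕 w : 𝓢(E d, ℂ)) p volume := by
    rw [SchwartzMap.toLp, Lp.enorm_toLp]
  unfold flNorm
  refine le_antisymm (iInf_le_of_le ((𝓕 w).toLp p volume) ?_) (le_iInf₂ fun h hh => ?_)
  · rw [iInf_pos hcoe]
    exact hn.le
  rw [← hn]
  have hinj : Function.Injective (Lp.toTemperedDistributionCLM ℂ (volume : Measure (E d)) p) :=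
    LinearMap.ker_eq_bot.1 Lp.ker_toTemperedDistributionCLM_eq_bot
  have : h = (𝓕 w).toLp p volume := hinj (by
    simp only [Lp.toTemperedDistributionCLM_apply]; rw [hh, hcoe])
  rw [this]

theorem coe_schwartz_apply (f θ : 𝓢(E d, ℂ)) : (f : 𝓢'(E d, ℂ)) θ = ∫ x, θ x * f x :=
  SchwartzMap.coe_apply f θ

theorem dsupport_coe_subset (f : 𝓢(E d, ℂ)) : dsupport (f : 𝓢'(E d, ℂ)) ⊆ tsupport f := by
  intro x hx
  by_contra hcon
  refine (notMem_dsupport_iff (f := (f : 𝓢'(E d, ℂ))) x).2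
    ⟨(tsupport f)ᶜ, fun θ hθ => ?_, (isClosed_tsupport f).isOpen_compl, hcon⟩ hx
  rw [coe_schwartz_apply]
  refine integral_eq_zero_of_ae (Filter.Eventually.of_forall fun y => ?_)
  by_cases hy : y ∈ tsupport f
  · have : θ y = 0 := image_eq_zero_of_notMem_tsupport fun h => hθ h hy
    simp [this]
  · simp [image_eq_zero_of_notMem_tsupport hy]

theorem coe_mem_FLDomain (p : ℝ≥0∞) [Fact (1 ≤ p)] {f : 𝓢(E d, ℂ)} (hf : HasCompactSupport f) :
    (f : 𝓢'(E d, ℂ)) ∈ FLDomain d p := by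
  have h1 : (f : 𝓢'(E d, ℂ)) ∈ FLComp d p := by
    refine ⟨⟨(𝓕 f).toLp p volume, ?_⟩,
      hf.isCompact.of_isClosed_subset isClosed_dsupport (dsupport_coe_subset f)⟩
    rw [Lp.toTemperedDistribution_toLp_eq, TemperedDistribution.fourier_toTemperedDistributionCLM_eq]
  unfold FLDomain
  split_ifs
  · refine ⟨h1, tsupport f, hf.isCompact, fun ε hε => ⟨f, subset_rfl, ?_⟩⟩
    have : flNorm p ((0 : 𝓢(E d, ℂ)) : 𝓢'(E d, ℂ)) = 0 := by
      rw [flNorm_coe]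
      have : ((𝓕 (0 : 𝓢(E d, ℂ)) : 𝓢(E d, ℂ)) : E d → ℂ) = 0 := by
        rw [show 𝓕 (0 : 𝓢(E d, ℂ)) = 0 from map_zero (fourierCLM ℂ 𝓢(E d, ℂ))]; rfl
      rw [this, eLpNorm_zero]
    rw [map_zero] at this
    rw [sub_self, this]
    exact_mod_cast hε
  · exact h1

theorem IsGivenBy.eq_coe {u : 𝓢'(E d, ℂ)} {w : 𝓢(E d, ℂ)} (h : IsGivenBy u w) :
    u = (w : 𝓢'(E d, ℂ)) := by
  ext θ
  rw [h θ, coe_schwartz_apply]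

/-- Only this a priori inequality on test functions is contradicted later. The extension agrees with
`T f`, and the norm of a Schwartz function is explicit. -/
theorem ExtendsToFLComp.exists_bound {p : ℝ≥0∞} [Fact (1 ≤ p)] {T : 𝓢(E d, ℂ) → E d → ℂ}
    (hT : ExtendsToFLComp p T) {K : Set (E d)} (hK : IsCompact K) :
    ∃ C : ℝ≥0, ∀ f w : 𝓢(E d, ℂ), tsupport f ⊆ K → T f = w →
      eLpNorm (𝓕 w : 𝓢(E d, ℂ)) p volume ≤ C * eLpNorm (𝓕 f : 𝓢(E d, ℂ)) p volume := by
  obtain ⟨S, hS, hb⟩ := hT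
  obtain ⟨_, _, C, hC⟩ := hb K hK
  refine ⟨C, fun f w hf hw => ?_⟩
  have hfc : HasCompactSupport f := hK.of_isClosed_subset (isClosed_tsupport f) hf
  have hmem := coe_mem_FLDomain p hfc
  have h1 := hS f hfc hmem
  rw [hw] at h1
  have h2 := (hC ⟨f, hmem⟩ ((dsupport_coe_subset f).trans hf)).2
  rwa [h1.eq_coe, flNorm_coe, flNorm_coe] at h2

end FourierLebesgue

/-! ### Modulation norms of Schwartz functions -/

section Modulation

variable {d : ℕ}

theorem stft_coe (g f : 𝓢(E d, ℂ)) (z : E d × E d) :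
    stft g (f : 𝓢'(E d, ℂ)) z = ∫ y, Complex.exp (-(2 * Real.pi * Complex.I) *
      (inner ℝ y z.2 : ℝ)) * (starRingEnd ℂ) (g (y - z.1)) * f y := by
  rw [stft, coe_schwartz_apply]
  simp only [conjShift_apply]

/-- The product of `f` with the conjugate of the window `g` translated by `x`. -/
def windowed (g : 𝓢(E d, ℂ)) (x : E d) (f : 𝓢(E d, ℂ)) : 𝓢(E d, ℂ) :=
  SchwartzMap.smulLeftCLM ℂ (conjShift g x 0) f

theorem windowed_apply (g : 𝓢(E d, ℂ)) (x : E d) (f : 𝓢(E d, ℂ)) (y : E d) :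
    windowed g x f y = (starRingEnd ℂ) (g (y - x)) * f y := by
  rw [windowed, SchwartzMap.smulLeftCLM_apply_apply (conjShift g x 0).hasTemperateGrowth,
    conjShift_apply]
  simp

theorem stft_eq_fourier (g f : 𝓢(E d, ℂ)) (x η : E d) :
    stft g (f : 𝓢'(E d, ℂ)) (x, η) = (𝓕 (windowed g x f)) η := by
  rw [stft_coe, SchwartzMap.fourier_coe, Real.fourier_eq']
  refine integral_congr_ae (Filter.Eventually.of_forall fun y => ?_)
  simp only [windowed_apply, smul_eq_mul, mul_assoc]
  congr 2
  push_cast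
  ring

theorem coordDeriv_windowed (j : Fin d) (g : 𝓢(E d, ℂ)) (x : E d) (f : 𝓢(E d, ℂ)) :
    coordDeriv j (windowed g x f) = windowed (coordDeriv j g) x f +
      windowed g x (coordDeriv j f) := by
  ext y
  rw [coordDeriv_apply, add_apply, windowed_apply, windowed_apply, coordDeriv_apply,
    coordDeriv_apply]
  have h1 : HasFDerivAt (fun y => (starRingEnd ℂ) (g (y - x)))
      ((Complex.conjCLE : ℂ →L[ℝ] ℂ).comp (fderiv ℝ g (y - x))) y :=
    (Complex.conjCLE : ℂ →L[ℝ] ℂ).hasFDerivAt.comp y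
      ((hasFDerivAt_comp_sub x).2 g.differentiableAt.hasFDerivAt)
  have h2 : HasFDerivAt f (fderiv ℝ f y) y := f.differentiableAt.hasFDerivAt
  have h3 := h1.mul h2
  have : (windowed g x f : E d → ℂ) = (fun y => (starRingEnd ℂ) (g (y - x))) * f :=
    funext fun y => windowed_apply g x f y
  rw [this, h3.fderiv]
  simp
  ring

/-- For fixed $x$ the short-time transform is the Fourier transform of a product, so multiplication
by $2\pi i\eta_j$ is a derivative, shared by the Leibniz rule between window and function. -/
theorem mul_stft (j : Fin d) (g f : 𝓢(E d, ℂ)) (x η : E d) :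
    2 * Real.pi * Complex.I * (η j) * stft g (f : 𝓢'(E d, ℂ)) (x, η) =
      stft (coordDeriv j g) (f : 𝓢'(E d, ℂ)) (x, η) +
        stft g (coordDeriv j f : 𝓢'(E d, ℂ)) (x, η) := by
  simp only [stft_eq_fourier]
  rw [← fourier_coordDeriv, coordDeriv_windowed, FourierTransform.fourier_add, add_apply]

theorem exists_pow_mul_norm_le (f : 𝓢(E d, ℂ)) (N : ℕ) :
    ∃ C : ℝ, 0 ≤ C ∧ ∀ x, (1 + ‖x‖) ^ N * ‖f x‖ ≤ C := by
  have h := SchwartzMap.one_add_le_sup_seminorm_apply (𝕜 := ℝ) (m := (N, 0)) (k := N) (n := 0)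
    le_rfl le_rfl f
  simp only [norm_iteratedFDeriv_zero] at h
  exact ⟨_, le_trans (by positivity) (h 0), h⟩

theorem exists_pow_mul_norm_stft_le_left (M : ℕ) (g f : 𝓢(E d, ℂ)) :
    ∃ C : ℝ, ∀ x η, (1 + ‖x‖) ^ M * ‖stft g (f : 𝓢'(E d, ℂ)) (x, η)‖ ≤ C := by
  obtain ⟨A, hA, hgA⟩ := exists_pow_mul_norm_le g M
  obtain ⟨B, hB, hfB⟩ := exists_pow_mul_norm_le f (M + (d + 1))
  have hInt : Integrable fun y : E d => (1 + ‖y‖) ^ (-((d + 1 : ℕ) : ℝ)) :=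
    integrable_one_add_norm (by simp)
  refine ⟨∫ y : E d, A * B * (1 + ‖y‖) ^ (-((d + 1 : ℕ) : ℝ)), fun x η => ?_⟩
  rw [stft_coe, ← Real.norm_of_nonneg (by positivity : 0 ≤ (1 + ‖x‖) ^ M), ← norm_smul,
    ← integral_smul]
  refine norm_integral_le_of_norm_le (hInt.const_mul _) (Filter.Eventually.of_forall fun y => ?_)
  have hexp : ‖Complex.exp (-(2 * Real.pi * Complex.I) * (inner ℝ y η : ℝ))‖ = 1 := by
    rw [Complex.norm_exp]; simp
  rw [norm_smul, norm_mul, norm_mul, hexp, one_mul, RCLike.norm_conj,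
    Real.norm_of_nonneg (by positivity : 0 ≤ (1 + ‖x‖) ^ M), Real.rpow_neg (by positivity),
    Real.rpow_natCast, ← div_eq_mul_inv, le_div_iff₀ (by positivity)]
  -- This distributes the weight in $x$ between the decay of the window and that of `f`. The
  -- additional $d+1$ powers of $1+|y|$ make the integral converge.
  have hx : 1 + ‖x‖ ≤ (1 + ‖y - x‖) * (1 + ‖y‖) := by
    have : ‖x‖ ≤ ‖y‖ + ‖y - x‖ := by
      simpa using norm_sub_le y (y - x)
    nlinarith [norm_nonneg y, norm_nonneg (y - x)]
  calc (1 + ‖x‖) ^ M * (‖g (y - x)‖ * ‖f y‖) * (1 + ‖y‖) ^ (d + 1)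
      ≤ ((1 + ‖y - x‖) * (1 + ‖y‖)) ^ M * (‖g (y - x)‖ * ‖f y‖) * (1 + ‖y‖) ^ (d + 1) := by gcongr
    _ = ((1 + ‖y - x‖) ^ M * ‖g (y - x)‖) * ((1 + ‖y‖) ^ (M + (d + 1)) * ‖f y‖) := by
        rw [mul_pow, pow_add]; ring
    _ ≤ A * B := mul_le_mul (hgA _) (hfB _) (by positivity) hA

/-- Each factor $|\eta_j|$ is exchanged through `mul_stft` for a derivative of `g` or of `f`, which
is why the induction generalises over both. The constant $2\pi$ may be dropped, being at least $1$.
-/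
theorem exists_pow_mul_pow_mul_norm_stft_le (M N : ℕ) (g f : 𝓢(E d, ℂ)) :
    ∃ C : ℝ, ∀ x η, (1 + ‖x‖) ^ M * ((1 + ∑ j, |η j|) ^ N * ‖stft g (f : 𝓢'(E d, ℂ)) (x, η)‖) ≤ C := by
  induction N generalizing g f with
  | zero =>
    obtain ⟨C, hC⟩ := exists_pow_mul_norm_stft_le_left M g f
    exact ⟨C, fun x η => by simpa using hC x η⟩
  | succ N ih =>
    obtain ⟨C, hC⟩ := ih g f
    choose A hA using fun j => ih (coordDeriv j g) f
    choose B hB using fun j => ih g (coordDeriv j f)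
    refine ⟨C + ∑ j, (A j + B j), fun x η => ?_⟩
    set V := ‖stft g (f : 𝓢'(E d, ℂ)) (x, η)‖ with hV
    have hj : ∀ j, |η j| * V ≤ ‖stft (coordDeriv j g) (f : 𝓢'(E d, ℂ)) (x, η)‖ +
        ‖stft g (coordDeriv j f : 𝓢'(E d, ℂ)) (x, η)‖ := fun j => by
      refine le_trans ?_ (norm_add_le _ _)
      rw [← mul_stft, norm_mul, norm_mul, ← hV, Complex.norm_real, Real.norm_eq_abs]
      have : ‖(2 * Real.pi * Complex.I : ℂ)‖ = 2 * Real.pi := by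
        simp [abs_of_pos Real.pi_pos]
      rw [this, mul_assoc]
      refine le_mul_of_one_le_left (by positivity) ?_
      linarith [Real.pi_gt_three]
    have hsum : (1 + ∑ j, |η j|) * V ≤ V + ∑ j, (‖stft (coordDeriv j g) (f : 𝓢'(E d, ℂ)) (x, η)‖ +
        ‖stft g (coordDeriv j f : 𝓢'(E d, ℂ)) (x, η)‖) := by
      rw [add_mul, one_mul, Finset.sum_mul]
      exact add_le_add le_rfl (Finset.sum_le_sum fun j _ => hj j)
    have hS : 0 ≤ ∑ j, |η j| := Finset.sum_nonneg fun j _ => abs_nonneg _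
    calc (1 + ‖x‖) ^ M * ((1 + ∑ j, |η j|) ^ (N + 1) * V)
        = (1 + ‖x‖) ^ M * (1 + ∑ j, |η j|) ^ N * ((1 + ∑ j, |η j|) * V) := by ring
      _ ≤ (1 + ‖x‖) ^ M * (1 + ∑ j, |η j|) ^ N * (V + ∑ j,
          (‖stft (coordDeriv j g) (f : 𝓢'(E d, ℂ)) (x, η)‖ +
            ‖stft g (coordDeriv j f : 𝓢'(E d, ℂ)) (x, η)‖)) := by gcongr
      _ = (1 + ‖x‖) ^ M * ((1 + ∑ j, |η j|) ^ N * V) + ∑ j,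
          ((1 + ‖x‖) ^ M * ((1 + ∑ j, |η j|) ^ N *
            ‖stft (coordDeriv j g) (f : 𝓢'(E d, ℂ)) (x, η)‖) +
          (1 + ‖x‖) ^ M * ((1 + ∑ j, |η j|) ^ N *
            ‖stft g (coordDeriv j f : 𝓢'(E d, ℂ)) (x, η)‖)) := by
          rw [mul_add, Finset.mul_sum]
          congr 1
          · ring
          · exact Finset.sum_congr rfl fun j _ => by ring
      _ ≤ _ := add_le_add (hC x η) (Finset.sum_le_sum fun j _ => add_le_add (hA j x η) (hB j x η))

theorem norm_le_sum_abs (η : E d) : ‖η‖ ≤ ∑ j, |η j| := by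
  conv_lhs => rw [← sum_coord_single η]
  refine (norm_sum_le _ _).trans (Finset.sum_le_sum fun j _ => ?_)
  simp [norm_smul]

theorem exists_norm_stft_le (g f : 𝓢(E d, ℂ)) :
    ∃ C : ℝ≥0, (∀ z, ‖stft g (f : 𝓢'(E d, ℂ)) z‖ ≤ C) ∧
      ∀ z, ‖stft g (f : 𝓢'(E d, ℂ)) z‖ ≤
        C * ((1 + ‖z.1‖) ^ (-((d + 1 : ℕ) : ℝ)) * (1 + ‖z.2‖) ^ (-((d + 1 : ℕ) : ℝ))) := by
  obtain ⟨C, hC⟩ := exists_pow_mul_pow_mul_norm_stft_le (d + 1) (d + 1) g f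
  have hC' : ∀ z : E d × E d, (1 + ‖z.1‖) ^ (d + 1) * ((1 + ‖z.2‖) ^ (d + 1) *
      ‖stft g (f : 𝓢'(E d, ℂ)) z‖) ≤ C := fun z => by
    refine le_trans ?_ (hC z.1 z.2)
    have := norm_le_sum_abs z.2
    gcongr
  have hC0 : 0 ≤ C := le_trans (by positivity) (hC' (0, 0))
  refine ⟨⟨C, hC0⟩, fun z => ?_, fun z => ?_⟩
  · refine le_trans ?_ (hC' z)
    exact (le_mul_of_one_le_left (norm_nonneg _) (one_le_pow₀ (by simp))).trans
      (le_mul_of_one_le_left (by positivity) (one_le_pow₀ (by simp)))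
  · rw [Real.rpow_neg (by positivity), Real.rpow_neg (by positivity), Real.rpow_natCast,
      Real.rpow_natCast, ← mul_inv, ← div_eq_mul_inv, le_div_iff₀ (by positivity)]
    refine le_trans (le_of_eq ?_) (hC' z)
    ring

theorem continuous_stft (g f : 𝓢(E d, ℂ)) : Continuous (stft g (f : 𝓢'(E d, ℂ))) := by
  obtain ⟨A, hA, hgA⟩ := exists_pow_mul_norm_le g 0
  have : stft g (f : 𝓢'(E d, ℂ)) = fun z => ∫ y, Complex.exp (-(2 * Real.pi * Complex.I) *
      (inner ℝ y z.2 : ℝ)) * (starRingEnd ℂ) (g (y - z.1)) * f y := funext fun z => stft_coe g f z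
  rw [this]
  have hg := g.continuous
  have hf := f.continuous
  have hconj := Complex.continuous_conj
  refine continuous_of_dominated (bound := fun y => A * ‖f y‖)
    (fun z => Continuous.aestronglyMeasurable ?_)
    (fun z => Filter.Eventually.of_forall fun y => ?_) (f.integrable.norm.const_mul A)
    (Filter.Eventually.of_forall fun y => ?_)
  · have : Continuous fun y => (starRingEnd ℂ) (g (y - z.1)) :=
      hconj.comp (hg.comp (continuous_id.sub continuous_const))
    fun_prop
  · have hexp : ‖Complex.exp (-(2 * Real.pi * Complex.I) * (inner ℝ y z.2 : ℝ))‖ = 1 := by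
      rw [Complex.norm_exp]; simp
    rw [norm_mul, norm_mul, hexp, one_mul, RCLike.norm_conj]
    exact mul_le_mul_of_nonneg_right (by simpa using hgA (y - z.1)) (norm_nonneg _)
  · have : Continuous fun z : E d × E d => (starRingEnd ℂ) (g (y - z.1)) :=
      hconj.comp (hg.comp (continuous_const.sub continuous_fst))
    fun_prop

theorem integrable_stft (g f : 𝓢(E d, ℂ)) : Integrable (stft g (f : 𝓢'(E d, ℂ))) := by
  obtain ⟨C, -, hC⟩ := exists_norm_stft_le g f
  have hInt : Integrable fun y : E d => (1 + ‖y‖) ^ (-((d + 1 : ℕ) : ℝ)) :=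
    integrable_one_add_norm (by simp)
  exact ((hInt.mul_prod hInt).const_mul (C : ℝ)).mono'
    (continuous_stft g f).aestronglyMeasurable (Filter.Eventually.of_forall hC)

/-- Interpolation between the $L^1$ norm and the sup bound reaches every exponent, including
infinity. -/
theorem memLp_stft (g f : 𝓢(E d, ℂ)) {q : ℝ≥0∞} (hq : 1 ≤ q) :
    MemLp (stft g (f : 𝓢'(E d, ℂ))) q volume := by
  obtain ⟨C, hC, -⟩ := exists_norm_stft_le g f
  refine ⟨(continuous_stft g f).aestronglyMeasurable, ?_⟩
  have hC' : ∀ z, ‖stft g (f : 𝓢'(E d, ℂ)) z‖ₑ ≤ C := fun z => by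
    rw [enorm_eq_nnnorm, ENNReal.coe_le_coe]; exact hC z
  have hle := eLpNorm_le_of_enorm_le (μ := volume) hC' one_pos (q := q) (by simpa using hq)
  have hq1 : (q⁻¹).toReal ≤ 1 := by
    have := ENNReal.toReal_mono ENNReal.one_ne_top (ENNReal.inv_le_one.2 hq)
    simpa using this
  refine hle.trans_lt (ENNReal.mul_lt_top ?_ ?_)
  · exact ENNReal.rpow_lt_top_of_nonneg (by linarith) ENNReal.coe_ne_top
  · rw [ENNReal.ofReal_one]
    exact ENNReal.rpow_lt_top_of_nonneg (by positivity)
      (memLp_one_iff_integrable.2 (integrable_stft g f)).2.ne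

/-- The orthogonality relation of the short-time Fourier transform. -/
theorem integral_conj_stft_mul_stft (g k w : 𝓢(E d, ℂ)) :
    ∫ z, (starRingEnd ℂ) (stft g (k : 𝓢'(E d, ℂ)) z) * stft g (w : 𝓢'(E d, ℂ)) z =
      ((∫ y, ‖g y‖ ^ 2 : ℝ) : ℂ) * ∫ y, (starRingEnd ℂ) (k y) * w y := by
  obtain ⟨C, hC, -⟩ := exists_norm_stft_le g k
  have hconj := Complex.continuous_conj
  have hInt : Integrable fun z => (starRingEnd ℂ) (stft g (k : 𝓢'(E d, ℂ)) z) *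
      stft g (w : 𝓢'(E d, ℂ)) z :=
    (integrable_stft g w).bdd_mul (c := C)
      (hconj.comp (continuous_stft g k)).aestronglyMeasurable
      (Filter.Eventually.of_forall fun z => by rw [RCLike.norm_conj]; exact hC z)
  rw [Measure.volume_eq_prod] at hInt ⊢
  rw [integral_prod _ hInt]
  -- Parseval in $\eta$ for fixed $x$. The window is evaluated at $-(x-y)$ so that the double
  -- integral in $(x,y)$ has the form of a convolution integrand.
  have hx : ∀ x : E d, ∫ η, (starRingEnd ℂ) (stft g (k : 𝓢'(E d, ℂ)) (x, η)) *
      stft g (w : 𝓢'(E d, ℂ)) (x, η) =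
        ∫ y, ((starRingEnd ℂ) (k y) * w y) * ((‖g (-(x - y))‖ ^ 2 : ℝ) : ℂ) := fun x => by
    have h := SchwartzMap.integral_inner_fourier_fourier (windowed g x k) (windowed g x w)
    simp only [RCLike.inner_apply] at h
    simp only [stft_eq_fourier, mul_comm ((starRingEnd ℂ) ((𝓕 (windowed g x k)) _))]
    rw [h]
    refine integral_congr_ae (Filter.Eventually.of_forall fun y => ?_)
    simp only [windowed_apply, map_mul, RCLike.conj_conj, neg_sub]
    rw [← Complex.normSq_eq_norm_sq, Complex.normSq_eq_conj_mul_self]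
    ring
  simp only [hx]
  have hg2 : Integrable fun y : E d => ((‖g (-y)‖ ^ 2 : ℝ) : ℂ) := by
    have h1 : Integrable fun y => ‖g y‖ ^ 2 := (g.memLp 2 volume).integrable_norm_pow (by simp)
    exact h1.comp_neg.ofReal
  have hkw : Integrable fun y => (starRingEnd ℂ) (k y) * w y := by
    obtain ⟨A, -, hA⟩ := exists_pow_mul_norm_le k 0
    exact w.integrable.bdd_mul (c := A) (hconj.comp k.continuous).aestronglyMeasurable
      (Filter.Eventually.of_forall fun y => by rw [RCLike.norm_conj]; simpa using hA y)
  have hprod := hkw.convolution_integrand (ContinuousLinearMap.mul ℝ ℂ) hg2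
  simp only [ContinuousLinearMap.mul_apply'] at hprod
  rw [integral_integral_swap hprod]
  simp only [integral_const_mul]
  rw [← integral_const_mul]
  refine integral_congr_ae (Filter.Eventually.of_forall fun y => ?_)
  simp only [neg_sub]
  rw [integral_sub_left_eq_self (fun v => ((‖g v‖ ^ 2 : ℝ) : ℂ)), integral_complex_ofReal,
    mul_comm]

/-- On the Fourier side the short-time transform integrates $\hat k$ against a function of modulus
$|\hat g(\zeta-\eta)|$, so a sup bound on $\hat k$ survives with the factor $\|\hat g\|_{L^1}$. -/
theorem norm_stft_le_of_fourier (g k : 𝓢(E d, ℂ)) {B : ℝ} (hB : ∀ ξ, ‖(𝓕 k) ξ‖ ≤ B)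
    (z : E d × E d) :
    ‖stft g (k : 𝓢'(E d, ℂ)) z‖ ≤ (∫ ζ, ‖(𝓕 g) ζ‖) * B := by
  obtain ⟨x, η⟩ := z
  have hnorm : ∀ ζ, ‖(𝓕⁻ (conjShift g x η)) ζ‖ = ‖(𝓕 g) (ζ - η)‖ := fun ζ => by
    rw [SchwartzMap.fourierInv_coe, Real.fourierInv_eq', SchwartzMap.fourier_coe,
      Real.fourier_eq', ← RCLike.norm_conj (∫ v, _ • g v), ← integral_conj,
      ← integral_sub_right_eq_self (fun v => (starRingEnd ℂ) (Complex.exp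
        (↑(-2 * Real.pi * inner ℝ v (ζ - η)) * Complex.I) • g v)) x]
    have : ∀ v : E d, (starRingEnd ℂ) (Complex.exp (↑(-2 * Real.pi * inner ℝ (v - x) (ζ - η)) *
        Complex.I) • g (v - x)) = Complex.exp (-(2 * Real.pi * Complex.I) *
          ((inner ℝ x (ζ - η) : ℝ) : ℂ)) * (Complex.exp (↑(2 * Real.pi * inner ℝ v ζ) * Complex.I) •
            conjShift g x η v) := fun v => by
      rw [conjShift_apply, smul_eq_mul, smul_eq_mul, map_mul, ← Complex.exp_conj, ← mul_assoc,
        ← mul_assoc, ← Complex.exp_add, ← Complex.exp_add]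
      congr 2
      simp only [map_mul, Complex.conj_ofReal, Complex.conj_I, inner_sub_left, inner_sub_right]
      push_cast
      ring
    simp only [this, integral_const_mul]
    rw [norm_mul]
    have hexp : ‖Complex.exp (-(2 * Real.pi * Complex.I) * ((inner ℝ x (ζ - η) : ℝ) : ℂ))‖ = 1 := by
      rw [Complex.norm_exp]; simp
    rw [hexp, one_mul]
  have hst : stft g (k : 𝓢'(E d, ℂ)) (x, η) = ∫ ζ, (𝓕⁻ (conjShift g x η)) ζ * (𝓕 k) ζ := by
    rw [stft, coe_schwartz_apply, ← SchwartzMap.integral_fourier_mul_eq, fourier_fourierInv_eq]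
  rw [hst]
  have hInt : Integrable fun ζ => ‖(𝓕 g) (ζ - η)‖ * B :=
    ((𝓕 g).integrable.norm.comp_sub_right η).mul_const B
  refine (norm_integral_le_of_norm_le hInt (Filter.Eventually.of_forall fun ζ => ?_)).trans
    (le_of_eq ?_)
  · rw [norm_mul, hnorm]
    exact mul_le_mul_of_nonneg_left (hB ζ) (norm_nonneg _)
  · rw [integral_mul_const, integral_sub_right_eq_self (fun ζ => ‖(𝓕 g : 𝓢(E d, ℂ)) ζ‖)]

theorem eLpNorm_two_sq {α : Type*} [MeasurableSpace α] {μ : Measure α} {f : α → ℂ}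
    (hf : MemLp f 2 μ) : eLpNorm f 2 μ ^ 2 = ENNReal.ofReal (∫ x, ‖f x‖ ^ 2 ∂μ) := by
  have h : 0 ≤ ∫ x, ‖f x‖ ^ 2 ∂μ := integral_nonneg fun x => by positivity
  rw [hf.eLpNorm_eq_integral_rpow_norm two_ne_zero ENNReal.ofNat_ne_top,
    ← ENNReal.ofReal_pow (by positivity)]
  simp only [ENNReal.toReal_ofNat, Real.rpow_ofNat]
  rw [← Real.rpow_natCast, ← Real.rpow_mul h]
  norm_num

theorem eLpNorm_stft_two (g k : 𝓢(E d, ℂ)) :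
    eLpNorm (stft g (k : 𝓢'(E d, ℂ))) 2 volume = eLpNorm g 2 volume * eLpNorm k 2 volume := by
  have h := integral_conj_stft_mul_stft g k k
  have hsq : ∀ c : ℂ, (starRingEnd ℂ) c * c = ((‖c‖ ^ 2 : ℝ) : ℂ) := fun c => by
    rw [← Complex.normSq_eq_norm_sq, Complex.normSq_eq_conj_mul_self]
  simp only [hsq, integral_complex_ofReal] at h
  have h' : ∫ z, ‖stft g (k : 𝓢'(E d, ℂ)) z‖ ^ 2 = (∫ y, ‖g y‖ ^ 2) * ∫ y, ‖k y‖ ^ 2 := by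
    exact_mod_cast h
  have h2 : eLpNorm (stft g (k : 𝓢'(E d, ℂ))) 2 volume ^ 2 =
      (eLpNorm g 2 volume * eLpNorm k 2 volume) ^ 2 := by
    rw [mul_pow, eLpNorm_two_sq (memLp_stft g k one_le_two), eLpNorm_two_sq (g.memLp 2 volume),
      eLpNorm_two_sq (k.memLp 2 volume), h', ENNReal.ofReal_mul (by positivity)]
  exact (ENNReal.pow_right_strictMono two_ne_zero).injective h2

theorem stft_mul_wave {f h : 𝓢(E d, ℂ)} {l : ℝ} (hh : ∀ x, h x = f x * wave l x)
    (g : 𝓢(E d, ℂ)) (z : E d × E d) :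
    stft g (h : 𝓢'(E d, ℂ)) z = stft g (f : 𝓢'(E d, ℂ)) (z.1, z.2 - diag l) := by
  obtain ⟨x, η⟩ := z
  rw [stft_eq_fourier, stft_eq_fourier]
  refine fourier_mul_wave (fun y => ?_) η
  rw [windowed_apply, windowed_apply, hh, mul_assoc]

/-- Orthogonality gives duality up to the factor $\|g\|_{L^2}^{-2}$ and supplies the $L^2$ endpoint.
The other endpoint of the interpolation is `norm_stft_le_of_fourier`. -/
theorem isDualScale_modNorm {g : 𝓢(E d, ℂ)} (hg : g ≠ 0) :
    IsDualScale fun (q : ℝ≥0∞) (f : 𝓢(E d, ℂ)) => modNorm g q (f : 𝓢'(E d, ℂ)) where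
  lt_top q hq f := (memLp_stft g f hq).2
  pairing p q _ := by
    set c : ℝ := ∫ y, ‖g y‖ ^ 2 with hc
    have hcpos : 0 < c := by
      obtain ⟨y, hy⟩ : ∃ y, g y ≠ 0 := by
        by_contra! h
        exact hg (SchwartzMap.ext h)
      have := g.continuous
      exact integral_pos_of_integrable_nonneg_nonzero (x := y) (by fun_prop)
        ((g.memLp 2 volume).integrable_norm_pow (by simp)) (fun _ => by positivity) (by simpa using hy)
    refine ⟨⟨c⁻¹, by positivity⟩, fun w k => ?_⟩
    have h := integral_conj_stft_mul_stft g k w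
    have h1 : ∫ x, (starRingEnd ℂ) (k x) * w x = ((c⁻¹ : ℝ) : ℂ) *
        ∫ z, (starRingEnd ℂ) (stft g (k : 𝓢'(E d, ℂ)) z) * stft g (w : 𝓢'(E d, ℂ)) z := by
      rw [h, ← mul_assoc, ← hc, ← Complex.ofReal_mul, inv_mul_cancel₀ hcpos.ne',
        Complex.ofReal_one, one_mul]
    rw [h1, enorm_mul]
    refine mul_le_mul' (le_of_eq ?_) (enorm_integral_conj_mul_le
      (continuous_stft g w).aestronglyMeasurable (continuous_stft g k).aestronglyMeasurable)
    rw [enorm_eq_nnnorm]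
    congr 1
    ext
    rw [coe_nnnorm, Complex.norm_real, Real.norm_of_nonneg (by positivity)]
    rfl
  modulation q l f h hh := by
    have : stft g (h : 𝓢'(E d, ℂ)) = stft g (f : 𝓢'(E d, ℂ)) ∘
        Prod.map id fun η => η - diag l :=
      funext fun z => stft_mul_wave hh g z
    simp only [modNorm]
    rw [this]
    exact eLpNorm_comp_measurePreserving (continuous_stft g f).aestronglyMeasurable
      ((MeasurePreserving.id volume).prod (measurePreserving_sub_right volume (diag l)))
  interpolation q hq := by
    set a : ℝ≥0 := ⟨∫ ζ, ‖(𝓕 g) ζ‖, by positivity⟩ with ha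
    have hg2 : eLpNorm g 2 volume ≠ ⊤ := (g.memLp 2 volume).2.ne
    have hq1 : (q⁻¹).toReal ≤ 1 / 2 := by
      have := ENNReal.toReal_mono (by simp) (ENNReal.inv_le_inv.2 hq)
      simpa using this
    have hA : (a : ℝ≥0∞) ^ (1 - 2 * (q⁻¹).toReal) *
        eLpNorm g 2 volume ^ (2 * (q⁻¹).toReal) ≠ ⊤ :=
      ENNReal.mul_ne_top (ENNReal.rpow_ne_top_of_nonneg (by linarith) ENNReal.coe_ne_top)
        (ENNReal.rpow_ne_top_of_nonneg (by positivity) hg2)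
    refine ⟨((a : ℝ≥0∞) ^ (1 - 2 * (q⁻¹).toReal) *
      eLpNorm g 2 volume ^ (2 * (q⁻¹).toReal)).toNNReal, fun k B hB => ?_⟩
    rw [ENNReal.coe_toNNReal hA]
    have hB' : ∀ ξ, ‖(𝓕 k) ξ‖ ≤ B := fun ξ => by
      have := hB ξ
      rwa [enorm_eq_nnnorm, ENNReal.coe_le_coe] at this
    have hsup : ∀ z, ‖stft g (k : 𝓢'(E d, ℂ)) z‖ₑ ≤ (a * B : ℝ≥0) := fun z => by
      rw [enorm_eq_nnnorm, ENNReal.coe_le_coe]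
      exact norm_stft_le_of_fourier g k hB' z
    have := eLpNorm_le_of_enorm_le (μ := volume) hsup two_pos (q := q) (by simpa using hq)
    rw [ENNReal.ofReal_ofNat, eLpNorm_stft_two, ENNReal.coe_mul,
      ENNReal.mul_rpow_of_nonneg _ _ (by linarith), ENNReal.mul_rpow_of_nonneg _ _ (by positivity),
      mul_mul_mul_comm] at this
    exact this

theorem coe_mem_ModDomain (g : 𝓢(E d, ℂ)) (p : ℝ≥0∞) [hp : Fact (1 ≤ p)] (f : 𝓢(E d, ℂ)) :
    (f : 𝓢'(E d, ℂ)) ∈ ModDomain g p := by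
  have h1 : (f : 𝓢'(E d, ℂ)) ∈ Mod g p := memLp_stft g f hp.out
  unfold ModDomain
  split_ifs
  · refine ⟨h1, fun ε hε => ⟨f, h1, ?_⟩⟩
    rw [sub_self, modNorm, stft_zero, eLpNorm_zero]
    exact_mod_cast hε
  · exact h1

theorem ExtendsToMod.exists_bound {g : 𝓢(E d, ℂ)} {p : ℝ≥0∞} [Fact (1 ≤ p)]
    {T : 𝓢(E d, ℂ) → E d → ℂ} (hT : ExtendsToMod g p T) :
    ∃ C : ℝ≥0, ∀ f w : 𝓢(E d, ℂ), T f = w →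
      modNorm g p (w : 𝓢'(E d, ℂ)) ≤ C * modNorm g p (f : 𝓢'(E d, ℂ)) := by
  obtain ⟨S, hS, C, hC⟩ := hT
  refine ⟨C, fun f w hw => ?_⟩
  have hmem := coe_mem_ModDomain g p f
  have h1 := hS f hmem
  rw [hw] at h1
  have h2 := hC ⟨f, hmem⟩
  rwa [h1.eq_coe] at h2

end Modulation

/-! ### The action of `japD` on modulated functions -/

section Envelope

open Filter Topology

variable {d : ℕ}

/-- The quotient `⟨η + (l, …, l)⟩² / l²`. -/
def bracketRatio (l : ℝ) (η : E d) : ℝ := (1 + ‖η + diag l‖ ^ 2) / l ^ 2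

theorem norm_diag_sq (l : ℝ) : ‖(diag l : E d)‖ ^ 2 = d * l ^ 2 := by
  rw [EuclideanSpace.norm_sq_eq]
  simp [diag]

theorem bracketRatio_pos {l : ℝ} (hl : 0 < l) (η : E d) : 0 < bracketRatio l η := by
  unfold bracketRatio; positivity

theorem bracketRatio_eq {l : ℝ} (hl : 0 < l) (η : E d) :
    bracketRatio l η = d + 2 * (∑ i, η i) * l⁻¹ + (1 + ‖η‖ ^ 2) * (l⁻¹ * l⁻¹) := by
  rw [bracketRatio, norm_add_sq_real, inner_diag, norm_diag_sq]
  field_simp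
  ring

theorem tendsto_bracketRatio (η : E d) :
    Tendsto (fun l : ℝ => bracketRatio l η) atTop (𝓝 d) := by
  have h : Tendsto (fun l : ℝ => (d : ℝ) + 2 * (∑ i, η i) * l⁻¹ + (1 + ‖η‖ ^ 2) * (l⁻¹ * l⁻¹))
      atTop (𝓝 (d + 2 * (∑ i, η i) * 0 + (1 + ‖η‖ ^ 2) * (0 * 0))) :=
    (tendsto_const_nhds.add (tendsto_inv_atTop_zero.const_mul _)).add
      ((tendsto_inv_atTop_zero.mul tendsto_inv_atTop_zero).const_mul _)
  simp only [mul_zero, add_zero] at h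
  refine h.congr' ?_
  filter_upwards [eventually_gt_atTop 0] with l hl
  rw [bracketRatio_eq hl]

/-- A form of Peetre's inequality: for $l\ge1$ the ratio and its inverse are both at most
$(2d+2)\langle\eta\rangle^2$. Both directions are needed because the sign of `m` is arbitrary. -/
theorem bracketRatio_rpow_le (hd : 0 < d) (m : ℝ) {l : ℝ} (hl : 1 ≤ l) (η : E d) :
    bracketRatio l η ^ (m / 2) ≤ (2 * d + 2 : ℝ) ^ (|m| / 2) * bracket |m| η := by
  have hl0 : 0 < l := by linarith
  have hd1 : (1 : ℝ) ≤ d := by exact_mod_cast hd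
  have hr := bracketRatio_pos hl0 η
  have hsq : 0 ≤ ‖η‖ ^ 2 := by positivity
  have hl2 : 1 ≤ l ^ 2 := one_le_pow₀ hl
  have h1 : bracketRatio l η ≤ (2 * d + 2) * (1 + ‖η‖ ^ 2) := by
    rw [bracketRatio, div_le_iff₀ (by positivity)]
    have : ‖η + diag l‖ ^ 2 ≤ 2 * (‖η‖ ^ 2 + d * l ^ 2) := by
      rw [← norm_diag_sq]
      have := norm_add_le η (diag l)
      nlinarith [sq_nonneg (‖η‖ - ‖(diag l : E d)‖), norm_nonneg (η + diag l)]
    nlinarith [mul_nonneg hsq (by linarith : 0 ≤ l ^ 2 - 1), mul_nonneg hsq (by positivity : 0 ≤ d * l ^ 2)]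
  have h2 : (bracketRatio l η)⁻¹ ≤ (2 * d + 2) * (1 + ‖η‖ ^ 2) := by
    rw [bracketRatio, inv_div, div_le_iff₀ (by positivity)]
    have : d * l ^ 2 ≤ 2 * (‖η + diag l‖ ^ 2 + ‖η‖ ^ 2) := by
      rw [← norm_diag_sq]
      have := norm_sub_le (η + diag l) η
      rw [add_sub_cancel_left] at this
      nlinarith [sq_nonneg (‖η + diag l‖ - ‖η‖), norm_nonneg (diag l : E d)]
    have h3 : l ^ 2 ≤ d * l ^ 2 := le_mul_of_one_le_left (by positivity) hd1
    have h4 : 0 ≤ ‖η‖ ^ 2 * ‖η + diag l‖ ^ 2 := by positivity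
    have h5 : 0 ≤ ‖η + diag l‖ ^ 2 := by positivity
    have h6 : (2 : ℝ) * ((1 + ‖η‖ ^ 2) * (1 + ‖η + diag l‖ ^ 2)) ≤
        (2 * d + 2) * ((1 + ‖η‖ ^ 2) * (1 + ‖η + diag l‖ ^ 2)) := by
      gcongr; linarith
    nlinarith
  rw [bracket, ← Real.mul_rpow (by positivity) (by positivity)]
  rcases le_total 0 m with hm | hm
  · rw [abs_of_nonneg hm]
    exact Real.rpow_le_rpow hr.le h1 (by positivity)
  · rw [abs_of_nonpos hm, ← inv_inv (bracketRatio l η), Real.inv_rpow (by positivity),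
      ← Real.rpow_neg (by positivity), ← neg_div]
    exact Real.rpow_le_rpow (by positivity) h2 (by linarith)

/-- The normalized envelope of `⟨D⟩ ^ m (b · wave l)`. -/
def envelope (m : ℝ) (b : 𝓢(E d, ℂ)) (l : ℝ) (y : E d) : ℂ :=
  ∫ η, Complex.exp (2 * Real.pi * Complex.I * (inner ℝ y η : ℝ)) *
    (((bracketRatio l η ^ (m / 2) : ℝ) : ℂ) * (𝓕 b) η)

/-- Translating the frequency variable by $(l,\dots,l)$ pulls the wave out of the integral. What is
left of the multiplier is normalised by $l^m$. -/
theorem japD_mul_wave (m : ℝ) {b h : 𝓢(E d, ℂ)} {l : ℝ} (hl : 0 < l)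
    (hh : ∀ x, h x = b x * wave l x) (y : E d) :
    japD m h y = ((l ^ m : ℝ) : ℂ) * (wave l y * envelope m b l y) := by
  rw [japD_apply, envelope, ← integral_const_mul, ← integral_const_mul,
    ← integral_add_right_eq_self _ (diag l)]
  refine integral_congr_ae (Eventually.of_forall fun η => ?_)
  simp only [← SchwartzMap.fourier_coe, fourier_mul_wave hh, add_sub_cancel_right]
  have hb : bracket m (η + diag l) = l ^ m * bracketRatio l η ^ (m / 2) := by
    have : l ^ m = (l ^ 2) ^ (m / 2) := by
      rw [← Real.rpow_natCast, ← Real.rpow_mul hl.le]; congr 1; push_cast; ring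
    rw [this, ← Real.mul_rpow (by positivity) (bracketRatio_pos hl η).le, bracketRatio,
      mul_div_cancel₀ _ (by positivity), bracket]
  rw [hb, wave_eq, inner_add_right]
  push_cast
  rw [mul_add, Complex.exp_add]
  ring

theorem norm_envelope_integrand_le (hd : 0 < d) (m : ℝ) (b : 𝓢(E d, ℂ)) {l : ℝ} (hl : 1 ≤ l)
    (y η : E d) :
    ‖Complex.exp (2 * Real.pi * Complex.I * (inner ℝ y η : ℝ)) *
      (((bracketRatio l η ^ (m / 2) : ℝ) : ℂ) * (𝓕 b) η)‖ ≤
      (2 * d + 2 : ℝ) ^ (|m| / 2) * ‖(bracket |m| η : ℂ) * (𝓕 b) η‖ := by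
  rw [norm_mul, norm_exp_two_pi_I_mul, one_mul, norm_mul, norm_mul, Complex.norm_real,
    Complex.norm_real, Real.norm_of_nonneg (bracket_pos _ _).le, Real.norm_of_nonneg
      (Real.rpow_nonneg (bracketRatio_pos (by linarith) η).le _), ← mul_assoc]
  exact mul_le_mul_of_nonneg_right (bracketRatio_rpow_le hd m hl η) (norm_nonneg _)

theorem integrable_envelope_bound (m : ℝ) (b : 𝓢(E d, ℂ)) :
    Integrable fun η : E d =>
      (2 * d + 2 : ℝ) ^ (|m| / 2) * ‖(bracket |m| η : ℂ) * (𝓕 b : 𝓢(E d, ℂ)) η‖ :=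
  (integrable_bracket_mul |m| (𝓕 b)).norm.const_mul _

theorem continuous_envelope_integrand (m : ℝ) (b : 𝓢(E d, ℂ)) {l : ℝ} (hl : 1 ≤ l) :
    Continuous fun z : E d × E d => Complex.exp (2 * Real.pi * Complex.I * (inner ℝ z.1 z.2 : ℝ)) *
      (((bracketRatio l z.2 ^ (m / 2) : ℝ) : ℂ) * (𝓕 b) z.2) := by
  have h1 : Continuous fun η : E d => bracketRatio l η := by unfold bracketRatio; fun_prop
  have h2 : Continuous fun η : E d => bracketRatio l η ^ (m / 2) :=
    h1.rpow_const fun η => Or.inl (bracketRatio_pos (by linarith) η).ne'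
  have h3 := (𝓕 b).continuous
  have h4 : Continuous fun z : E d × E d => bracketRatio l z.2 ^ (m / 2) := h2.comp continuous_snd
  fun_prop

theorem continuous_envelope (hd : 0 < d) (m : ℝ) (b : 𝓢(E d, ℂ)) {l : ℝ} (hl : 1 ≤ l) :
    Continuous (envelope m b l) := by
  have hc := continuous_envelope_integrand m b hl
  refine continuous_of_dominated (bound := fun η =>
      (2 * d + 2 : ℝ) ^ (|m| / 2) * ‖(bracket |m| η : ℂ) * (𝓕 b : 𝓢(E d, ℂ)) η‖)
    (fun y => Continuous.aestronglyMeasurable ?_)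
    (fun y => Eventually.of_forall fun η => norm_envelope_integrand_le hd m b hl y η)
    (integrable_envelope_bound m b) (Eventually.of_forall fun η => ?_)
  · have := hc.comp (Continuous.prodMk_right y)
    simpa only [Function.comp_def] using this
  · have := hc.comp (Continuous.prodMk_left η)
    simpa only [Function.comp_def] using this

theorem exists_norm_envelope_le (hd : 0 < d) (m : ℝ) (b : 𝓢(E d, ℂ)) :
    ∃ C : ℝ, ∀ l : ℝ, 1 ≤ l → ∀ y, ‖envelope m b l y‖ ≤ C :=
  ⟨_, fun _ hl y => norm_integral_le_of_norm_le
    (integrable_envelope_bound m b)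
    (Eventually.of_forall fun η => norm_envelope_integrand_le hd m b hl y η)⟩

/-- The normalised multiplier tends to $d^{m/2}$ at each frequency, and Peetre's inequality against
the Schwartz function $\hat b$ provides a dominating function independent of `l`. -/
theorem tendsto_envelope (hd : 0 < d) (m : ℝ) (b : 𝓢(E d, ℂ)) (y : E d) :
    Tendsto (fun l => envelope m b l y) atTop (𝓝 ((((d : ℝ) ^ (m / 2) : ℝ) : ℂ) * b y)) := by
  have hlim : (((d : ℝ) ^ (m / 2) : ℝ) : ℂ) * b y =
      ∫ η, Complex.exp (2 * Real.pi * Complex.I * (inner ℝ y η : ℝ)) *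
        ((((d : ℝ) ^ (m / 2) : ℝ) : ℂ) * (𝓕 b) η) := by
    rw [← fourier_inversion_apply b y, ← integral_const_mul]
    refine integral_congr_ae (Eventually.of_forall fun η => ?_)
    ring
  rw [hlim]
  refine tendsto_integral_filter_of_dominated_convergence
    (fun η => (2 * d + 2 : ℝ) ^ (|m| / 2) * ‖(bracket |m| η : ℂ) * (𝓕 b : 𝓢(E d, ℂ)) η‖) ?_ ?_
    (integrable_envelope_bound m b) ?_
  · filter_upwards [eventually_ge_atTop 1] with l hl
    exact ((continuous_envelope_integrand m b hl).comp
      (Continuous.prodMk_right y)).aestronglyMeasurable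
  · filter_upwards [eventually_ge_atTop 1] with l hl
    exact Eventually.of_forall fun η => norm_envelope_integrand_le hd m b hl y η
  · refine Eventually.of_forall fun η => ((Tendsto.mul_const _ ?_).const_mul _)
    have hd0 : (d : ℝ) ≠ 0 := by exact_mod_cast hd.ne'
    exact (Complex.continuous_ofReal.tendsto _).comp
      ((tendsto_bracketRatio η).rpow_const (Or.inl hd0))

theorem tendsto_integral_envelope (hd : 0 < d) (m : ℝ) {b : 𝓢(E d, ℂ)} {β : E d → ℝ}
    (hβ : ∀ y, b y = β y) {c : E d → ℝ} (hc : Continuous c) (hcc : HasCompactSupport c)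
    {Ψ : E d → E d} (hΨ : Continuous Ψ) :
    Tendsto (fun l => ∫ x, (c x : ℂ) * envelope m b l (Ψ x)) atTop
      (𝓝 (((d : ℝ) ^ (m / 2) * ∫ x, c x * β (Ψ x) : ℝ) : ℂ)) := by
  obtain ⟨C, hC⟩ := exists_norm_envelope_le hd m b
  have hlim : (((d : ℝ) ^ (m / 2) * ∫ x, c x * β (Ψ x) : ℝ) : ℂ) =
      ∫ x, (c x : ℂ) * ((((d : ℝ) ^ (m / 2) : ℝ) : ℂ) * b (Ψ x)) := by
    rw [Complex.ofReal_mul, ← integral_complex_ofReal, ← integral_const_mul]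
    refine integral_congr_ae (Eventually.of_forall fun x => ?_)
    simp only [hβ]
    push_cast
    ring
  rw [hlim]
  refine tendsto_integral_filter_of_dominated_convergence (fun x => ‖c x‖ * C) ?_ ?_
    ((hc.integrable_of_hasCompactSupport hcc).norm.mul_const C) ?_
  · filter_upwards [eventually_ge_atTop 1] with l hl
    have := (continuous_envelope hd m b hl).comp hΨ
    exact Continuous.aestronglyMeasurable ((Complex.continuous_ofReal.comp hc).mul this)
  · filter_upwards [eventually_ge_atTop 1] with l hl
    refine Eventually.of_forall fun x => ?_
    rw [norm_mul, Complex.norm_real]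
    exact mul_le_mul_of_nonneg_left (hC l hl _) (norm_nonneg _)
  · exact Eventually.of_forall fun x => (tendsto_envelope hd m b (Ψ x)).const_mul _

end Envelope

/-! ### Unboundedness -/

section Unbounded

open Filter Topology

variable {d : ℕ}

/-- With the $L^2$ norm bounded, interpolation raises the decay $l^{-d/2}$ to the power $1-2/q$,
that is, to $l^{-d(1/2-1/q)}$. -/
theorem IsDualScale.exists_le_of_norm_fourier_le {N : ℝ≥0∞ → 𝓢(E d, ℂ) → ℝ≥0∞}
    (hN : IsDualScale N) {q : ℝ≥0∞} (hq : 2 ≤ q) {k : ℝ → 𝓢(E d, ℂ)} {C : ℝ} (hC : 0 ≤ C)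
    (hk : ∀ (l : ℝ) (ξ : E d), 0 < l → ‖(𝓕 (k l)) ξ‖ ≤ C * l ^ (-(d : ℝ) / 2)) {M : ℝ≥0}
    (hM : ∀ l, eLpNorm (k l) 2 volume ≤ M) :
    ∃ A : ℝ≥0, ∀ l : ℝ, 0 < l →
      N q (k l) ≤ A * ENNReal.ofReal (l ^ (-((d : ℝ) * (1 / 2 - (q⁻¹).toReal)))) := by
  obtain ⟨A, hA⟩ := hN.interpolation q hq
  have hq1 : (q⁻¹).toReal ≤ 1 / 2 := by
    have := ENNReal.toReal_mono (by simp) (ENNReal.inv_le_inv.2 hq)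
    simpa using this
  have hq0 : 0 ≤ (q⁻¹).toReal := ENNReal.toReal_nonneg
  set t := (q⁻¹).toReal with ht
  refine ⟨A * (C.toNNReal ^ (1 - 2 * t) * M ^ (2 * t)), fun l hl => ?_⟩
  have hB : ∀ ξ, ‖(𝓕 (k l)) ξ‖ₑ ≤ ((C.toNNReal * (l ^ (-(d : ℝ) / 2)).toNNReal : ℝ≥0) : ℝ≥0∞) :=
    fun ξ => by
      rw [enorm_eq_nnnorm, ENNReal.coe_le_coe, ← NNReal.coe_le_coe, NNReal.coe_mul,
        Real.coe_toNNReal _ hC, Real.coe_toNNReal _ (Real.rpow_nonneg hl.le _)]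
      exact hk l ξ hl
  refine (hA (k l) _ hB).trans ?_
  have hpow : ENNReal.ofReal (l ^ (-((d : ℝ) * (1 / 2 - t)))) =
      ENNReal.ofReal (l ^ (-(d : ℝ) / 2)) ^ (1 - 2 * t) := by
    rw [ENNReal.ofReal_rpow_of_pos (Real.rpow_pos_of_pos hl _), ← Real.rpow_mul hl.le]
    congr 2
    ring
  rw [hpow, ENNReal.coe_mul, ENNReal.coe_mul, ENNReal.coe_mul,
    ENNReal.coe_rpow_of_nonneg _ (by linarith), ENNReal.coe_rpow_of_nonneg _ (by linarith),
    ENNReal.mul_rpow_of_nonneg _ _ (by linarith)]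
  calc _ ≤ (A : ℝ≥0∞) * ((C.toNNReal : ℝ≥0∞) ^ (1 - 2 * t) *
        ENNReal.ofReal (l ^ (-(d : ℝ) / 2)) ^ (1 - 2 * t) * (M : ℝ≥0∞) ^ (2 * t)) := by
        gcongr
        · linarith
        · exact le_rfl
        · exact hM l
    _ = _ := by ring

/-- Dividing by $l^m$ would give $|I(l)|\le Cl^{-(m+s)}\to0$, against the nonzero limit. -/
theorem false_of_enorm_mul_le {m s : ℝ} (hms : 0 < m + s) {I : ℝ → ℂ} {L : ℂ} (hL : L ≠ 0)
    (hI : Tendsto I atTop (𝓝 L)) {C : ℝ≥0}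
    (hC : ∀ l : ℝ, 1 ≤ l → ‖((l ^ m : ℝ) : ℂ) * I l‖ₑ ≤ C * ENNReal.ofReal (l ^ (-s))) : False := by
  have h0 : Tendsto (fun l : ℝ => (C : ℝ) * l ^ (-(m + s))) atTop (𝓝 0) := by
    simpa using (tendsto_rpow_neg_atTop hms).const_mul (C : ℝ)
  refine hL (tendsto_nhds_unique hI (squeeze_zero_norm' ?_ h0))
  filter_upwards [eventually_ge_atTop 1] with l hl
  have hl0 : 0 < l := by linarith
  have h := hC l hl
  rw [ENNReal.ofReal, enorm_eq_nnnorm, ← ENNReal.coe_mul, ENNReal.coe_le_coe,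
    ← NNReal.coe_le_coe, NNReal.coe_mul, Real.coe_toNNReal _ (Real.rpow_nonneg hl0.le _),
    coe_nnnorm, norm_mul, Complex.norm_real, Real.norm_of_nonneg (Real.rpow_nonneg hl0.le _)] at h
  have hpos := Real.rpow_pos_of_pos hl0 m
  rw [neg_add, Real.rpow_add hl0, Real.rpow_neg hl0.le m]
  calc ‖I l‖ = (l ^ m)⁻¹ * (l ^ m * ‖I l‖) := by field_simp
    _ ≤ (l ^ m)⁻¹ * (C * l ^ (-s)) := by gcongr
    _ = _ := by ring

/-- The multiplier `⟨D⟩ ^ m` on Schwartz functions. -/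
def japDSchwartz (m : ℝ) (f : 𝓢(E d, ℂ)) : 𝓢(E d, ℂ) :=
  𝓕⁻ (SchwartzMap.smulLeftCLM ℂ (fun η : E d => (bracket m η : ℂ)) (𝓕 f))

theorem coe_japDSchwartz (m : ℝ) (f : 𝓢(E d, ℂ)) : ⇑(japDSchwartz m f) = japD m f := by
  rw [japDSchwartz, SchwartzMap.fourierInv_coe, japD]
  congr 1
  funext η
  rw [SchwartzMap.smulLeftCLM_apply_apply (hasTemperateGrowth_bracket m), smul_eq_mul,
    SchwartzMap.fourier_coe]

theorem prodMap_id (x : E d) : prodMap (fun t => t) x = x := rfl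

theorem chirp_id_apply {G : E d → ℝ} (hG : ContDiff ℝ ∞ G) (hGc : HasCompactSupport G) (l : ℝ)
    (x : E d) : chirp hG hGc contDiff_id l x = (G x : ℂ) * wave l x := rfl

theorem wave_zero (x : E d) : wave 0 x = 1 := by simp [wave]

theorem chirp_id_zero_apply {G : E d → ℝ} (hG : ContDiff ℝ ∞ G) (hGc : HasCompactSupport G)
    (x : E d) : chirp hG hGc contDiff_id 0 x = (G x : ℂ) := by
  rw [chirp_id_apply, wave_zero, mul_one]

theorem eLpNorm_chirp {G : E d → ℝ} (hG : ContDiff ℝ ∞ G) (hGc : HasCompactSupport G) {φ : ℝ → ℝ}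
    (hφ : ContDiff ℝ ∞ φ) (l : ℝ) (q : ℝ≥0∞) :
    eLpNorm (chirp hG hGc hφ l) q volume = eLpNorm G q volume :=
  eLpNorm_congr_norm_ae (Eventually.of_forall fun x => by
    rw [norm_chirp, Real.norm_eq_abs])

/-- `T` is bounded with respect to `N`, locally uniformly with respect to supports. -/
def IsLocallyBounded (N : 𝓢(E d, ℂ) → ℝ≥0∞) (T : 𝓢(E d, ℂ) → E d → ℂ) : Prop :=
  ∀ K : Set (E d), IsCompact K → ∃ C : ℝ≥0, ∀ f w : 𝓢(E d, ℂ), tsupport f ⊆ K → T f = w →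
    N w ≤ C * N f

theorem exists_tensorPow_ne_zero {θ : ℝ → ℝ} (hs : tsupport θ ⊆ Ioo 0 1) (hne : ∃ t, θ t ≠ 0) :
    ∃ x : E d, tensorPow θ x ≠ 0 ∧ ∀ i, x i ∈ Ioo (0 : ℝ) 1 := by
  obtain ⟨t, ht⟩ := hne
  exact ⟨diag t, Finset.prod_ne_zero_iff.2 fun i _ => ht, fun i => hs (subset_tsupport _ ht)⟩

theorem prodMap_mem_Icc {φ : ℝ ≃ ℝ} (hφ : IsNonlinearDiffeo φ) {x : E d}
    (hx : ∀ i, x i ∈ Ioo (0 : ℝ) 1) (i : Fin d) : prodMap φ x i ∈ Icc (0 : ℝ) 1 :=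
  Ioo_subset_Icc_self (hφ.image ▸ mem_image_of_mem φ (hx i))

/-- The inputs are packets $Ge_l$, of constant norm and common support. The output, with oscillation
$e_l\circ\tilde\varphi$, is paired with a chirp of the same phase: the oscillations cancel and a
convergent integral times $l^m$ remains. Duality bounds the pairing by the decaying norm of the
chirp in the conjugate exponent $q\ge2$. -/
theorem not_isLocallyBounded_opF (hd : 0 < d) {φ : ℝ ≃ ℝ} (hφ : IsNonlinearDiffeo φ)
    {G : E d → ℝ} (hG : IsCutoff G) (hG1 : ∀ x, (∀ i, x i ∈ Icc (0 : ℝ) 1) → G x = 1)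
    {N : ℝ≥0∞ → 𝓢(E d, ℂ) → ℝ≥0∞} (hN : IsDualScale N) {p : ℝ≥0∞} (hp1 : 1 ≤ p) (hp2 : p ≤ 2)
    {m : ℝ} (hm : -(d : ℝ) * |1 / 2 - (p⁻¹).toReal| < m) :
    ¬ IsLocallyBounded (N p) (opF m φ G) := by
  intro hT
  obtain ⟨θ, hθ, hθc, hθ0, hθs, hθne, B, hB, hle⟩ := exists_bump_norm_fourier_chirp_le (d := d) hφ
  set q : ℝ≥0∞ := (1 - p⁻¹)⁻¹ with hq
  have hpq : ENNReal.HolderConjugate p q := ENNReal.HolderConjugate.inv_one_sub_inv' hp1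
  have hinv2 : (2 : ℝ≥0∞)⁻¹ ≤ p⁻¹ := ENNReal.inv_le_inv.2 hp2
  have hq2 : 2 ≤ q := by
    rw [hq, ← inv_inv (2 : ℝ≥0∞), ENNReal.inv_le_inv, tsub_le_iff_right,
      ← ENNReal.inv_two_add_inv_two]
    exact add_le_add le_rfl hinv2
  have hpi1 : p⁻¹ ≤ 1 := ENNReal.inv_le_one.2 hp1
  have hqt : (q⁻¹).toReal = 1 - (p⁻¹).toReal := by
    rw [hq, inv_inv, ENNReal.toReal_sub_of_le hpi1 ENNReal.one_ne_top, ENNReal.toReal_one]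
  have hp12 : 1 / 2 ≤ (p⁻¹).toReal := by
    have := ENNReal.toReal_mono (ne_top_of_le_ne_top ENNReal.one_ne_top hpi1) hinv2
    simpa using this
  have hk := hN.exists_le_of_norm_fourier_le hq2 hB hle
    (M := (eLpNorm (tensorPow (d := d) θ) 2 volume).toNNReal) fun l => by
      rw [eLpNorm_chirp, ENNReal.coe_toNNReal]
      exact ((contDiff_tensorPow hθ).continuous.memLp_of_hasCompactSupport
        (hasCompactSupport_tensorPow hθc)).2.ne
  obtain ⟨A₁, hA₁⟩ := hk
  obtain ⟨A₂, hA₂⟩ := hN.pairing p q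
  obtain ⟨A₃, hA₃⟩ := hT (tsupport G) hG.compact
  set b : 𝓢(E d, ℂ) := chirp hG.smooth hG.compact contDiff_id 0 with hb
  have hbG : ∀ y, b y = G y := chirp_id_zero_apply hG.smooth hG.compact
  set k : ℝ → 𝓢(E d, ℂ) := fun l =>
    chirp (contDiff_tensorPow hθ) (hasCompactSupport_tensorPow hθc) hφ.smooth l with hkdef
  set f : ℝ → 𝓢(E d, ℂ) := fun l => chirp hG.smooth hG.compact contDiff_id l with hf
  have hfb : ∀ l x, f l x = b x * wave l x := fun l x => by
    rw [hbG]; exact chirp_id_apply hG.smooth hG.compact l x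
  set w : ℝ → 𝓢(E d, ℂ) := fun l => twist hφ.smooth hG.contDiff_ofReal
    hG.hasCompactSupport_ofReal (japDSchwartz m (f l)) with hw
  have hTw : ∀ l, opF m φ G (f l) = w l := fun l => by
    funext x
    rw [hw, twist_apply, coe_japDSchwartz, opF]
  have hpair : ∀ l, 0 < l → ∫ x, (starRingEnd ℂ) (k l x) * w l x = ((l ^ m : ℝ) : ℂ) *
      ∫ x, ((tensorPow θ x * G x : ℝ) : ℂ) * envelope m b l (prodMap φ x) := fun l hl => by
    rw [← integral_const_mul]
    refine integral_congr_ae (Eventually.of_forall fun x => ?_)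
    simp only
    rw [← hTw, opF, japD_mul_wave m hl (hfb l), chirp_apply, map_mul, Complex.conj_ofReal]
    have := conj_wave_mul l (prodMap φ x)
    push_cast
    linear_combination ((tensorPow θ x : ℂ) * G x * (l ^ m : ℝ) *
      envelope m b l (prodMap φ x)) * this
  have hcont : Continuous fun x : E d => tensorPow θ x * G x :=
    (contDiff_tensorPow hθ).continuous.mul hG.smooth.continuous
  have hφc : Continuous (prodMap (d := d) φ) := (contDiff_prodMap hφ.smooth).continuous
  have hlim := tendsto_integral_envelope hd m hbG hcont hG.compact.mul_left hφc
  refine false_of_enorm_mul_le (m := m) (s := d * (1 / 2 - (q⁻¹).toReal))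
    (C := A₂ * (A₃ * (N p b).toNNReal * A₁)) ?_ ?_ hlim fun l hl => ?_
  -- Since $1/2-1/q=1/p-1/2=|1/2-1/p|$, the hypothesis on `m` is exactly $m+s>0$.
  · rw [hqt]
    rw [abs_of_nonpos (by linarith)] at hm
    linarith
  · rw [Complex.ofReal_ne_zero]
    have hd0 : (0 : ℝ) < d := by exact_mod_cast hd
    refine (mul_pos (Real.rpow_pos_of_pos hd0 _) ?_).ne'
    -- The limit integrand is nonnegative, and at this point of the open cube both cutoff factors
    -- equal $1$ because $\tilde\varphi$ preserves the cube.
    obtain ⟨x, hx, hx01⟩ := exists_tensorPow_ne_zero (d := d) hθs hθne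
    refine Continuous.integral_pos_of_hasCompactSupport_nonneg_nonzero (x := x)
      (hcont.mul (hG.smooth.continuous.comp hφc)) (hG.compact.mul_left.mul_right) (fun x => ?_) ?_
    · exact mul_nonneg (mul_nonneg (Finset.prod_nonneg fun i _ => hθ0 _) (hG.nonneg _))
        (hG.nonneg _)
    · rw [hG1 _ (prodMap_mem_Icc hφ hx01), hG1 _ fun i => Ioo_subset_Icc_self (hx01 i), mul_one,
        mul_one]
      exact hx
  · have hl0 : 0 < l := by linarith
    rw [← hpair l hl0]
    refine (hA₂ (w l) (k l)).trans ?_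
    have h1 : N p (w l) ≤ A₃ * N p b := by
      rw [← hN.modulation p l b (f l) (hfb l)]
      exact hA₃ (f l) (w l) (tsupport_chirp_subset hG.smooth hG.compact contDiff_id l) (hTw l)
    have h2 := hA₁ l hl0
    have h3 : ((N p b).toNNReal : ℝ≥0∞) = N p b := ENNReal.coe_toNNReal (hN.lt_top p hp1 b).ne
    calc (A₂ : ℝ≥0∞) * (N p (w l) * N q (k l))
        ≤ A₂ * (A₃ * N p b * (A₁ * ENNReal.ofReal (l ^ (-((d : ℝ) * (1 / 2 - (q⁻¹).toReal)))))) := by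
          gcongr
      _ = _ := by
          push_cast
          rw [h3]
          ring

/-- The dual argument: the input is the chirp, whose norm in the exponent $p\ge2$ decays. The
inverse change of variables straightens it into a packet with oscillation $e_l$, on which $\langle
D\rangle^m$ acts like $l^m$, and the output is tested against $Ge_l$, of constant norm in the
conjugate exponent. -/
theorem not_isLocallyBounded_opFtilde (hd : 0 < d) {φ : ℝ ≃ ℝ} (hφ : IsNonlinearDiffeo φ)
    {G : E d → ℝ} (hG : IsCutoff G) (hG1 : ∀ x, (∀ i, x i ∈ Icc (0 : ℝ) 1) → G x = 1)
    {H : E d → ℝ} (hH : IsCutoff H)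
    (hH1 : ∀ x ∈ tsupport (fun y => G (prodMap φ.symm y)), H x = 1)
    {N : ℝ≥0∞ → 𝓢(E d, ℂ) → ℝ≥0∞} (hN : IsDualScale N) {p : ℝ≥0∞} (hp2 : 2 ≤ p)
    {m : ℝ} (hm : -(d : ℝ) * |1 / 2 - (p⁻¹).toReal| < m) :
    ¬ IsLocallyBounded (N p) (opFtilde m φ G H) := by
  intro hT
  obtain ⟨θ, hθ, hθc, hθ0, hθs, hθne, B, hB, hle⟩ := exists_bump_norm_fourier_chirp_le (d := d) hφ
  have hp1 : 1 ≤ p := one_le_two.trans hp2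
  set q : ℝ≥0∞ := (1 - p⁻¹)⁻¹ with hq
  have hpq : ENNReal.HolderConjugate p q := ENNReal.HolderConjugate.inv_one_sub_inv' hp1
  have hq1 : 1 ≤ q := by rw [hq, ENNReal.one_le_inv]; exact tsub_le_self
  have hp12 : (p⁻¹).toReal ≤ 1 / 2 := by
    have := ENNReal.toReal_mono (by simp) (ENNReal.inv_le_inv.2 hp2)
    simpa using this
  have hθC := contDiff_tensorPow (d := d) hθ
  have hθK := hasCompactSupport_tensorPow (d := d) hθc
  obtain ⟨A₁, hA₁⟩ := hN.exists_le_of_norm_fourier_le hp2 hB hle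
    (M := (eLpNorm (tensorPow (d := d) θ) 2 volume).toNNReal) fun l => by
      rw [eLpNorm_chirp, ENNReal.coe_toNNReal]
      exact (hθC.continuous.memLp_of_hasCompactSupport hθK).2.ne
  obtain ⟨A₂, hA₂⟩ := hN.pairing p q
  obtain ⟨A₃, hA₃⟩ := hT (tsupport (tensorPow (d := d) θ)) hθK
  set k : ℝ → 𝓢(E d, ℂ) := fun l => chirp hθC hθK hφ.smooth l with hkdef
  set f : ℝ → 𝓢(E d, ℂ) := fun l => chirp hG.smooth hG.compact contDiff_id l with hf
  have hfb : ∀ l x, f l x = f 0 x * wave l x := fun l x => by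
    rw [hf]
    simp only
    rw [chirp_id_zero_apply hG.smooth hG.compact]
    exact chirp_id_apply hG.smooth hG.compact l x
  have haC := contDiff_adjointAmplitude hφ hG.smooth
  have haK := hasCompactSupport_adjointAmplitude hφ hG.compact
  set u : ℝ → 𝓢(E d, ℂ) := fun l => twist hφ.smooth_symm haC haK (k l) with hu
  -- The profile of the straightened chirp, $T^*(Gk_l)=\beta\,e_l$, independent of `l`.
  set β : E d → ℝ := fun y => |∏ i, deriv φ (φ.symm (y i))|⁻¹ * G (prodMap φ.symm y) *
    tensorPow θ (prodMap φ.symm y) with hβ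
  have hul : ∀ l y, u l y = (β y : ℂ) * wave l y := fun l y => by
    rw [hu]
    simp only
    rw [twist_apply, chirp_apply, adjointAmplitude, prodMap_prodMap_symm, hβ]
    push_cast
    ring
  have hu0 : ∀ y, u 0 y = β y := fun y => by rw [hul, wave_zero, mul_one]
  have huw : ∀ l y, u l y = u 0 y * wave l y := fun l y => by rw [hul, hu0]
  -- Multiplication by `H` is a twisted product with the identity map, so the output is again a
  -- Schwartz function.
  have hid : ContDiff ℝ ∞ (fun t : ℝ => t) := contDiff_id
  set w : ℝ → 𝓢(E d, ℂ) := fun l => twist hid hH.contDiff_ofReal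
    hH.hasCompactSupport_ofReal (japDSchwartz m (u l)) with hw
  have hTw : ∀ l, opFtilde m φ G H (k l) = w l := fun l => by
    funext x
    rw [hw, twist_apply, coe_japDSchwartz, opFtilde, compAdjoint_eq hφ]
    rfl
  have hwl : ∀ l x, w l x = (H x : ℂ) * japD m (u l) x := fun l x => by
    rw [hw, twist_apply, coe_japDSchwartz, prodMap_id]
  have hpair : ∀ l, 0 < l → ∫ x, (starRingEnd ℂ) (f l x) * w l x = ((l ^ m : ℝ) : ℂ) *
      ∫ x, ((G x * H x : ℝ) : ℂ) * envelope m (u 0) l (id x) := fun l hl => by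
    rw [← integral_const_mul]
    refine integral_congr_ae (Eventually.of_forall fun x => ?_)
    simp only [id]
    rw [hwl, japD_mul_wave m hl (huw l), chirp_id_apply, map_mul, Complex.conj_ofReal]
    have := conj_wave_mul l x
    push_cast
    linear_combination ((G x : ℂ) * H x * (l ^ m : ℝ) * envelope m (u 0) l x) * this
  have hcont : Continuous fun x : E d => G x * H x := hG.smooth.continuous.mul hH.smooth.continuous
  have hlim := tendsto_integral_envelope hd m hu0 hcont hG.compact.mul_right continuous_id
  refine false_of_enorm_mul_le (m := m) (s := d * (1 / 2 - (p⁻¹).toReal))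
    (C := A₂ * (A₃ * A₁ * (N q (f 0)).toNNReal)) ?_ ?_ hlim fun l hl => ?_
  · rw [abs_of_nonneg (by linarith)] at hm
    linarith
  · rw [Complex.ofReal_ne_zero]
    have hd0 : (0 : ℝ) < d := by exact_mod_cast hd
    refine (mul_pos (Real.rpow_pos_of_pos hd0 _) ?_).ne'
    obtain ⟨x, hx, hx01⟩ := exists_tensorPow_ne_zero (d := d) hθs hθne
    have hβc : Continuous β := by
      have : β = fun y => (u 0 y).re := funext fun y => by rw [hu0, Complex.ofReal_re]
      rw [this]
      exact Complex.continuous_re.comp (u 0).continuous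
    have hGx : G x = 1 := hG1 _ fun i => Ioo_subset_Icc_self (hx01 i)
    refine Continuous.integral_pos_of_hasCompactSupport_nonneg_nonzero (x := prodMap φ x)
      (hcont.mul (hβc.comp continuous_id)) (hG.compact.mul_right.mul_right) (fun x => ?_) ?_
    · exact mul_nonneg (mul_nonneg (hG.nonneg _) (hH.nonneg _)) (mul_nonneg (mul_nonneg
        (by positivity) (hG.nonneg _)) (Finset.prod_nonneg fun i _ => hθ0 _))
    · simp only [id, hβ]
      rw [prodMap_symm_prodMap, hGx, hG1 _ (prodMap_mem_Icc hφ hx01), hH1, one_mul, one_mul, mul_one]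
      · exact mul_ne_zero (inv_ne_zero (abs_ne_zero.2 (Finset.prod_ne_zero_iff.2
          fun i _ => hφ.deriv_ne_zero _))) hx
      · refine subset_tsupport _ ?_
        rw [Function.mem_support, prodMap_symm_prodMap, hGx]
        exact one_ne_zero
  · have hl0 : 0 < l := by linarith
    rw [← hpair l hl0]
    refine (hA₂ (w l) (f l)).trans ?_
    have h1 : N p (w l) ≤ A₃ * N p (k l) :=
      hA₃ (k l) (w l) (tsupport_chirp_subset hθC hθK hφ.smooth l) (hTw l)
    have h2 := hA₁ l hl0
    have h3 : ((N q (f 0)).toNNReal : ℝ≥0∞) = N q (f 0) :=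
      ENNReal.coe_toNNReal (hN.lt_top q hq1 _).ne
    calc (A₂ : ℝ≥0∞) * (N p (w l) * N q (f l))
        ≤ A₂ * (A₃ * (A₁ * ENNReal.ofReal (l ^ (-((d : ℝ) * (1 / 2 - (p⁻¹).toReal))))) *
            N q (f 0)) := by
          rw [hN.modulation q l (f 0) (f l) (hfb l)]
          gcongr
          exact h1.trans (by gcongr)
      _ = _ := by
          push_cast
          rw [h3]
          ring

theorem ExtendsToFLComp.isLocallyBounded {p : ℝ≥0∞} [Fact (1 ≤ p)] {T : 𝓢(E d, ℂ) → E d → ℂ}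
    (hT : ExtendsToFLComp p T) :
    IsLocallyBounded (fun f => eLpNorm (𝓕 f : 𝓢(E d, ℂ)) p volume) T :=
  fun _ hK => hT.exists_bound hK

theorem ExtendsToMod.isLocallyBounded {g : 𝓢(E d, ℂ)} {p : ℝ≥0∞} [Fact (1 ≤ p)]
    {T : 𝓢(E d, ℂ) → E d → ℂ} (hT : ExtendsToMod g p T) :
    IsLocallyBounded (fun f => modNorm g p (f : 𝓢'(E d, ℂ))) T :=
  fun _ _ => hT.exists_bound.imp fun _ hC f w _ => hC f w

end Unbounded

/-! ### Existence of the data -/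

section Existence

open Filter Topology

variable {d : ℕ}

theorem exists_isCutoff_eq_one {K : Set (E d)} (hK : IsCompact K) :
    ∃ G : E d → ℝ, IsCutoff G ∧ ∀ x ∈ K, G x = 1 := by
  obtain ⟨R, hR, hKR⟩ := hK.isBounded.subset_closedBall_lt 0 0
  let f : ContDiffBump (0 : E d) := ⟨R, R + 1, hR, by linarith⟩
  exact ⟨f, ⟨f.contDiff, f.hasCompactSupport, fun x => f.nonneg⟩,
    fun x hx => f.one_of_mem_closedBall (hKR hx)⟩

/-- A sinusoidal perturbation of the identity of the line. -/
def wiggle (t : ℝ) : ℝ := t + Real.sin (2 * Real.pi * t) / (4 * Real.pi)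

theorem hasDerivAt_wiggle (t : ℝ) :
    HasDerivAt wiggle (1 + Real.cos (2 * Real.pi * t) / 2) t := by
  have h := ((Real.hasDerivAt_sin (2 * Real.pi * t)).comp t
    ((hasDerivAt_id t).const_mul (2 * Real.pi))).div_const (4 * Real.pi)
  refine ((hasDerivAt_id t).add h).congr_deriv ?_
  have := Real.pi_ne_zero
  field_simp
  ring

theorem contDiff_wiggle : ContDiff ℝ ∞ wiggle := by
  unfold wiggle
  exact contDiff_id.add ((Real.contDiff_sin.comp (contDiff_const.mul contDiff_id)).div_const _)

/-- The map $t+\sin(2\pi t)/4\pi$ fixes $0$ and $1$, has derivative between $1/2$ and $3/2$, and has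
second derivative $-\pi\sin(2\pi t)$, of modulus $\pi$ at $t=1/4$ and hence larger than $1$ nearby.
-/
theorem exists_isNonlinearDiffeo : ∃ φ : ℝ ≃ ℝ, IsNonlinearDiffeo φ := by
  have hderiv : deriv wiggle = fun t => 1 + Real.cos (2 * Real.pi * t) / 2 :=
    funext fun t => (hasDerivAt_wiggle t).deriv
  have hlow : ∀ t, 1 / 2 ≤ 1 + Real.cos (2 * Real.pi * t) / 2 := fun t => by
    linarith [Real.neg_one_le_cos (2 * Real.pi * t)]
  have hup : ∀ t, 1 + Real.cos (2 * Real.pi * t) / 2 ≤ 3 / 2 := fun t => by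
    linarith [Real.cos_le_one (2 * Real.pi * t)]
  have hmono : StrictMono wiggle := strictMono_of_deriv_pos fun t => by
    rw [hderiv]; linarith [hlow t]
  have hpi := Real.pi_gt_three
  have hdist : ∀ t, |wiggle t - t| ≤ 1 := fun t => by
    rw [wiggle, add_sub_cancel_left, abs_div, abs_of_pos (a := 4 * Real.pi) (by positivity),
      div_le_one (by positivity)]
    linarith [Real.abs_sin_le_one (2 * Real.pi * t)]
  have hsurj : Function.Surjective wiggle := contDiff_wiggle.continuous.surjective
    (tendsto_atTop_mono (fun t => by linarith [(abs_le.1 (hdist t)).1] : ∀ t, t - 1 ≤ wiggle t)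
      (tendsto_atTop_add_const_right _ (-1) tendsto_id))
    (tendsto_atBot_mono (fun t => by linarith [(abs_le.1 (hdist t)).2] : ∀ t, wiggle t ≤ t + 1)
      (tendsto_atBot_add_const_right _ 1 tendsto_id))
  set e : ℝ ≃o ℝ := hmono.orderIsoOfSurjective wiggle hsurj with he
  have hcoe : (e : ℝ → ℝ) = wiggle := rfl
  refine ⟨e.toEquiv, ?_, ?_, ?_, ?_, ⟨1 / 2, 3 / 2, by norm_num, fun t => ?_⟩⟩
  · exact contDiff_wiggle
  · exact e.toHomeomorph.contDiff_symm_deriv (fun t => (by linarith [hlow t] :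
      1 + Real.cos (2 * Real.pi * t) / 2 ≠ 0)) hasDerivAt_wiggle contDiff_wiggle
  · have h := e.image_Ioo 0 1
    rw [hcoe] at h
    have h0 : wiggle 0 = 0 := by simp [wiggle]
    have h1 : wiggle 1 = 1 := by simp [wiggle]
    rw [h0, h1] at h
    exact h
  · have h2 : iteratedDeriv 2 wiggle = fun t => -(Real.pi * Real.sin (2 * Real.pi * t)) := by
      rw [iteratedDeriv_succ, iteratedDeriv_one, hderiv]
      funext t
      have h := ((Real.hasDerivAt_cos (2 * Real.pi * t)).comp t
        ((hasDerivAt_id t).const_mul (2 * Real.pi))).div_const 2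
      refine (h.const_add 1).deriv.trans ?_
      ring
    have hev : ∀ᶠ t in 𝓝 (1 / 4 : ℝ), 1 < |iteratedDeriv 2 wiggle t| ∧ t ∈ Ioo (0 : ℝ) 1 := by
      refine ((Continuous.tendsto ?_ _).eventually_const_lt ?_).and
        (Ioo_mem_nhds (by norm_num) (by norm_num))
      · rw [h2]; fun_prop
      · rw [h2]
        have : 2 * Real.pi * (1 / 4) = Real.pi / 2 := by ring
        simp only [this, Real.sin_pi_div_two, mul_one, abs_neg, abs_of_pos Real.pi_pos]
        linarith
    obtain ⟨ε, hε, hball⟩ := Metric.eventually_nhds_iff_ball.1 hev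
    have hmem : ∀ t, |t - 1 / 4| < ε → t ∈ Metric.ball (1 / 4 : ℝ) ε := fun t ht => by
      rwa [Metric.mem_ball, Real.dist_eq]
    have ha := (hball (1 / 4 - ε / 2) (hmem _ (by rw [abs_lt]; constructor <;> linarith))).2
    have hb := (hball (1 / 4 + ε / 2) (hmem _ (by rw [abs_lt]; constructor <;> linarith))).2
    exact ⟨1 / 4 - ε / 2, 1 / 4 + ε / 2, 1, ha.1.le, by linarith, hb.2.le, one_pos, fun t ht =>
      (hball t (hmem t (by rw [abs_lt]; constructor <;> linarith [ht.1, ht.2]))).1.le⟩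
  · have : deriv e.toEquiv t = 1 + Real.cos (2 * Real.pi * t) / 2 := (hasDerivAt_wiggle t).deriv
    rw [this, abs_of_pos (by linarith [hlow t])]
    exact ⟨hlow t, hup t⟩

end Existence

end FourierInt

end

/-! ### The theorem: explicit operators for every admissible `φ`, and an instance of them -/

theorem mainTheorem3 (d : ℕ) (hd : 1 ≤ d) (p : ℝ≥0∞) [Fact (1 ≤ p)] (m : ℝ)
    (hm : -(d : ℝ) * |1 / 2 - (p⁻¹).toReal| < m) :
    (∃ (Φ : FourierInt.E d → FourierInt.E d → ℝ) (σ : FourierInt.E d → FourierInt.E d → ℂ) (T : 𝓢(FourierInt.E d, ℂ) → FourierInt.E d → ℂ),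
      (∀ x, IsLinearMap ℝ (Φ x)) ∧ FourierInt.IsFourierIntegral m Φ σ T ∧
      ¬ FourierInt.ExtendsToFLComp p T ∧
      ∀ g : 𝓢(FourierInt.E d, ℂ), g ≠ 0 → ¬ FourierInt.ExtendsToMod g p T) ∧
    ∀ φ : ℝ ≃ ℝ, FourierInt.IsNonlinearDiffeo φ →
    ∀ G : FourierInt.E d → ℝ, FourierInt.IsCutoff G → (∀ x, (∀ i, x i ∈ Icc (0 : ℝ) 1) → G x = 1) →
      (p ≤ 2 →
        FourierInt.IsFourierIntegral m (FourierInt.linearPhase (FourierInt.prodMap φ))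
          (fun x η => (G x : ℂ) * (FourierInt.bracket m η : ℂ)) (FourierInt.opF m φ G) ∧
        ¬ FourierInt.ExtendsToFLComp p (FourierInt.opF m φ G) ∧
        ∀ g : 𝓢(FourierInt.E d, ℂ), g ≠ 0 → ¬ FourierInt.ExtendsToMod g p (FourierInt.opF m φ G)) ∧
      (2 < p →
        ∀ H : FourierInt.E d → ℝ, FourierInt.IsCutoff H →
        (∀ x ∈ tsupport (fun y => G (FourierInt.prodMap φ.symm y)), H x = 1) →
          (∃ σ, FourierInt.IsFourierIntegral m (FourierInt.linearPhase (FourierInt.prodMap φ.symm)) σ (FourierInt.opFtilde m φ G H)) ∧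
          ¬ FourierInt.ExtendsToFLComp p (FourierInt.opFtilde m φ G H) ∧
          ∀ g : 𝓢(FourierInt.E d, ℂ), g ≠ 0 → ¬ FourierInt.ExtendsToMod g p (FourierInt.opFtilde m φ G H)) := by
  have hd0 : 0 < d := hd
  have hp1 : 1 ≤ p := Fact.out
  have main : ∀ φ : ℝ ≃ ℝ, FourierInt.IsNonlinearDiffeo φ →
      ∀ G : FourierInt.E d → ℝ, FourierInt.IsCutoff G →
      (∀ x, (∀ i, x i ∈ Icc (0 : ℝ) 1) → G x = 1) →
      (p ≤ 2 →
        FourierInt.IsFourierIntegral m (FourierInt.linearPhase (FourierInt.prodMap φ))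
          (fun x η => (G x : ℂ) * (FourierInt.bracket m η : ℂ)) (FourierInt.opF m φ G) ∧
        ¬ FourierInt.ExtendsToFLComp p (FourierInt.opF m φ G) ∧
        ∀ g : 𝓢(FourierInt.E d, ℂ), g ≠ 0 → ¬ FourierInt.ExtendsToMod g p (FourierInt.opF m φ G)) ∧
      (2 < p →
        ∀ H : FourierInt.E d → ℝ, FourierInt.IsCutoff H →
        (∀ x ∈ tsupport (fun y => G (FourierInt.prodMap φ.symm y)), H x = 1) →
          (∃ σ, FourierInt.IsFourierIntegral m
            (FourierInt.linearPhase (FourierInt.prodMap φ.symm)) σ (FourierInt.opFtilde m φ G H)) ∧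
          ¬ FourierInt.ExtendsToFLComp p (FourierInt.opFtilde m φ G H) ∧
          ∀ g : 𝓢(FourierInt.E d, ℂ), g ≠ 0 →
            ¬ FourierInt.ExtendsToMod g p (FourierInt.opFtilde m φ G H)) := by
    intro φ hφ G hG hG1
    refine ⟨fun hp2 => ⟨FourierInt.isFourierIntegral_opF hφ hG m, fun h => ?_, fun g hg h => ?_⟩,
      fun hp2 H hH hH1 => ⟨FourierInt.exists_isFourierIntegral_opFtilde hd0 m hφ hG hH,
        fun h => ?_, fun g hg h => ?_⟩⟩
    · exact FourierInt.not_isLocallyBounded_opF hd0 hφ hG hG1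
        FourierInt.isDualScale_eLpNorm_fourier hp1 hp2 hm h.isLocallyBounded
    · exact FourierInt.not_isLocallyBounded_opF hd0 hφ hG hG1
        (FourierInt.isDualScale_modNorm hg) hp1 hp2 hm h.isLocallyBounded
    · exact FourierInt.not_isLocallyBounded_opFtilde hd0 hφ hG hG1 hH hH1
        FourierInt.isDualScale_eLpNorm_fourier hp2.le hm h.isLocallyBounded
    · exact FourierInt.not_isLocallyBounded_opFtilde hd0 hφ hG hG1 hH hH1
        (FourierInt.isDualScale_modNorm hg) hp2.le hm h.isLocallyBounded
  refine ⟨?_, main⟩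
  obtain ⟨φ, hφ⟩ := FourierInt.exists_isNonlinearDiffeo
  obtain ⟨G, hG, hG1⟩ := FourierInt.exists_isCutoff_eq_one
    (FourierInt.isCompact_setOf_coord_mem (d := d) (isCompact_Icc (a := (0 : ℝ)) (b := 1)))
  rcases le_or_gt p 2 with hp2 | hp2
  · exact ⟨_, _, _, FourierInt.isLinearMap_linearPhase _, (main φ hφ G hG hG1).1 hp2⟩
  · obtain ⟨H, hH, hH1⟩ := FourierInt.exists_isCutoff_eq_one
      (FourierInt.hasCompactSupport_comp_prodMap_symm hφ hG.compact)
    obtain ⟨⟨σ, hσ⟩, h1, h2⟩ := (main φ hφ G hG hG1).2 hp2 H hH hH1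
    exact ⟨_, σ, _, FourierInt.isLinearMap_linearPhase _, hσ, h1, h2⟩
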